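/- Let $n\ge 1$, $\gamma>0$, $\gamma'<\gamma$ and $0<a'<a<b$ be such that the rectangle $\Omega=(a',a)+i(-\gamma',b)$ satisfies $\Omega\Subset\{\lambda\in\mathbb C\setminus\{0\}:-\pi/8<\arg\lambda<7\pi/8\}$, where $A\Subset U$ means that $\overline A$ is compact and contained in $U$. Fix $\rho\in C^\infty([0,\infty);\mathbb R)$ with $\rho\equiv 0$ near $0$, $\rho(t)=1$ for all large $t$, $0\le\rho'(t)<\gamma^{-1}\tan(\pi/8)$ for all $t\ge 0$, and $\Omega\Subset\{x+iy:x>0,\ y>-\gamma\rho(x)\}$. Put $\psi(\xi)=|\xi|^{-1}\rho(|\xi|)\,\xi$ for $\xi\in\mathbb R^n$ and, for $\theta\in\mathbb C$ with $|\operatorname{Re}\theta|+|\operatorname{Im}\theta|<\gamma$, $\phi_\theta(\xi)=\xi+\theta\psi(\xi)$, $\phi_\theta(\xi)^2=\sum_j\phi_\theta(\xi)_j^2$, $D\phi_\theta=I+\theta D\psi$, $J_\theta=\det D\phi_\theta=(1+\theta\rho'(|\xi|))(1+\theta|\xi|^{-1}\rho(|\xi|))^{n-1}$, $J^{lj}=[(D\phi_\theta)^{-1}]_{jl}$.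 For $\epsilon>0$ let $Q_{\epsilon,\theta}$ be the operator $$Q_{\epsilon,\theta}=\phi_\theta(\xi)^2-i\epsilon\sum_{j,k,l}J_\theta^{-1/2}D_{\xi_l}J^{lj}J_\theta J^{kj}D_{\xi_k}J_\theta^{-1/2},\qquad D_{\xi_k}=-i\partial_{\xi_k},$$ on $L^2(\mathbb R^n)$, with domain the set of $u\in L^2(\mathbb R^n)$ for which $Q_{\epsilon,\theta}u$, taken in the sense of distributions, lies in $L^2(\mathbb R^n)$; here $J_\theta^{1/2}$ is the branch that is analytic in $\theta$ and positive for real $\theta$. Then for every $\beta\in(\gamma',\gamma)$ with $\beta>-\gamma$ (automatic if $\gamma'\ge 0$) and $$\Omega\Subset\{x+iy:x>0,\ y>-\beta\rho(x)\}$$ there is $\epsilon_0>0$ such that for all $0<\epsilon<\epsilon_0$ $$\sigma(Q_{\epsilon,-i\beta})\cap\{\lambda^2:\lambda\in\Omega\}=\emptyset .$$ -/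

import Mathlib

open MeasureTheory
open scoped ContDiff

namespace CAP

/-- The real Euclidean space `ℝⁿ` (the space of the frequency variable `ξ`). -/
abbrev E (n : ℕ) : Type := EuclideanSpace ℝ (Fin n)

/-- The complex Hilbert space `L²(ℝⁿ)`. -/
abbrev L2 (n : ℕ) : Type := Lp ℂ 2 (volume : Measure (E n))

/-! ### Regions of the complex plane -/

/-- The open rectangle `(a', a) + i (-γ', b)`. -/
def rect (a' a γ' b : ℝ) : Set ℂ :=
  {l | a' < l.re ∧ l.re < a ∧ -γ' < l.im ∧ l.im < b}

/-- The open sector `-π/8 < arg λ < 7π/8` (without its vertex). -/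
def sector : Set ℂ :=
  {l | l ≠ 0 ∧ -(Real.pi / 8) < l.arg ∧ l.arg < 7 * Real.pi / 8}

/-- The region `{x + iy : x > 0, y > -s ρ(x)}`. -/
def regionAbove (s : ℝ) (ρ : ℝ → ℝ) : Set ℂ :=
  {l | 0 < l.re ∧ -(s * ρ l.re) < l.im}

/-- `A ⋐ U`: the closure of `A` is compact and contained in `U`. -/
def CompactlyIn (A U : Set ℂ) : Prop := IsCompact (closure A) ∧ closure A ⊆ U

/-- `ρ ∈ C^∞([0,∞); ℝ)`, `ρ ≡ 0` near `0`, `ρ(t) ≡ 1` for large `t`, and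
`0 ≤ ρ'(t) < γ⁻¹ tan(π/8)` for all `t ≥ 0`.  The values of `ρ` on the negative half line are never
used (`deriv ρ 0 = 0` whatever they are, because `ρ` vanishes to the right of `0`). -/
structure IsProfile (γ : ℝ) (ρ : ℝ → ℝ) : Prop where
  smooth : ContDiffOn ℝ ∞ ρ (Set.Ici 0)
  zero_near : ∃ r > 0, ∀ t, 0 ≤ t → t ≤ r → ρ t = 0
  one_far : ∃ R, ∀ t, R ≤ t → ρ t = 1
  deriv_nonneg : ∀ t, 0 ≤ t → 0 ≤ deriv ρ t
  deriv_lt : ∀ t, 0 ≤ t → deriv ρ t < γ⁻¹ * Real.tan (Real.pi / 8)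

/-! ### The deformation `φ_θ(ξ) = ξ + θ ψ(ξ)` -/

variable {n : ℕ}

/-- `ψ(ξ) = |ξ|⁻¹ ρ(|ξ|) ξ`. -/
noncomputable def psi (ρ : ℝ → ℝ) (ξ : E n) : E n := (‖ξ‖⁻¹ * ρ ‖ξ‖) • ξ

/-- The Jacobian matrix `Dψ(ξ)`, with entries `∂_k ψ_j(ξ)`. -/
noncomputable def Dpsi (ρ : ℝ → ℝ) (ξ : E n) : Matrix (Fin n) (Fin n) ℝ :=
  Matrix.of fun j k => (fderiv ℝ (psi ρ) ξ (EuclideanSpace.single k 1)) j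

/-- `φ_θ(ξ) = ξ + θ ψ(ξ) ∈ ℂⁿ`, for complex `θ`. -/
noncomputable def phi (ρ : ℝ → ℝ) (θ : ℂ) (ξ : E n) : Fin n → ℂ :=
  fun j => (ξ j : ℂ) + θ * ((psi ρ ξ) j : ℂ)

/-- `φ_θ(ξ)² = φ_θ(ξ) · φ_θ(ξ)` (bilinear, no complex conjugation). -/
noncomputable def phiSq (ρ : ℝ → ℝ) (θ : ℂ) (ξ : E n) : ℂ := ∑ j, phi ρ θ ξ j ^ 2

/-- `Dφ_θ(ξ) = I + θ Dψ(ξ)`, for complex `θ`. -/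
noncomputable def Dphi (ρ : ℝ → ℝ) (θ : ℂ) (ξ : E n) : Matrix (Fin n) (Fin n) ℂ :=
  1 + θ • (Dpsi ρ ξ).map (fun x : ℝ => (x : ℂ))

/-- `J_θ(ξ) = det Dφ_θ(ξ)`. -/
noncomputable def jac (ρ : ℝ → ℝ) (θ : ℂ) (ξ : E n) : ℂ := (Dphi ρ θ ξ).det

/-- The square root `J_θ(ξ)^{1/2}` of
`J_θ(ξ) = (1 + θ ρ'(|ξ|)) (1 + θ |ξ|⁻¹ ρ(|ξ|))^{n-1}` which is holomorphic in `θ` and positive for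
real `θ`.  Both factors lie in the right half plane for the `θ` in use, so each of them has its
principal root; the principal root of the product would be discontinuous in `ξ` for large `n`. -/
noncomputable def sqrtJac (ρ : ℝ → ℝ) (θ : ℂ) (ξ : E n) : ℂ :=
  (1 + θ * ((deriv ρ ‖ξ‖ : ℝ) : ℂ)) ^ (1 / 2 : ℂ) *
    ((1 + θ * ((‖ξ‖⁻¹ * ρ ‖ξ‖ : ℝ) : ℂ)) ^ (1 / 2 : ℂ)) ^ (n - 1)

/-! `sqrtJac` is indeed a square root of `J_θ`. -/

theorem Dpsi_zero {γ : ℝ} {ρ : ℝ → ℝ} (hρ : IsProfile γ ρ) : Dpsi ρ (0 : E n) = 0 := by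
  obtain ⟨r, hr, h⟩ := hρ.zero_near
  have : psi (n := n) ρ =ᶠ[nhds 0] fun _ => 0 := by
    filter_upwards [Metric.ball_mem_nhds (0 : E n) hr] with ξ hξ
    simp only [mem_ball_zero_iff] at hξ
    simp [psi, h _ (norm_nonneg _) hξ.le]
  ext j k
  simp [Dpsi, this.fderiv_eq]

theorem Dpsi_of_ne {γ : ℝ} {ρ : ℝ → ℝ} (hρ : IsProfile γ ρ) {ξ : E n} (hξ : ξ ≠ 0) :
    Dpsi ρ ξ = (‖ξ‖⁻¹ * ρ ‖ξ‖) • (1 : Matrix (Fin n) (Fin n) ℝ) +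
      ((‖ξ‖ ^ 2)⁻¹ * deriv ρ ‖ξ‖ - (‖ξ‖ ^ 3)⁻¹ * ρ ‖ξ‖) • Matrix.vecMulVec ξ ξ := by
  have hr : 0 < ‖ξ‖ := norm_pos_iff.mpr hξ
  have hd : HasDerivAt ρ (deriv ρ ‖ξ‖) ‖ξ‖ :=
    ((hρ.smooth.contDiffAt (Ici_mem_nhds hr)).differentiableAt (by simp)).hasDerivAt
  have hg : HasDerivAt (fun t => t⁻¹ * ρ t)
      (-(‖ξ‖ ^ 2)⁻¹ * ρ ‖ξ‖ + ‖ξ‖⁻¹ * deriv ρ ‖ξ‖) ‖ξ‖ := (hasDerivAt_inv hr.ne').mul hd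
  have hn : HasFDerivAt (fun x : E n => ‖x‖) (‖ξ‖⁻¹ • innerSL ℝ ξ) ξ := by
    have h1 := (((hasStrictFDerivAt_norm_sq ξ).hasFDerivAt).sqrt (pow_ne_zero 2 hr.ne'))
    simp only [Real.sqrt_sq (norm_nonneg _)] at h1
    refine h1.congr_fderiv ?_
    ext y
    simp only [smul_apply, smul_eq_mul, nsmul_eq_mul]
    push_cast
    field_simp
  have hpsi := (hg.comp_hasFDerivAt ξ hn).smul (hasFDerivAt_id ξ)
  have : fderiv ℝ (psi ρ) ξ = _ := hpsi.fderiv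
  ext j k
  simp only [Dpsi, Matrix.of_apply, this]
  by_cases hjk : j = k
  · subst hjk
    simp [Matrix.vecMulVec_apply, EuclideanSpace.inner_single_right]
    field_simp
    ring
  · simp [Matrix.vecMulVec_apply, EuclideanSpace.inner_single_right, hjk]
    field_simp
    ring

theorem sqrtJac_sq {γ : ℝ} {ρ : ℝ → ℝ} (hρ : IsProfile γ ρ) (hn : 1 ≤ n) (θ : ℂ) (ξ : E n) :
    sqrtJac ρ θ ξ ^ 2 = jac ρ θ ξ := by
  have hsq : ∀ z : ℂ, (z ^ (1 / 2 : ℂ)) ^ 2 = z := fun z => by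
    rw [← Complex.cpow_nat_mul]; norm_num
  have hJ : sqrtJac ρ θ ξ ^ 2 = (1 + θ * ((deriv ρ ‖ξ‖ : ℝ) : ℂ)) *
      (1 + θ * ((‖ξ‖⁻¹ * ρ ‖ξ‖ : ℝ) : ℂ)) ^ (n - 1) := by
    rw [sqrtJac, mul_pow, hsq, ← pow_mul, mul_comm (n - 1), pow_mul, hsq]
  rw [hJ]
  by_cases hξ : ξ = 0
  · subst hξ
    obtain ⟨r, hr, h⟩ := hρ.zero_near
    have hd : deriv ρ 0 = 0 := by
      by_cases hdiff : DifferentiableAt ℝ ρ 0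
      · rw [← hdiff.derivWithin (uniqueDiffOn_Ici (0 : ℝ) 0 (by simp))]
        have : ρ =ᶠ[nhdsWithin 0 (Set.Ici 0)] fun _ => 0 := by
          filter_upwards [self_mem_nhdsWithin, mem_nhdsWithin_of_mem_nhds (Iic_mem_nhds hr)]
            with t ht ht'
          exact h t ht ht'
        rw [this.derivWithin_eq (h 0 le_rfl hr.le)]
        simp
      · exact deriv_zero_of_not_differentiableAt hdiff
    simp [jac, Dphi, Dpsi_zero hρ, hd]
  · have hr : (‖ξ‖ : ℂ) ≠ 0 := by simpa using hξ
    set c : ℂ := 1 + θ * ((‖ξ‖⁻¹ * ρ ‖ξ‖ : ℝ) : ℂ) with hc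
    set d : ℂ := θ * (((‖ξ‖ ^ 2)⁻¹ * deriv ρ ‖ξ‖ - (‖ξ‖ ^ 3)⁻¹ * ρ ‖ξ‖ : ℝ) : ℂ) with hd
    have hM : Dphi ρ θ ξ = Matrix.scalar (Fin n) c -
        Matrix.vecMulVec (fun j => -d * (ξ j : ℂ)) (fun j => (ξ j : ℂ)) := by
      ext j k
      rw [Dphi, Dpsi_of_ne hρ hξ]
      by_cases hjk : j = k
      · subst hjk
        simp [Matrix.vecMulVec_apply, hc, hd]
        ring
      · simp [Matrix.vecMulVec_apply, hc, hd, hjk]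
        ring
    have hnorm : ∑ j, (ξ j : ℂ) * (ξ j : ℂ) = (‖ξ‖ : ℂ) ^ 2 := by
      have := EuclideanSpace.real_norm_sq_eq ξ
      rw [← Complex.ofReal_pow, this]
      push_cast
      exact Finset.sum_congr rfl fun j _ => by ring
    rw [jac, hM, ← Matrix.eval_charpoly, Matrix.charpoly_vecMulVec]
    obtain ⟨m, rfl⟩ : ∃ m, n = m + 1 := ⟨n - 1, by omega⟩
    simp only [dotProduct, mul_assoc, ← Finset.mul_sum, hnorm]
    simp
    rw [pow_succ, hd, hc]
    push_cast
    field_simp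
    ring

/-- `D_k v = -i ∂_k v`. -/
noncomputable def Dcoord (k : Fin n) (v : E n → ℂ) (ξ : E n) : ℂ :=
  -Complex.I * fderiv ℝ v ξ (EuclideanSpace.single k 1)

/-- The differential expression
`Q_{ε,θ} v = φ_θ² v - i ε ∑ J_θ^{-1/2} D_l (J^{lj} J_θ J^{kj} D_k (J_θ^{-1/2} v))`,
where `J^{lj}` is the `(j,l)` entry of `(Dφ_θ)⁻¹`. -/
noncomputable def Qexpr (ρ : ℝ → ℝ) (ε : ℝ) (θ : ℂ) (v : E n → ℂ) (ξ : E n) : ℂ :=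
  phiSq ρ θ ξ * v ξ - Complex.I * (ε : ℂ) * ∑ l, ∑ j, ∑ k,
    (sqrtJac ρ θ ξ)⁻¹ * Dcoord l (fun η =>
      (Dphi ρ θ η)⁻¹ j l * jac ρ θ η * (Dphi ρ θ η)⁻¹ j k *
        Dcoord k (fun ζ => (sqrtJac ρ θ ζ)⁻¹ * v ζ) η) ξ

/-! ### The operator on `L²(ℝⁿ)` -/

/-- Test functions: smooth and compactly supported. -/
def IsTest (v : E n → ℂ) : Prop := ContDiff ℝ ∞ v ∧ HasCompactSupport v

theorem integrable_mul_test (f : L2 n) {v : E n → ℂ} (hv : IsTest v) :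
    Integrable (fun ξ => f ξ * v ξ) volume := by
  have hv2 : MemLp v 2 (volume : Measure (E n)) :=
    hv.1.continuous.memLp_of_hasCompactSupport hv.2
  exact (Lp.memLp f).integrable_mul hv2

/-- The pairs `(u, f)` in `L² × L²` with `Q_{ε,θ} u = f` in the sense of distributions.
Transposing `Q_{ε,θ}` exchanges the roles of `k` and `l` in the sum over `k, l, j`, so the formal
transpose of `Q_{ε,θ}` for the bilinear pairing `∫ u v` is `Q_{ε,θ}` itself.  (The integrability
is automatic when the coefficients are smooth.) -/
noncomputable def Qgraph (ρ : ℝ → ℝ) (ε : ℝ) (θ : ℂ) : Submodule ℂ (L2 n × L2 n) where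
  carrier := {p | ∀ v : E n → ℂ, IsTest v →
    Integrable (fun ξ => p.1 ξ * Qexpr ρ ε θ v ξ) volume ∧
      ∫ ξ, p.1 ξ * Qexpr ρ ε θ v ξ = ∫ ξ, p.2 ξ * v ξ}
  zero_mem' := by
    intro v _
    have h : ∀ w : E n → ℂ,
        (fun ξ => ((0 : L2 n) : E n → ℂ) ξ * w ξ) =ᵐ[volume] fun _ => (0 : ℂ) := by
      intro w
      filter_upwards [Lp.coeFn_zero ℂ 2 (volume : Measure (E n))] with ξ
      simp
    refine ⟨(integrable_zero _ _ _).congr (h _).symm, ?_⟩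
    exact (integral_congr_ae (h _)).trans (integral_congr_ae (h _)).symm
  add_mem' := by
    intro p q hp hq v hv
    obtain ⟨hp1, hp2⟩ := hp v hv
    obtain ⟨hq1, hq2⟩ := hq v hv
    have h : ∀ (f g : L2 n) (w : E n → ℂ), (fun ξ => (f + g : L2 n) ξ * w ξ) =ᵐ[volume]
        fun ξ => f ξ * w ξ + g ξ * w ξ := by
      intro f g w
      filter_upwards [Lp.coeFn_add f g] with ξ hξ
      simp only [hξ, Pi.add_apply, add_mul]
    refine ⟨(hp1.add hq1).congr (h _ _ _).symm, ?_⟩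
    refine (integral_congr_ae (h _ _ _)).trans ?_
    refine Eq.trans ?_ (integral_congr_ae (h _ _ _)).symm
    rw [integral_add hp1 hq1, integral_add (integrable_mul_test _ hv) (integrable_mul_test _ hv),
      hp2, hq2]
  smul_mem' := by
    intro c p hp v hv
    obtain ⟨hp1, hp2⟩ := hp v hv
    have h : ∀ (f : L2 n) (w : E n → ℂ), (fun ξ => (c • f : L2 n) ξ * w ξ) =ᵐ[volume]
        fun ξ => c * (f ξ * w ξ) := by
      intro f w
      filter_upwards [Lp.coeFn_smul c f] with ξ hξ
      simp [hξ, mul_assoc]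
    refine ⟨(hp1.const_mul c).congr (h _ _).symm, ?_⟩
    refine (integral_congr_ae (h _ _)).trans ?_
    refine Eq.trans ?_ (integral_congr_ae (h _ _)).symm
    rw [integral_const_mul, integral_const_mul, hp2]

/-- The operator `Q_{ε,θ}` on `L²(ℝⁿ)`, with its natural (maximal) domain
`{u ∈ L² : Q_{ε,θ} u ∈ L²}`, `Q_{ε,θ} u` being taken in the sense of distributions. -/
noncomputable def Qop (n : ℕ) (ρ : ℝ → ℝ) (ε : ℝ) (θ : ℂ) : L2 n →ₗ.[ℂ] L2 n :=
  (Qgraph (n := n) ρ ε θ).toLinearPMap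

theorem graph_Qop (n : ℕ) (ρ : ℝ → ℝ) (ε : ℝ) (θ : ℂ) :
    (Qop n ρ ε θ).graph = Qgraph ρ ε θ := by
  refine Submodule.toLinearPMap_graph_eq _ ?_
  rintro ⟨u, f⟩ hx hu
  simp only at hu
  subst hu
  have hloc : LocallyIntegrable (f : E n → ℂ) volume :=
    (Lp.memLp f).locallyIntegrable (by norm_num)
  have h0 : ∀ᵐ ξ ∂(volume : Measure (E n)), f ξ = 0 := by
    refine ae_eq_zero_of_integral_contDiff_smul_eq_zero hloc ?_
    intro g hg hgs
    have hv : IsTest (fun ξ : E n => (g ξ : ℂ)) :=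
      ⟨Complex.ofRealCLM.contDiff.comp hg, hgs.comp_left Complex.ofReal_zero⟩
    have h1 := (hx _ hv).2
    have h2 : (fun ξ => ((0 : L2 n) : E n → ℂ) ξ * Qexpr ρ ε θ (fun ξ => (g ξ : ℂ)) ξ)
        =ᵐ[volume] fun _ => (0 : ℂ) := by
      filter_upwards [Lp.coeFn_zero ℂ 2 (volume : Measure (E n))] with ξ
      simp
    have h3 : ∫ ξ, f ξ * (g ξ : ℂ) = 0 := by
      rw [← h1]
      simp
    rw [← h3]
    refine integral_congr_ae (Filter.Eventually.of_forall fun ξ => ?_)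
    simp [mul_comm]
  exact Lp.ext (Filter.EventuallyEq.trans h0 (Lp.coeFn_zero ℂ 2 volume).symm)

/-- The spectrum of an unbounded operator `T`: the complement of the set of those `z` for which
`T - z : dom T → H` is a bijection with bounded inverse `R`. -/
def opSpectrum {H : Type*} [NormedAddCommGroup H] [NormedSpace ℂ H] (T : H →ₗ.[ℂ] H) : Set ℂ :=
  {z | ¬ ∃ R : H →L[ℂ] H,
    (∀ f : H, ∃ u : T.domain, (u : H) = R f ∧ T u - z • (u : H) = f) ∧
      ∀ u : T.domain, R (T u - z • (u : H)) = u}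

end CAP

/-!
Conjugation by `J_θ^{1/2}`, `θ = -iβ`, turns `Q_{ε,θ} - μ` into a divergence-form operator
`T = p + iε ∑ ∂_l a_{lk} ∂_k` (`divOp`, `Qexpr_sub_eq`), where `p = (φ_θ² - μ) J_θ` and
`a = J_θ (Dφ_θ)⁻²`, so that `-ia` has, up to the factor `J_θ`, the eigenvalues
`-i(1 - iβρ'(|ξ|))⁻²` and `-i(1 - iβρ(|ξ|)/|ξ|)⁻²`.  Everything rests on one bounded smooth
function, a *phase* `κ(ξ)`, for which `κ(φ_θ² - μ)` and both numbers `-iκ(1 - iβx)⁻²` have real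
part at least some `c > 0`; then `m = κ conj J_θ` makes `m p` and `-i m a` coercive at the same time
(`IsMultiplier`, `exists_isMultiplier`).

*The phase* (`exists_phase`).  Let `μ = λ²`, `z = |ξ| - iβρ(|ξ|)`, `w = φ_θ² - λ² = z² - λ²`.  As
`|β| ρ' < tan(π/8)`, the numbers `1 - iβx` have argument less than `π/8` in absolute value, and
their inverse squares stay away from one of the lines `Im = ± Re`.  For `β ≥ 0` this leaves room for
`κ = S - 1 + i` with any `S > 0`, and `Re κw = S Re w + (-Re w - Im w)`.  A suitable weight
`S(ξ)`, small where `Re w ≤ 0` and large elsewhere, makes this positive (`exists_weight`), unless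
somewhere `Re w ≤ 0` and `-Re w ≤ Im w`.  That would put `λ - z = -w / (λ + z)` into the sector
`-π/2 ≤ arg ≤ -π/8`, whereas `λ` lies above the curve `x - iβρ(x)`, which is less steep than that
(`re_pos_or_of_nonneg`).  For `β < 0` one takes `κ = S (1 + i) - 1` instead (`re_pos_or_of_neg`).

*From the phase to the resolvent.*  Pairing `T u` with `m conj u` and integrating by parts gives
`c ‖u‖² + εc ‖∇u‖² ≤ |⟨m conj u, T u⟩| + O(ε) ‖u‖ ‖∇u‖` (`IsMultiplier.energy`).  So for small `ε`
`T` is bounded below on test functions (`exists_eps_bounded_below`).  If `w ∈ L²` annihilates the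
range of `T` on test functions, mollifications `u` of truncations of `w` satisfy
`⟨m conj u, T u⟩ = O(ε) ‖w‖ (‖u‖ + ‖∇u‖)`, uniformly in the mollification and the truncation,
because commutators with the second-order part lose only one derivative; hence `‖u‖ ≤ ‖w‖ / 2` for
small `ε`, and in the limit `w = 0` (`exists_eps_annihilator`).  These two facts give a bounded
extension `G` of `(Q - μ) v ↦ v` to all of `L²`, and since `Q` is its own transpose, with its maximal domain,
the transpose of `G` is the resolvent (`notMem_opSpectrum`).

The phase constructed for `λ` serves for nearby points as well, and the closure of the rectangle is
compact, so a single `ε₀` suffices.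
-/

namespace CAP

variable {n : ℕ}

/-! ### Partial derivatives -/

/-- The `k`-th partial derivative of a complex function on `ℝⁿ`. -/
noncomputable def pd (k : Fin n) (f : E n → ℂ) (ξ : E n) : ℂ :=
  fderiv ℝ f ξ (EuclideanSpace.single k 1)

theorem norm_pd_le (k : Fin n) (f : E n → ℂ) (ξ : E n) : ‖pd k f ξ‖ ≤ ‖fderiv ℝ f ξ‖ := by
  simpa [pd] using (fderiv ℝ f ξ).le_opNorm (EuclideanSpace.single k 1)

theorem pd_mul (k : Fin n) {f g : E n → ℂ} {ξ : E n} (hf : DifferentiableAt ℝ f ξ)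
    (hg : DifferentiableAt ℝ g ξ) :
    pd k (fun η => f η * g η) ξ = pd k f ξ * g ξ + f ξ * pd k g ξ := by
  rw [pd, fderiv_fun_mul hf hg]
  simp [pd]
  ring

theorem pd_add (k : Fin n) {f g : E n → ℂ} {ξ : E n} (hf : DifferentiableAt ℝ f ξ)
    (hg : DifferentiableAt ℝ g ξ) :
    pd k (fun η => f η + g η) ξ = pd k f ξ + pd k g ξ := by
  rw [pd, fderiv_fun_add hf hg]
  simp [pd]

theorem pd_conj (k : Fin n) (f : E n → ℂ) (ξ : E n) :
    pd k (fun η => starRingEnd ℂ (f η)) ξ = starRingEnd ℂ (pd k f ξ) := by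
  have h := (Complex.conjCLE).comp_fderiv (f := f) (x := ξ)
  have h2 : (fun η => starRingEnd ℂ (f η)) = ⇑Complex.conjCLE ∘ f := by
    ext; simp
  rw [pd, h2, h]
  simp [pd]

theorem contDiff_pd (k : Fin n) {f : E n → ℂ} (hf : ContDiff ℝ ∞ f) : ContDiff ℝ ∞ (pd k f) :=
  (hf.fderiv_right (m := ∞) (by simp)).clm_apply contDiff_const

/-! ### Test functions -/

theorem IsTest.pd (k : Fin n) {f : E n → ℂ} (hf : IsTest f) : IsTest (pd k f) :=
  ⟨contDiff_pd k hf.1, (hf.2.fderiv ℝ).comp_left (g := fun L : E n →L[ℝ] ℂ =>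
    L (EuclideanSpace.single k 1)) rfl⟩

theorem IsTest.mul_left {f g : E n → ℂ} (hf : ContDiff ℝ ∞ f) (hg : IsTest g) :
    IsTest (fun ξ => f ξ * g ξ) :=
  ⟨hf.mul hg.1, hg.2.mul_left⟩

theorem IsTest.add {f g : E n → ℂ} (hf : IsTest f) (hg : IsTest g) :
    IsTest (fun ξ => f ξ + g ξ) :=
  ⟨hf.1.add hg.1, hf.2.add hg.2⟩

theorem IsTest.sub {f g : E n → ℂ} (hf : IsTest f) (hg : IsTest g) :
    IsTest (fun ξ => f ξ - g ξ) :=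
  ⟨hf.1.sub hg.1, hf.2.sub hg.2⟩

theorem IsTest.sum {ι : Type*} {s : Finset ι} {f : ι → E n → ℂ} (hf : ∀ i, IsTest (f i)) :
    IsTest (fun ξ => ∑ i ∈ s, f i ξ) := by
  classical
  induction s using Finset.induction_on with
  | empty => exact ⟨by simpa using contDiff_const, by
    simpa only [Finset.sum_empty] using! (HasCompactSupport.zero : HasCompactSupport (0 : E n → ℂ))⟩
  | insert i s hi ih => simpa [Finset.sum_insert hi] using (hf i).add ih

theorem contDiff_conj {f : E n → ℂ} (hf : ContDiff ℝ ∞ f) :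
    ContDiff ℝ ∞ (fun ξ => starRingEnd ℂ (f ξ)) :=
  (Complex.conjCLE.contDiff (n := ∞)).comp hf

theorem IsTest.conj {f : E n → ℂ} (hf : IsTest f) : IsTest (fun ξ => starRingEnd ℂ (f ξ)) :=
  ⟨contDiff_conj hf.1, hf.2.comp_left (map_zero _)⟩

theorem IsTest.integrable {f : E n → ℂ} (hf : IsTest f) : Integrable f :=
  hf.1.continuous.integrable_of_hasCompactSupport hf.2

theorem IsTest.memLp {f : E n → ℂ} (hf : IsTest f) : MemLp f 2 :=
  hf.1.continuous.memLp_of_hasCompactSupport hf.2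

theorem IsTest.differentiableAt {f : E n → ℂ} (hf : IsTest f) (ξ : E n) :
    DifferentiableAt ℝ f ξ := hf.1.differentiable (by simp) ξ

theorem differentiableAt_of_smooth {f : E n → ℂ} (hf : ContDiff ℝ ∞ f) (ξ : E n) :
    DifferentiableAt ℝ f ξ := hf.differentiable (by simp) ξ

/-- Integration by parts against a test function. -/
theorem integral_mul_pd (k : Fin n) {f g : E n → ℂ} (hf : ContDiff ℝ ∞ f) (hg : IsTest g) :
    ∫ ξ, f ξ * pd k g ξ = - ∫ ξ, pd k f ξ * g ξ :=
  integral_mul_fderiv_eq_neg_fderiv_mul_of_integrable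
    (IsTest.mul_left (contDiff_pd k hf) hg).integrable
    (IsTest.mul_left hf (hg.pd k)).integrable (IsTest.mul_left hf hg).integrable
    (fun x _ => differentiableAt_of_smooth hf x) (fun x _ => hg.differentiableAt x)

/-! ### The `L²` norm and convolution estimates -/

/-- The `L²` norm of a function, as a real number (`0` if the function is not in `L²`). -/
noncomputable def l2 (f : E n → ℂ) : ℝ := (eLpNorm f 2 (volume : Measure (E n))).toReal

theorem l2_nonneg (f : E n → ℂ) : 0 ≤ l2 f := ENNReal.toReal_nonneg

theorem l2_sq {f : E n → ℂ} (hf : MemLp f 2) : l2 f ^ 2 = ∫ ξ, ‖f ξ‖ ^ 2 := by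
  have h := hf.eLpNorm_eq_integral_rpow_norm (by norm_num) (by norm_num)
  have h0 : 0 ≤ ∫ ξ, ‖f ξ‖ ^ 2 := integral_nonneg fun _ => by positivity
  rw [l2, h, ENNReal.toReal_ofReal (by positivity)]
  simp only [ENNReal.toReal_ofNat, Real.rpow_ofNat]
  rw [← Real.rpow_natCast, ← Real.rpow_mul h0]
  norm_num

/-- Young's inequality, in the dual form in which the kernel may depend on both variables as long
as it is dominated by a convolution kernel `κ`. -/
theorem norm_integral_mul_kernel_le {F h : E n → ℂ} (hF : MemLp F 2) (hh : MemLp h 2)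
    {κ : E n → ℝ} (hκ : Integrable κ) (hκ0 : ∀ t, 0 ≤ κ t) {K : E n → E n → ℂ}
    (hK : ∀ x t, F x ≠ 0 → ‖K x t‖ ≤ κ t) :
    ‖∫ x, F x * ∫ t, K x t * h (x - t)‖ ≤ (∫ t, κ t) * l2 F * l2 h := by
  have hκe : ENNReal.ofReal (∫ t, κ t) = ∫⁻ t, ‖κ t‖ₑ := by
    rw [ofReal_integral_eq_lintegral_ofReal hκ (.of_forall hκ0)]
    exact lintegral_congr fun t => (Real.enorm_of_nonneg (hκ0 t)).symm
  have hm : AEMeasurable (fun z : E n × E n => ‖F z.1‖ₑ * (‖κ z.2‖ₑ * ‖h (z.1 - z.2)‖ₑ))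
      ((volume : Measure (E n)).prod volume) := by
    refine (hF.1.comp_fst.enorm).mul ((hκ.1.comp_snd.enorm).mul ?_)
    exact (hh.1.comp_quasiMeasurePreserving
      (quasiMeasurePreserving_sub_of_right_invariant volume volume)).enorm
  have key : ‖∫ x, F x * ∫ t, K x t * h (x - t)‖ₑ ≤
      ENNReal.ofReal (∫ t, κ t) * eLpNorm F 2 volume * eLpNorm h 2 volume := by
    calc ‖∫ x, F x * ∫ t, K x t * h (x - t)‖ₑ
        ≤ ∫⁻ x, ‖F x * ∫ t, K x t * h (x - t)‖ₑ := enorm_integral_le_lintegral_enorm _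
      _ ≤ ∫⁻ x, ∫⁻ t, ‖F x‖ₑ * (‖κ t‖ₑ * ‖h (x - t)‖ₑ) := by
          refine lintegral_mono fun x => ?_
          by_cases hx : F x = 0
          · simp [hx]
          rw [enorm_mul, lintegral_const_mul' _ _ enorm_ne_top]
          gcongr
          refine (enorm_integral_le_lintegral_enorm _).trans (lintegral_mono fun t => ?_)
          rw [enorm_mul]
          gcongr
          rw [enorm_le_iff_norm_le, Real.norm_of_nonneg (hκ0 t)]
          exact hK x t hx
      _ = ∫⁻ t, ∫⁻ x, ‖F x‖ₑ * (‖κ t‖ₑ * ‖h (x - t)‖ₑ) := lintegral_lintegral_swap hm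
      _ ≤ ∫⁻ t, ‖κ t‖ₑ * (eLpNorm F 2 volume * eLpNorm h 2 volume) := by
          refine lintegral_mono fun t => ?_
          have hht : MemLp (fun x => h (x - t)) 2 volume :=
            hh.comp_measurePreserving (measurePreserving_sub_right volume t)
          have e1 : ∀ x, ‖F x‖ₑ * (‖κ t‖ₑ * ‖h (x - t)‖ₑ)
              = ‖κ t‖ₑ * (‖F x‖ₑ * ‖h (x - t)‖ₑ) := fun x => by ring
          simp_rw [e1]
          rw [lintegral_const_mul' _ _ enorm_ne_top]
          gcongr
          have e2 : eLpNorm (fun x => h (x - t)) 2 volume = eLpNorm h 2 volume :=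
            eLpNorm_comp_measurePreserving hh.1 (measurePreserving_sub_right volume t)
          rw [← e2]
          have := ENNReal.lintegral_mul_le_Lp_mul_Lq (volume : Measure (E n))
            (p := 2) (q := 2) (Real.HolderConjugate.two_two) hF.1.enorm hht.1.enorm
          simpa [eLpNorm_eq_lintegral_rpow_enorm_toReal] using this
      _ = _ := by
          rw [lintegral_mul_const'' _ hκ.1.enorm, hκe, mul_assoc]
  have := ENNReal.toReal_mono (by
    refine ENNReal.mul_ne_top (ENNReal.mul_ne_top ENNReal.ofReal_ne_top hF.2.ne) hh.2.ne) key
  rw [toReal_enorm, ENNReal.toReal_mul, ENNReal.toReal_mul,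
    ENNReal.toReal_ofReal (integral_nonneg hκ0)] at this
  exact this

theorem norm_integral_mul_le {F h : E n → ℂ} (hF : MemLp F 2) (hh : MemLp h 2) :
    ‖∫ x, F x * h x‖ ≤ l2 F * l2 h := by
  have h1 := ENNReal.lintegral_mul_le_Lp_mul_Lq (volume : Measure (E n))
    (p := 2) (q := 2) (Real.HolderConjugate.two_two) hF.1.enorm hh.1.enorm
  have h2 : ‖∫ x, F x * h x‖ₑ ≤ eLpNorm F 2 volume * eLpNorm h 2 volume := by
    refine (enorm_integral_le_lintegral_enorm _).trans ?_
    simpa [eLpNorm_eq_lintegral_rpow_enorm_toReal, enorm_mul] using h1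
  have := ENNReal.toReal_mono (ENNReal.mul_ne_top hF.2.ne hh.2.ne) h2
  rwa [toReal_enorm, ENNReal.toReal_mul] at this

theorem l2_mul_le {f b : E n → ℂ} (hf : MemLp f 2) {C : ℝ} (hC : 0 ≤ C)
    (hb : ∀ ξ, ‖b ξ‖ ≤ C) : l2 (fun ξ => b ξ * f ξ) ≤ C * l2 f := by
  have h : eLpNorm (fun ξ => b ξ * f ξ) 2 volume ≤
      ENNReal.ofReal C * eLpNorm f 2 (volume : Measure (E n)) := by
    refine eLpNorm_le_mul_eLpNorm_of_ae_le_mul (.of_forall fun ξ => ?_) 2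
    rw [norm_mul]
    gcongr
    exact hb ξ
  have := ENNReal.toReal_mono (ENNReal.mul_ne_top ENNReal.ofReal_ne_top hf.2.ne) h
  rwa [ENNReal.toReal_mul, ENNReal.toReal_ofReal hC] at this

theorem l2_add_le {f g : E n → ℂ} (hf : MemLp f 2) (hg : MemLp g 2) :
    l2 (fun ξ => f ξ + g ξ) ≤ l2 f + l2 g := by
  have h := eLpNorm_add_le hf.1 hg.1 (p := 2) (by norm_num)
  have := ENNReal.toReal_mono (ENNReal.add_ne_top.2 ⟨hf.2.ne, hg.2.ne⟩) h
  rwa [ENNReal.toReal_add hf.2.ne hg.2.ne] at this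

theorem l2_conj (f : E n → ℂ) : l2 (fun ξ => starRingEnd ℂ (f ξ)) = l2 f := by
  rw [l2, l2, eLpNorm_congr_norm_ae (g := f) (.of_forall fun ξ => by simp)]

/-! ### Convolution -/

/-- Convolution `(k ⋆ f)(x) = ∫ k(t) f(x - t) dt`. -/
noncomputable def conv (k f : E n → ℂ) (x : E n) : ℂ := ∫ t, k t * f (x - t)

theorem conv_eq (k f : E n → ℂ) :
    conv k f = convolution k f (ContinuousLinearMap.mul ℝ ℂ) volume := rfl

theorem isTest_conv {k f : E n → ℂ} (hk : IsTest k) (hf : LocallyIntegrable f)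
    (hfc : HasCompactSupport f) : IsTest (conv k f) :=
  ⟨hk.2.contDiff_convolution_left (n := (⊤ : ℕ∞)) (ContinuousLinearMap.mul ℝ ℂ) hk.1 hf,
    hk.2.convolution (ContinuousLinearMap.mul ℝ ℂ) hfc⟩

theorem pd_conv_left (l : Fin n) {k f : E n → ℂ} (hk : IsTest k) (hf : LocallyIntegrable f)
    (x : E n) : pd l (conv k f) x = conv (pd l k) f x := by
  have h := hk.2.hasFDerivAt_convolution_left (ContinuousLinearMap.mul ℝ ℂ)
    (hk.1.of_le (by simp)) hf x
  rw [pd, conv_eq, h.fderiv, convolution_def, ContinuousLinearMap.integral_apply]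
  · rfl
  · exact (hk.2.fderiv ℝ).convolutionExists_left _
      (hk.1.continuous_fderiv (by simp)) hf x

theorem pd_conv_right (l : Fin n) {k f : E n → ℂ} (hk : LocallyIntegrable k) (hf : IsTest f)
    (x : E n) : pd l (conv k f) x = conv k (pd l f) x := by
  have h := hf.2.hasFDerivAt_convolution_right (ContinuousLinearMap.mul ℝ ℂ) hk
    (hf.1.of_le (by simp)) x
  rw [pd, conv_eq, h.fderiv, convolution_def, ContinuousLinearMap.integral_apply]
  · rfl
  · exact (hf.2.fderiv ℝ).convolutionExists_right _ hk
      (hf.1.continuous_fderiv (by simp)) x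

/-- Convolution with an even kernel is symmetric for the bilinear pairing. -/
theorem integral_conv_mul {k f q : E n → ℂ} (hk : IsTest k) (hk' : ∀ t, k (-t) = k t)
    (hf : Integrable f) (hq : Integrable q) :
    ∫ x, conv k f x * q x = ∫ x, f x * conv k q x := by
  have e : ∀ (f : E n → ℂ) x, conv k f x = ∫ y, k (x - y) * f y := fun f x => by
    rw [conv_eq, convolution_eq_swap]
    rfl
  obtain ⟨C, hC⟩ := hk.1.continuous.bounded_above_of_compact_support hk.2
  have hint : Integrable (Function.uncurry fun x y => (k (x - y) * f y) * q x)
      ((volume : Measure (E n)).prod volume) := by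
    have h1 : Integrable (fun z : E n × E n => q z.1 * f z.2)
      ((volume : Measure (E n)).prod volume) := hq.mul_prod hf
    have h2 := h1.bdd_mul (f := fun z : E n × E n => k (z.1 - z.2)) (c := C)
      (hk.1.continuous.comp (continuous_fst.sub continuous_snd)).aestronglyMeasurable
      (.of_forall fun z => hC _)
    refine h2.congr (.of_forall fun z => ?_)
    simp only [Function.uncurry]
    ring
  simp_rw [e]
  calc ∫ x, (∫ y, k (x - y) * f y) * q x = ∫ x, ∫ y, (k (x - y) * f y) * q x := by
        simp_rw [integral_mul_const]
    _ = ∫ y, ∫ x, (k (x - y) * f y) * q x := integral_integral_swap hint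
    _ = ∫ y, f y * ∫ x, k (y - x) * q x := by
        refine integral_congr_ae (.of_forall fun y => ?_)
        simp only
        rw [← integral_const_mul]
        refine integral_congr_ae (.of_forall fun x => ?_)
        simp only
        rw [← hk' (y - x), neg_sub]
        ring

/-! ### Divergence-form operators and the energy estimate -/

/-- The divergence-form operator `v ↦ p v + i ε ∑ ∂_l (a_{lk} ∂_k v)`. -/
noncomputable def divOp (ε : ℝ) (a : Fin n → Fin n → E n → ℂ) (p v : E n → ℂ) (ξ : E n) : ℂ :=
  p ξ * v ξ + Complex.I * ε * ∑ l, ∑ k, pd l (fun η => a l k η * pd k v η) ξ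

/-- The coefficients `a`, `p` admit the multiplier `m`: after multiplication by `m`, both the
potential and the principal part `-i a` are coercive with constant `c`.  Everything except the
unbounded potential `p` is bounded by `C`, together with its first derivatives. -/
structure IsMultiplier (a : Fin n → Fin n → E n → ℂ) (p m : E n → ℂ) (C c : ℝ) : Prop where
  smooth_a : ∀ l k, ContDiff ℝ ∞ (a l k)
  smooth_p : ContDiff ℝ ∞ p
  smooth_m : ContDiff ℝ ∞ m
  symm : ∀ l k ξ, a l k ξ = a k l ξ
  norm_a : ∀ l k ξ, ‖a l k ξ‖ ≤ C
  fderiv_a : ∀ l k ξ, ‖fderiv ℝ (a l k) ξ‖ ≤ C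
  norm_m : ∀ ξ, ‖m ξ‖ ≤ C
  fderiv_m : ∀ ξ, ‖fderiv ℝ m ξ‖ ≤ C
  coercive_p : ∀ ξ, c ≤ (m ξ * p ξ).re
  coercive_a : ∀ ξ (ζ : Fin n → ℂ),
    c * ∑ k, ‖ζ k‖ ^ 2 ≤ (-Complex.I * m ξ * ∑ l, ∑ k, a l k ξ * ζ k * starRingEnd ℂ (ζ l)).re

section Estimates

variable {a : Fin n → Fin n → E n → ℂ} {p m : E n → ℂ} {C c : ℝ}

theorem IsMultiplier.C_nonneg (H : IsMultiplier a p m C c) : 0 ≤ C :=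
  (norm_nonneg _).trans (H.norm_m 0)

theorem IsMultiplier.isTest_flux (H : IsMultiplier a p m C c) {g : E n → ℂ} (hg : IsTest g)
    (l k : Fin n) : IsTest (fun η => a l k η * pd k g η) :=
  IsTest.mul_left (H.smooth_a l k) (hg.pd k)

theorem IsMultiplier.isTest_divOp (H : IsMultiplier a p m C c) (ε : ℝ) {g : E n → ℂ}
    (hg : IsTest g) : IsTest (divOp ε a p g) := by
  refine (IsTest.mul_left H.smooth_p hg).add (IsTest.mul_left contDiff_const ?_)
  exact IsTest.sum fun l => IsTest.sum fun k => (H.isTest_flux hg l k).pd l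

/-- The weak form of `divOp`. -/
theorem IsMultiplier.integral_mul_divOp (H : IsMultiplier a p m C c) (ε : ℝ) {f g : E n → ℂ}
    (hf : ContDiff ℝ ∞ f) (hg : IsTest g) :
    ∫ ξ, f ξ * divOp ε a p g ξ = (∫ ξ, f ξ * (p ξ * g ξ)) -
      Complex.I * ε * ∑ l, ∑ k, ∫ ξ, pd l f ξ * (a l k ξ * pd k g ξ) := by
  have hT : ∀ l k, IsTest (fun ξ => f ξ * pd l (fun η => a l k η * pd k g η) ξ) := fun l k =>
    IsTest.mul_left hf ((H.isTest_flux hg l k).pd l)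
  have e : ∀ ξ, f ξ * divOp ε a p g ξ = f ξ * (p ξ * g ξ) +
      Complex.I * ε * ∑ l, ∑ k, f ξ * pd l (fun η => a l k η * pd k g η) ξ := fun ξ => by
    simp only [divOp, ← Finset.mul_sum]
    ring
  simp_rw [e]
  rw [integral_add (IsTest.mul_left hf (IsTest.mul_left H.smooth_p hg)).integrable
    (IsTest.mul_left contDiff_const (IsTest.sum fun l => IsTest.sum fun k => hT l k)).integrable,
    integral_const_mul, integral_finsetSum _ fun l _ => (IsTest.sum fun k => hT l k).integrable]
  simp_rw [integral_finsetSum _ fun k _ => (hT _ k).integrable,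
    integral_mul_pd _ hf (H.isTest_flux hg _ _), Finset.sum_neg_distrib]
  ring

theorem IsMultiplier.divOp_symm (H : IsMultiplier a p m C c) (ε : ℝ) {f g : E n → ℂ}
    (hf : IsTest f) (hg : IsTest g) :
    ∫ ξ, f ξ * divOp ε a p g ξ = ∫ ξ, g ξ * divOp ε a p f ξ := by
  rw [H.integral_mul_divOp ε hf.1 hg, H.integral_mul_divOp ε hg.1 hf, Finset.sum_comm]
  have e1 : ∀ ξ, f ξ * (p ξ * g ξ) = g ξ * (p ξ * f ξ) := fun ξ => by ring
  have e2 : ∀ l k ξ, pd k f ξ * (a k l ξ * pd l g ξ) = pd l g ξ * (a l k ξ * pd k f ξ) :=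
    fun l k ξ => by rw [H.symm k l]; ring
  simp_rw [e1, e2]

/-- The multiplier (energy) estimate: the real part of `∫ m ū divOp u` controls `u` in `H¹`, up to
the terms in which the derivative falls on `m`. -/
theorem IsMultiplier.energy (H : IsMultiplier a p m C c) {ε : ℝ} (hε : 0 < ε) {u : E n → ℂ}
    (hu : IsTest u) :
    c * l2 u ^ 2 + ε * (c * ∑ k, l2 (pd k u) ^ 2) ≤
      ‖∫ ξ, (m ξ * starRingEnd ℂ (u ξ)) * divOp ε a p u ξ‖ +
        ε * (C ^ 2 * n * (l2 u * ∑ k, l2 (pd k u))) := by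
  have hC := H.C_nonneg
  set cu : E n → ℂ := fun ξ => starRingEnd ℂ (u ξ) with hcu
  have tcu : IsTest cu := hu.conj
  have tg : IsTest (fun ξ => m ξ * cu ξ) := IsTest.mul_left H.smooth_m tcu
  have hpd : ∀ l ξ, pd l (fun ξ => m ξ * cu ξ) ξ =
      pd l m ξ * cu ξ + m ξ * starRingEnd ℂ (pd l u ξ) := fun l ξ => by
    rw [pd_mul l (differentiableAt_of_smooth H.smooth_m ξ) (tcu.differentiableAt ξ), hcu, pd_conj]
  have t1 : ∀ l k, IsTest (fun ξ => (pd l m ξ * a l k ξ * cu ξ) * pd k u ξ) := fun l k =>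
    IsTest.mul_left ((((contDiff_pd l H.smooth_m).mul (H.smooth_a l k))).mul tcu.1) (hu.pd k)
  have t2 : ∀ l k, IsTest (fun ξ => (m ξ * a l k ξ * starRingEnd ℂ (pd l u ξ)) * pd k u ξ) :=
    fun l k => IsTest.mul_left ((H.smooth_m.mul (H.smooth_a l k)).mul
      (contDiff_conj (hu.pd l).1)) (hu.pd k)
  have t0 : IsTest (fun ξ => (m ξ * cu ξ) * (p ξ * u ξ)) :=
    IsTest.mul_left tg.1 (IsTest.mul_left H.smooth_p hu)
  set Φ : E n → ℂ := fun ξ => (m ξ * cu ξ) * (p ξ * u ξ) + -(Complex.I * ε) *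
    ∑ l, ∑ k, (m ξ * a l k ξ * starRingEnd ℂ (pd l u ξ)) * pd k u ξ with hΦ
  have tΦ : IsTest Φ := t0.add (IsTest.mul_left contDiff_const
    (IsTest.sum fun l => IsTest.sum fun k => t2 l k))
  have hsplit : ∫ ξ, Φ ξ = (∫ ξ, (m ξ * cu ξ) * divOp ε a p u ξ) + Complex.I * ε *
      ∑ l, ∑ k, ∫ ξ, (pd l m ξ * a l k ξ * cu ξ) * pd k u ξ := by
    rw [H.integral_mul_divOp ε tg.1 hu, hΦ, integral_add t0.integrable
      (IsTest.mul_left contDiff_const (IsTest.sum fun l => IsTest.sum fun k => t2 l k)).integrable,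
      integral_const_mul, integral_finsetSum _ fun l _ => (IsTest.sum fun k => t2 l k).integrable]
    simp_rw [integral_finsetSum _ fun k _ => (t2 _ k).integrable]
    have e : ∀ l k, ∫ ξ, pd l (fun ξ => m ξ * cu ξ) ξ * (a l k ξ * pd k u ξ) =
        (∫ ξ, (pd l m ξ * a l k ξ * cu ξ) * pd k u ξ) +
        ∫ ξ, (m ξ * a l k ξ * starRingEnd ℂ (pd l u ξ)) * pd k u ξ := fun l k => by
      rw [← integral_add (t1 l k).integrable (t2 l k).integrable]
      refine integral_congr_ae (.of_forall fun ξ => ?_)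
      simp only [hpd]
      ring
    simp_rw [e, Finset.sum_add_distrib]
    ring
  have hlow : c * l2 u ^ 2 + ε * (c * ∑ k, l2 (pd k u) ^ 2) ≤ (∫ ξ, Φ ξ).re := by
    have hre : (∫ ξ, Φ ξ).re = ∫ ξ, (Φ ξ).re := (integral_re tΦ.integrable).symm
    have i1 : Integrable (fun ξ => ‖u ξ‖ ^ 2) := hu.memLp.integrable_norm_pow (by norm_num)
    have i2 : ∀ k, Integrable (fun ξ => ‖pd k u ξ‖ ^ 2) := fun k =>
      (hu.pd k).memLp.integrable_norm_pow (by norm_num)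
    rw [hre, l2_sq hu.memLp]
    simp_rw [l2_sq (hu.pd _).memLp]
    rw [← integral_finsetSum _ fun k _ => i2 k, ← integral_const_mul, ← integral_const_mul,
      ← integral_const_mul, ← integral_add (i1.const_mul c)
        (((integrable_finsetSum _ fun k _ => i2 k).const_mul c).const_mul ε)]
    refine integral_mono ((i1.const_mul c).add
        (((integrable_finsetSum _ fun k _ => i2 k).const_mul c).const_mul ε))
        tΦ.integrable.re fun ξ => ?_
    have h1 : ((m ξ * cu ξ) * (p ξ * u ξ)).re = (m ξ * p ξ).re * ‖u ξ‖ ^ 2 := by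
      have : (m ξ * cu ξ) * (p ξ * u ξ) = (m ξ * p ξ) * ((‖u ξ‖ ^ 2 : ℝ) : ℂ) := by
        rw [Complex.ofReal_pow, ← Complex.mul_conj']
        simp only [hcu]
        ring
      rw [this, Complex.re_mul_ofReal]
    have h2 : -(Complex.I * ε) *
        ∑ l, ∑ k, (m ξ * a l k ξ * starRingEnd ℂ (pd l u ξ)) * pd k u ξ =
        (-Complex.I * m ξ * ∑ l, ∑ k, a l k ξ * pd k u ξ * starRingEnd ℂ (pd l u ξ)) *
          (ε : ℂ) := by
      have : ∀ l k, (m ξ * a l k ξ * starRingEnd ℂ (pd l u ξ)) * pd k u ξ =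
        m ξ * (a l k ξ * pd k u ξ * starRingEnd ℂ (pd l u ξ)) := fun l k => by ring
      simp_rw [this, ← Finset.mul_sum]
      ring
    have h3 := H.coercive_p ξ
    have h4 := H.coercive_a ξ (fun k => pd k u ξ)
    simp only [hΦ, Complex.add_re, h1, h2, Complex.re_mul_ofReal]
    have h5 := mul_le_mul_of_nonneg_right h3 (sq_nonneg ‖u ξ‖)
    have h6 := mul_le_mul_of_nonneg_left h4 hε.le
    change c * ‖u ξ‖ ^ 2 + ε * (c * ∑ k, ‖pd k u ξ‖ ^ 2) ≤ _
    linarith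
  have herr : ∀ l k, ‖∫ ξ, (pd l m ξ * a l k ξ * cu ξ) * pd k u ξ‖ ≤
      C ^ 2 * l2 u * l2 (pd k u) := fun l k => by
    have hm : MemLp (fun ξ => pd l m ξ * a l k ξ * cu ξ) 2 :=
      (IsTest.mul_left ((contDiff_pd l H.smooth_m).mul (H.smooth_a l k)) tcu).memLp
    refine (norm_integral_mul_le hm (hu.pd k).memLp).trans ?_
    refine mul_le_mul_of_nonneg_right ?_ (l2_nonneg _)
    rw [← l2_conj u]
    refine l2_mul_le tcu.memLp (by positivity) fun ξ => ?_
    rw [norm_mul, sq]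
    exact mul_le_mul ((norm_pd_le _ _ _).trans (H.fderiv_m ξ)) (H.norm_a l k ξ) (norm_nonneg _) hC
  have hsum : ‖Complex.I * ε * ∑ l, ∑ k, ∫ ξ, (pd l m ξ * a l k ξ * cu ξ) * pd k u ξ‖ ≤
      ε * (C ^ 2 * n * (l2 u * ∑ k, l2 (pd k u))) := by
    rw [norm_mul, norm_mul, Complex.norm_I, one_mul, Complex.norm_real, Real.norm_of_nonneg hε.le]
    gcongr
    refine (norm_sum_le _ _).trans ?_
    refine (Finset.sum_le_sum fun l _ => (norm_sum_le _ _).trans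
      (Finset.sum_le_sum fun k _ => herr l k)).trans ?_
    rw [← Finset.mul_sum, Finset.sum_const, Finset.card_univ, Fintype.card_fin, nsmul_eq_mul]
    exact le_of_eq (by ring)
  calc _ ≤ (∫ ξ, Φ ξ).re := hlow
    _ ≤ ‖∫ ξ, Φ ξ‖ := Complex.re_le_norm _
    _ ≤ _ := by
      rw [hsplit]
      exact (norm_add_le _ _).trans (by gcongr)

end Estimates

/-! ### Commutators with mollifiers and cutoffs -/

/-- An even smoothing kernel `k` supported in the ball of radius `δ`, of mass at most one, for which
the first moment of `|∂k|` is at most `D`.  For `k = δ⁻ⁿ η(·/δ)` the constant `D` depends only on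
`η`. -/
structure IsMollifier (δ D : ℝ) (k : E n → ℂ) : Prop where
  test : IsTest k
  even : ∀ t, k (-t) = k t
  support : ∀ t, δ < ‖t‖ → k t = 0
  mass : ∫ t, ‖k t‖ ≤ 1
  moment : ∀ l, ∫ t, ‖t‖ * ‖pd l k t‖ ≤ D

/-- A smooth compactly supported cutoff, bounded by one, with first and second derivatives
bounded by `D`. -/
structure IsCutoff (D : ℝ) (χ : E n → ℂ) : Prop where
  test : IsTest χ
  norm_le : ∀ ξ, ‖χ ξ‖ ≤ 1
  norm_pd : ∀ k ξ, ‖pd k χ ξ‖ ≤ D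
  norm_pd_pd : ∀ l k ξ, ‖pd l (pd k χ) ξ‖ ≤ D

theorem l2_conv_le {k f : E n → ℂ} (hk : IsTest k) (hm : ∫ t, ‖k t‖ ≤ 1) (hf : IsTest f) :
    l2 (conv k f) ≤ l2 f := by
  have ht : IsTest (conv k f) := isTest_conv hk hf.integrable.locallyIntegrable hf.2
  set F : E n → ℂ := fun x => starRingEnd ℂ (conv k f x) with hF
  have h1 : ‖∫ x, F x * ∫ t, k t * f (x - t)‖ ≤ (∫ t, ‖k t‖) * l2 F * l2 f :=
    norm_integral_mul_kernel_le ht.conj.memLp hf.memLp hk.integrable.norm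
      (fun t => norm_nonneg _) fun x t _ => le_rfl
  have h2 : ∫ x, F x * ∫ t, k t * f (x - t) = ((l2 (conv k f) ^ 2 : ℝ) : ℂ) := by
    rw [l2_sq ht.memLp, ← integral_complex_ofReal]
    refine integral_congr_ae (.of_forall fun x => ?_)
    simp only [hF]
    rw [Complex.ofReal_pow, ← Complex.conj_mul']
    rfl
  rw [h2, hF, l2_conj, Complex.norm_real, Real.norm_of_nonneg (sq_nonneg _)] at h1
  by_contra! hlt
  have h3 : (∫ t, ‖k t‖) * l2 (conv k f) * l2 f ≤ 1 * l2 (conv k f) * l2 f := by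
    have := l2_nonneg (conv k f)
    have := l2_nonneg f
    gcongr
  nlinarith [l2_nonneg f]

theorem integrable_memLp_mul_test {w g : E n → ℂ} (hw : MemLp w 2) (hg : IsTest g) :
    Integrable fun x => w x * g x :=
  hw.integrable_mul hg.memLp

section Commutators

variable {a : Fin n → Fin n → E n → ℂ} {p m : E n → ℂ} {C c : ℝ}

/-- The commutator of a mollifier with a second-order term `∂_l b ∂_k` loses one derivative only,
uniformly in the width of the mollifier. -/
theorem norm_integral_commutator_le {δ D : ℝ} {k : E n → ℂ} (hk : IsMollifier δ D k)
    {b : E n → ℂ} (hb : ContDiff ℝ ∞ b) (hC : 0 ≤ C) (hbC : ∀ ξ, ‖fderiv ℝ b ξ‖ ≤ C)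
    {F g : E n → ℂ} (hF : MemLp F 2) (hg : IsTest g) (l j : Fin n) :
    ‖∫ x, F x * (conv k (pd l (fun η => b η * pd j g η)) x -
      pd l (fun η => b η * pd j (conv k g) η) x)‖ ≤ C * (D + 1) * l2 F * l2 (pd j g) := by
  set h := pd j g with hh
  have th : IsTest h := hg.pd j
  have tbh : IsTest (fun η => b η * h η) := IsTest.mul_left hb th
  have tk := hk.test
  have hpc : pd j (conv k g) = conv k h := funext fun x =>
    pd_conv_right j tk.integrable.locallyIntegrable hg x
  have tch : IsTest (conv k h) := isTest_conv tk th.integrable.locallyIntegrable th.2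
  have hint : ∀ {q r : E n → ℂ} (_ : IsTest q) (_ : IsTest r) (x : E n),
      Integrable fun t => q t * r (x - t) := fun {q r} hq hr x => by
    refine (Continuous.integrable_of_hasCompactSupport ?_ (hq.2.mul_right))
    exact hq.1.continuous.mul (hr.1.continuous.comp (continuous_const.sub continuous_id))
  have e : ∀ x, conv k (pd l (fun η => b η * h η)) x - pd l (fun η => b η * conv k h η) x =
      ∫ t, (pd l k t * (b (x - t) - b x) - pd l b x * k t) * h (x - t) := fun x => by
    rw [← pd_conv_right l tk.integrable.locallyIntegrable tbh,
      pd_conv_left l tk tbh.integrable.locallyIntegrable,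
      pd_mul l (differentiableAt_of_smooth hb x) (tch.differentiableAt x),
      pd_conv_left l tk th.integrable.locallyIntegrable]
    simp only [conv]
    rw [← integral_const_mul, ← integral_const_mul, ← integral_add, ← integral_sub]
    · refine integral_congr_ae (.of_forall fun t => ?_)
      simp only
      ring
    · exact hint (tk.pd l) tbh x
    · exact ((hint tk th x).const_mul _).add ((hint (tk.pd l) th x).const_mul _)
    · exact (hint tk th x).const_mul _
    · exact (hint (tk.pd l) th x).const_mul _
  have hlip : ∀ x t, ‖b (x - t) - b x‖ ≤ C * ‖t‖ := fun x t => by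
    have := Convex.norm_image_sub_le_of_norm_fderiv_le (𝕜 := ℝ) (f := b) (s := Set.univ) (C := C)
      (fun x _ => differentiableAt_of_smooth hb x) (fun x _ => hbC x) convex_univ
      (Set.mem_univ x) (Set.mem_univ (x - t))
    simpa using this
  have im : Integrable fun t => ‖t‖ * ‖pd l k t‖ :=
    (continuous_norm.mul (tk.pd l).1.continuous.norm).integrable_of_hasCompactSupport
      ((tk.pd l).2.norm.mul_left)
  simp_rw [hpc, e]
  refine (norm_integral_mul_kernel_le hF th.memLp
    (κ := fun t => C * (‖t‖ * ‖pd l k t‖) + C * ‖k t‖)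
    ((im.const_mul C).add (tk.integrable.norm.const_mul C)) (fun t => by positivity) ?_).trans ?_
  · intro x t _
    refine (norm_sub_le _ _).trans ?_
    rw [norm_mul, norm_mul]
    have h1 := hlip x t
    have h2 : ‖pd l b x‖ ≤ C := (norm_pd_le _ _ _).trans (hbC x)
    have h3 := mul_le_mul_of_nonneg_left h1 (norm_nonneg (pd l k t))
    have h4 := mul_le_mul_of_nonneg_right h2 (norm_nonneg (k t))
    linarith
  · rw [integral_add (im.const_mul C) (tk.integrable.norm.const_mul C), integral_const_mul,
      integral_const_mul]
    have := l2_nonneg F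
    have := l2_nonneg h
    have h5 := mul_le_mul_of_nonneg_left (hk.moment l) hC
    have h6 := mul_le_mul_of_nonneg_left hk.mass hC
    gcongr
    linarith

/-- The commutator of a mollifier with `divOp`, tested against `F ∈ L²`. -/
theorem IsMultiplier.norm_integral_mollifier_commutator_le (H : IsMultiplier a p m C c) {ε : ℝ}
    (hε : 0 < ε) {δ D τ : ℝ} {k : E n → ℂ} (hk : IsMollifier δ D k) (hτ : 0 ≤ τ)
    {F g : E n → ℂ} (hF : MemLp F 2) (hg : IsTest g)
    (hp : ∀ x t, F x ≠ 0 → ‖t‖ ≤ δ → ‖p (x - t) - p x‖ ≤ τ) :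
    ‖∫ x, F x * (conv k (divOp ε a p g) x - divOp ε a p (conv k g) x)‖ ≤
      l2 F * (τ * l2 g + ε * (C * (D + 1) * n * ∑ j, l2 (pd j g))) := by
  have hC := H.C_nonneg
  have tk := hk.test
  have tpg : IsTest (fun x => p x * g x) := IsTest.mul_left H.smooth_p hg
  have tcg : IsTest (conv k g) := isTest_conv tk hg.integrable.locallyIntegrable hg.2
  have tq : ∀ l j, IsTest (pd l (fun η => a l j η * pd j g η)) := fun l j =>
    (H.isTest_flux hg l j).pd l
  have tR : ∀ l j, IsTest (fun x => conv k (pd l (fun η => a l j η * pd j g η)) x -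
      pd l (fun η => a l j η * pd j (conv k g) η) x) := fun l j =>
    (isTest_conv tk (tq l j).integrable.locallyIntegrable (tq l j).2).sub
      ((H.isTest_flux tcg l j).pd l)
  have tP : IsTest (fun x => conv k (fun y => p y * g y) x - p x * conv k g x) :=
    (isTest_conv tk tpg.integrable.locallyIntegrable tpg.2).sub (IsTest.mul_left H.smooth_p tcg)
  have hint : ∀ {r : E n → ℂ} (_ : IsTest r) (x : E n),
      Integrable fun t => k t * r (x - t) := fun {r} hr x => by
    refine (Continuous.integrable_of_hasCompactSupport ?_ (tk.2.mul_right))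
    exact tk.1.continuous.mul (hr.1.continuous.comp (continuous_const.sub continuous_id))
  have e : ∀ x, F x * (conv k (divOp ε a p g) x - divOp ε a p (conv k g) x) =
      F x * (conv k (fun y => p y * g y) x - p x * conv k g x) + Complex.I * ε *
      ∑ l, ∑ j, F x * (conv k (pd l (fun η => a l j η * pd j g η)) x -
        pd l (fun η => a l j η * pd j (conv k g) η) x) := fun x => by
    have e1 : conv k (divOp ε a p g) x = conv k (fun y => p y * g y) x + Complex.I * ε *
        ∑ l, ∑ j, conv k (pd l (fun η => a l j η * pd j g η)) x := by
      simp only [conv]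
      simp_rw [← integral_finsetSum _ fun j _ => hint (tq _ j) x]
      rw [← integral_finsetSum _ fun l _ => integrable_finsetSum _ fun j _ => hint (tq l j) x,
        ← integral_const_mul, ← integral_add (hint tpg x)
        ((integrable_finsetSum _ fun l _ => integrable_finsetSum _ fun j _ =>
          hint (tq l j) x).const_mul _)]
      refine integral_congr_ae (.of_forall fun t => ?_)
      simp only [divOp, ← Finset.mul_sum]
      ring
    rw [e1, divOp]
    simp only [← Finset.mul_sum, Finset.sum_sub_distrib]
    ring
  have iF : ∀ {r : E n → ℂ} (_ : IsTest r), Integrable fun x => F x * r x := fun hr =>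
    hF.integrable_mul hr.memLp
  simp_rw [e]
  rw [integral_add (iF tP) ((integrable_finsetSum _ fun l _ => integrable_finsetSum _ fun j _ =>
      iF (tR l j)).const_mul _), integral_const_mul,
    integral_finsetSum _ fun l _ => integrable_finsetSum _ fun j _ => iF (tR l j)]
  simp_rw [integral_finsetSum _ fun j _ => iF (tR _ j)]
  refine (norm_add_le _ _).trans ?_
  rw [mul_add]
  have hP : ‖∫ x, F x * (conv k (fun y => p y * g y) x - p x * conv k g x)‖ ≤
      l2 F * (τ * l2 g) := by
    have e2 : ∀ x, conv k (fun y => p y * g y) x - p x * conv k g x =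
        ∫ t, (k t * (p (x - t) - p x)) * g (x - t) := fun x => by
      simp only [conv]
      rw [← integral_const_mul, ← integral_sub (hint tpg x) ((hint hg x).const_mul _)]
      refine integral_congr_ae (.of_forall fun t => ?_)
      simp only
      ring
    simp_rw [e2]
    refine (norm_integral_mul_kernel_le hF hg.memLp (κ := fun t => τ * ‖k t‖)
      (tk.integrable.norm.const_mul τ) (fun t => by positivity) ?_).trans ?_
    · intro x t hx
      rw [norm_mul, mul_comm]
      rcases le_or_gt ‖t‖ δ with ht | ht
      · exact mul_le_mul_of_nonneg_right (hp x t hx ht) (norm_nonneg _)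
      · simp [hk.support t ht]
    · rw [integral_const_mul]
      have h1 := mul_le_mul_of_nonneg_left hk.mass hτ
      have h2 := mul_le_mul_of_nonneg_right h1 (mul_nonneg (l2_nonneg F) (l2_nonneg g))
      linarith
  refine add_le_add hP ?_
  rw [norm_mul, norm_mul, Complex.norm_I, one_mul, Complex.norm_real, Real.norm_of_nonneg hε.le]
  have hsum : ‖∑ l, ∑ j, ∫ x, F x * (conv k (pd l (fun η => a l j η * pd j g η)) x -
        pd l (fun η => a l j η * pd j (conv k g) η) x)‖ ≤
      ∑ _l : Fin n, ∑ j, C * (D + 1) * l2 F * l2 (pd j g) :=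
    (norm_sum_le _ _).trans (Finset.sum_le_sum fun l _ => (norm_sum_le _ _).trans
      (Finset.sum_le_sum fun j _ => norm_integral_commutator_le hk (H.smooth_a l j) hC
        (H.fderiv_a l j) hF hg l j))
  rw [← Finset.mul_sum, Finset.sum_const, Finset.card_univ, Fintype.card_fin, nsmul_eq_mul] at hsum
  calc ε * _ ≤ ε * (n * (C * (D + 1) * l2 F * ∑ j, l2 (pd j g))) := by gcongr
    _ = _ := by ring

/-- The commutator of a cutoff with `divOp`, tested against `w ∈ L²`. -/
theorem IsMultiplier.norm_integral_cutoff_commutator_le (H : IsMultiplier a p m C c) {ε : ℝ}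
    (hε : 0 < ε) {D : ℝ} {χ : E n → ℂ} (hχ : IsCutoff D χ) (hD : 0 ≤ D)
    {w G : E n → ℂ} (hw : MemLp w 2) (hG : IsTest G) :
    ‖∫ x, w x * (divOp ε a p (fun y => χ y * G y) x - χ x * divOp ε a p G x)‖ ≤
      l2 w * (ε * (2 * C * D * n * (n * l2 G + ∑ j, l2 (pd j G)))) := by
  have hC := H.C_nonneg
  have tχ := hχ.test
  -- the zeroth-order and the two first-order terms of the commutator
  set c0 : Fin n → Fin n → E n → ℂ := fun l k x =>
    pd l (a l k) x * pd k χ x + a l k x * pd l (pd k χ) x with hc0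
  set T : Fin n → Fin n → E n → ℂ := fun l k x =>
    c0 l k x * G x + ((a l k x * pd l χ x) * pd k G x + (a l k x * pd k χ x) * pd l G x) with hT
  have t0 : ∀ l k, IsTest (fun x => c0 l k x * G x) := fun l k =>
    IsTest.mul_left (((contDiff_pd l (H.smooth_a l k)).mul (contDiff_pd k tχ.1)).add
      ((H.smooth_a l k).mul (contDiff_pd l (contDiff_pd k tχ.1)))) hG
  have t2 : ∀ l k j i, IsTest (fun x => (a l k x * pd j χ x) * pd i G x) := fun l k j i =>
    IsTest.mul_left ((H.smooth_a l k).mul (contDiff_pd j tχ.1)) (hG.pd i)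
  have tT : ∀ l k, IsTest (T l k) := fun l k => (t0 l k).add ((t2 l k l k).add (t2 l k k l))
  have dχ := fun x => tχ.differentiableAt x
  have dG := fun x => hG.differentiableAt x
  have da := fun l k x => differentiableAt_of_smooth (H.smooth_a l k) x
  have dpχ := fun k x => (tχ.pd k).differentiableAt x
  have dpG := fun k x => (hG.pd k).differentiableAt x
  have e : ∀ x, divOp ε a p (fun y => χ y * G y) x - χ x * divOp ε a p G x =
      Complex.I * ε * ∑ l, ∑ k, T l k x := fun x => by
    have e1 : ∀ l k, pd l (fun η => a l k η * pd k (fun y => χ y * G y) η) x =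
        χ x * pd l (fun η => a l k η * pd k G η) x + T l k x := fun l k => by
      have : pd k (fun y => χ y * G y) = fun η => pd k χ η * G η + χ η * pd k G η :=
        funext fun η => pd_mul k (dχ η) (dG η)
      have d1 : DifferentiableAt ℝ (fun η => pd k χ η * G η) x := (dpχ k x).mul (dG x)
      have d2 : DifferentiableAt ℝ (fun η => χ η * pd k G η) x := (dχ x).mul (dpG k x)
      have d3 : DifferentiableAt ℝ (fun η => pd k χ η * G η + χ η * pd k G η) x := d1.add d2
      rw [this, pd_mul l (da l k x) d3, pd_add l d1 d2, pd_mul l (dpχ k x) (dG x),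
        pd_mul l (dχ x) (dpG k x), pd_mul l (da l k x) (dpG k x)]
      simp only [hT, hc0]
      ring
    simp only [divOp, e1, Finset.sum_add_distrib, ← Finset.mul_sum]
    ring
  have iT : ∀ l k, Integrable fun x => w x * T l k x := fun l k =>
    hw.integrable_mul (tT l k).memLp
  have e3 : ∀ x, w x * (divOp ε a p (fun y => χ y * G y) x - χ x * divOp ε a p G x) =
      Complex.I * ε * ∑ l, ∑ k, w x * T l k x := fun x => by
    rw [e]
    simp only [← Finset.mul_sum]
    ring
  simp_rw [e3]
  rw [integral_const_mul,
    integral_finsetSum _ fun l _ => integrable_finsetSum _ fun k _ => iT l k]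
  simp_rw [integral_finsetSum _ fun k _ => iT _ k]
  rw [norm_mul, norm_mul, Complex.norm_I, one_mul, Complex.norm_real, Real.norm_of_nonneg hε.le]
  have b1 : ∀ l k j ξ, ‖a l k ξ * pd j χ ξ‖ ≤ C * D := fun l k j ξ => by
    rw [norm_mul]
    exact mul_le_mul (H.norm_a l k ξ) (hχ.norm_pd j ξ) (norm_nonneg _) hC
  have b0 : ∀ l k ξ, ‖c0 l k ξ‖ ≤ 2 * (C * D) := fun l k ξ => by
    refine (norm_add_le _ _).trans ?_
    rw [norm_mul, norm_mul]
    have h1 := mul_le_mul ((norm_pd_le l (a l k) ξ).trans (H.fderiv_a l k ξ)) (hχ.norm_pd k ξ)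
      (norm_nonneg _) hC
    have h2 := mul_le_mul (H.norm_a l k ξ) (hχ.norm_pd_pd l k ξ) (norm_nonneg _) hC
    linarith
  have hTl : ∀ l k, l2 (T l k) ≤ C * D * (2 * l2 G + l2 (pd k G) + l2 (pd l G)) := fun l k => by
    have h1 := l2_add_le (t0 l k).memLp ((t2 l k l k).add (t2 l k k l)).memLp
    have h2 := l2_add_le (t2 l k l k).memLp (t2 l k k l).memLp
    have h3 := l2_mul_le hG.memLp (by positivity) (b0 l k)
    have h4 := l2_mul_le (hG.pd k).memLp (by positivity) (b1 l k l)
    have h5 := l2_mul_le (hG.pd l).memLp (by positivity) (b1 l k k)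
    have h6 : l2 (T l k) ≤ _ := h1
    linarith
  have hsum : ‖∑ l, ∑ k, ∫ x, w x * T l k x‖ ≤
      ∑ l, ∑ k, l2 w * (C * D * (2 * l2 G + l2 (pd k G) + l2 (pd l G))) :=
    (norm_sum_le _ _).trans (Finset.sum_le_sum fun l _ => (norm_sum_le _ _).trans
      (Finset.sum_le_sum fun k _ => (norm_integral_mul_le hw (tT l k).memLp).trans
        (mul_le_mul_of_nonneg_left (hTl l k) (l2_nonneg w))))
  simp only [← Finset.mul_sum, Finset.sum_add_distrib, Finset.sum_const, Finset.card_univ,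
    Fintype.card_fin, nsmul_eq_mul] at hsum
  calc _ ≤ ε * _ := mul_le_mul_of_nonneg_left hsum hε.le
    _ = _ := by ring

/-- If `w ∈ L²` annihilates the range of `divOp` on test functions, the mollification `u` of
`χ w` is almost annihilated by `divOp`. -/
theorem IsMultiplier.norm_integral_mollified_le (H : IsMultiplier a p m C c) {ε : ℝ}
    (hε : 0 < ε) {δ D τ : ℝ} {k χ : E n → ℂ} (hk : IsMollifier δ D k) (hχ : IsCutoff D χ)
    (hD : 0 ≤ D) (hτ : 0 ≤ τ) (hp : ∀ x t, χ x ≠ 0 → ‖t‖ ≤ δ → ‖p (x - t) - p x‖ ≤ τ)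
    {w g : E n → ℂ} (hw : MemLp w 2) (hg : IsTest g)
    (hann : ∀ v, IsTest v → ∫ x, w x * divOp ε a p v x = 0) :
    ‖∫ x, conv k (fun y => χ y * w y) x * divOp ε a p g x‖ ≤
      l2 w * (τ * l2 g + ε * (3 * C * (D + 1) * n * (n * l2 g + ∑ j, l2 (pd j g)))) := by
  have hC := H.C_nonneg
  have tk := hk.test
  have tχ := hχ.test
  have tG : IsTest (conv k g) := isTest_conv tk hg.integrable.locallyIntegrable hg.2
  have tS := H.isTest_divOp ε hg
  have hF : MemLp (fun y => χ y * w y) 2 :=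
    hw.of_le_mul (c := 1) (tχ.1.continuous.aestronglyMeasurable.mul hw.1) (.of_forall fun x => by
      rw [norm_mul]
      exact mul_le_mul_of_nonneg_right (hχ.norm_le x) (norm_nonneg _))
  have hFl : l2 (fun y => χ y * w y) ≤ l2 w := by
    simpa using l2_mul_le hw zero_le_one hχ.norm_le
  have iF : Integrable (fun y => χ y * w y) := by
    have := hw.integrable_mul tχ.memLp
    refine this.congr (.of_forall fun y => ?_)
    simp [mul_comm]
  rw [integral_conv_mul tk hk.even iF tS.integrable]
  have tcS : IsTest (conv k (divOp ε a p g)) :=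
    isTest_conv tk tS.integrable.locallyIntegrable tS.2
  have tSG := H.isTest_divOp ε tG
  have tχG : IsTest (fun y => χ y * conv k g y) := IsTest.mul_left tχ.1 tG
  have h0 := hann _ tχG
  have split : ∫ x, (χ x * w x) * conv k (divOp ε a p g) x =
      (∫ x, (χ x * w x) * (conv k (divOp ε a p g) x - divOp ε a p (conv k g) x)) -
      ∫ x, w x * (divOp ε a p (fun y => χ y * conv k g y) x - χ x * divOp ε a p (conv k g) x) := by
    have i1 : Integrable fun x => w x * divOp ε a p (fun y => χ y * conv k g y) x :=
      hw.integrable_mul (H.isTest_divOp ε tχG).memLp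
    have e1 : ∫ x, (χ x * w x) * conv k (divOp ε a p g) x =
      ∫ x, ((χ x * w x) * conv k (divOp ε a p g) x -
        w x * divOp ε a p (fun y => χ y * conv k g y) x) := by
      rw [integral_sub (integrable_memLp_mul_test hF tcS) i1, h0, sub_zero]
    rw [e1, ← integral_sub (integrable_memLp_mul_test hF (tcS.sub tSG))
      (integrable_memLp_mul_test hw ((H.isTest_divOp ε tχG).sub (IsTest.mul_left tχ.1 tSG)))]
    refine integral_congr_ae (.of_forall fun x => ?_)
    simp only
    ring
  rw [split]
  have h1 := H.norm_integral_mollifier_commutator_le hε hk hτ hF hg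
    (fun x t hx => hp x t (left_ne_zero_of_mul hx))
  have h2 := H.norm_integral_cutoff_commutator_le hε hχ hD hw tG
  have h3 : l2 (conv k g) ≤ l2 g := l2_conv_le tk hk.mass hg
  have h4 : ∀ j, l2 (pd j (conv k g)) ≤ l2 (pd j g) := fun j => by
    rw [show pd j (conv k g) = conv k (pd j g) from
      funext fun x => pd_conv_right j tk.integrable.locallyIntegrable hg x]
    exact l2_conv_le tk hk.mass (hg.pd j)
  have h5 : ∑ j, l2 (pd j (conv k g)) ≤ ∑ j, l2 (pd j g) := Finset.sum_le_sum fun j _ => h4 j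
  have hW := l2_nonneg w
  have hg0 := l2_nonneg g
  have hs0 : 0 ≤ ∑ j, l2 (pd j g) := Finset.sum_nonneg fun j _ => l2_nonneg _
  generalize ∑ j, l2 (pd j (conv k g)) = Y' at h2 h5
  generalize ∑ j, l2 (pd j g) = Y at h1 h5 hs0 ⊢
  refine (norm_sub_le _ _).trans ((add_le_add h1 h2).trans ?_)
  generalize l2 (conv k g) = X' at h2 h3 ⊢
  have h6 : 2 * C * D * n * (n * X' + Y') ≤ 2 * C * D * n * (n * l2 g + Y) := by gcongr
  have h7 : 0 ≤ C * n * ((D + 3) * (n * l2 g) + 2 * Y) := by positivity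
  have h8 : C * (D + 1) * n * Y + 2 * C * D * n * (n * X' + Y') ≤
      3 * C * (D + 1) * n * (n * l2 g + Y) := by linarith
  have h9 : l2 (fun y => χ y * w y) * (τ * l2 g + ε * (C * (D + 1) * n * Y)) ≤
      l2 w * (τ * l2 g + ε * (C * (D + 1) * n * Y)) := by gcongr
  have h10 := mul_le_mul_of_nonneg_left (mul_le_mul_of_nonneg_left h8 hε.le) hW
  linarith

end Commutators

/-! ### Existence of mollifiers and cutoffs -/

theorem pd_comp_smul (l : Fin n) (f : E n → ℂ) (r : ℝ) (x : E n) :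
    pd l (fun y => f (r • y)) x = r * pd l f (r • x) := by
  rw [pd, fderiv_comp_smul]
  simp [pd]

theorem pd_const_mul (l : Fin n) (z : ℂ) {f : E n → ℂ} {x : E n} (hf : DifferentiableAt ℝ f x) :
    pd l (fun y => z * f y) x = z * pd l f x := by
  rw [pd_mul l (differentiableAt_const z) hf]
  simp [pd]

theorem differentiableAt_comp_smul {f : E n → ℂ} (hf : Differentiable ℝ f) (r : ℝ) (x : E n) :
    DifferentiableAt ℝ (fun y => f (r • y)) x :=
  (hf _).comp x (differentiableAt_id.const_smul r)

/-- The bump function on the ball of radius `2 r`, equal to `1` on the ball of radius `r`. -/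
noncomputable def scaledBump (n : ℕ) (r : ℝ) (hr : 0 < r) : ContDiffBump (0 : E n) :=
  ⟨r, 2 * r, hr, by linarith⟩

theorem scaledBump_apply (r : ℝ) (hr : 0 < r) (x : E n) :
    scaledBump n r hr x = scaledBump n 1 one_pos (r⁻¹ • x) := by
  rw [ContDiffBump.apply, ContDiffBump.apply]
  simp only [scaledBump, sub_zero, inv_one, one_smul, mul_one, div_one]
  rw [mul_div_assoc, div_self hr.ne', mul_one]

theorem scaledBump_normed_apply (r : ℝ) (hr : 0 < r) (x : E n) :
    (scaledBump n r hr).normed volume x =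
      (r⁻¹) ^ n * (scaledBump n 1 one_pos).normed volume (r⁻¹ • x) := by
  have h : ∫ y, scaledBump n r hr y = r ^ n * ∫ y, scaledBump n 1 one_pos y := by
    simp_rw [scaledBump_apply r hr]
    rw [Measure.integral_comp_smul volume (fun y => scaledBump n 1 one_pos y),
      finrank_euclideanSpace, Fintype.card_fin, smul_eq_mul, abs_of_pos (by positivity)]
    simp
  rw [ContDiffBump.normed_def, ContDiffBump.normed_def, h, scaledBump_apply r hr]
  have : (∫ y, scaledBump n 1 one_pos y) ≠ 0 :=
    (ContDiffBump.integral_pos (scaledBump n 1 one_pos) (μ := volume)).ne'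
  generalize scaledBump n 1 one_pos (r⁻¹ • x) = z
  rw [inv_pow]
  field_simp

theorem isTest_ofReal {f : E n → ℝ} (hf : ContDiff ℝ ∞ f) (hc : HasCompactSupport f) :
    IsTest fun x => (f x : ℂ) :=
  ⟨Complex.ofRealCLM.contDiff.comp hf, hc.comp_left Complex.ofReal_zero⟩

/-- The normalized bump `r⁻ⁿ η(·/r)`, as a complex function. -/
noncomputable def bumpKernel (n : ℕ) (r : ℝ) (hr : 0 < r) (x : E n) : ℂ :=
  ((scaledBump n r hr).normed volume x : ℝ)

theorem isTest_bumpKernel (r : ℝ) (hr : 0 < r) : IsTest (bumpKernel n r hr) :=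
  isTest_ofReal (ContDiffBump.contDiff_normed (n := (⊤ : ℕ∞)) _)
    (ContDiffBump.hasCompactSupport_normed _)

/-- The first moment of `|∂ bumpKernel|` is invariant under scaling. -/
theorem moment_bumpKernel (l : Fin n) (r : ℝ) (hr : 0 < r) :
    ∫ t, ‖t‖ * ‖pd l (bumpKernel n r hr) t‖ = ∫ t, ‖t‖ * ‖pd l (bumpKernel n 1 one_pos) t‖ := by
  have h : bumpKernel n r hr = fun x => (((r⁻¹) ^ n : ℝ) : ℂ) *
      bumpKernel n 1 one_pos (r⁻¹ • x) := by
    funext x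
    simp only [bumpKernel]
    rw [scaledBump_normed_apply]
    push_cast
    ring
  have t1 := isTest_bumpKernel (n := n) 1 one_pos
  have hd : ∀ t, ‖t‖ * ‖pd l (bumpKernel n r hr) t‖ = (r⁻¹) ^ n *
      (‖r⁻¹ • t‖ * ‖pd l (bumpKernel n 1 one_pos) (r⁻¹ • t)‖) := fun t => by
    rw [h, pd_const_mul l _ (differentiableAt_comp_smul t1.differentiableAt _ _), pd_comp_smul]
    have hr' : |r| = r := abs_of_pos hr
    simp [norm_smul, hr']
    ring
  simp_rw [hd]
  rw [integral_const_mul, Measure.integral_comp_smul volume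
    (fun t => ‖t‖ * ‖pd l (bumpKernel n 1 one_pos) t‖), finrank_euclideanSpace, Fintype.card_fin,
    smul_eq_mul, abs_of_pos (by positivity)]
  field_simp

/-- An approximate identity whose moment bound `D` is the same for all its members. -/
theorem exists_mollifiers (n : ℕ) : ∃ D : ℝ, 0 ≤ D ∧ ∃ (δ : ℕ → ℝ) (k : ℕ → E n → ℂ),
    Filter.Tendsto δ Filter.atTop (nhds 0) ∧ (∀ j, IsMollifier (δ j) D (k j)) ∧
    ∀ f : E n → ℂ, LocallyIntegrable f → ∀ᵐ x, Filter.Tendsto (fun j => conv (k j) f x)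
      Filter.atTop (nhds (f x)) := by
  have hpos : ∀ j : ℕ, (0 : ℝ) < 1 / (j + 1) := fun j => by positivity
  have hlim : Filter.Tendsto (fun j : ℕ => 2 * (1 / ((j : ℝ) + 1))) Filter.atTop (nhds 0) := by
    simpa using (tendsto_one_div_add_atTop_nhds_zero_nat (𝕜 := ℝ)).const_mul 2
  refine ⟨∑ l, ∫ t, ‖t‖ * ‖pd l (bumpKernel n 1 one_pos) t‖, Finset.sum_nonneg fun l _ =>
    integral_nonneg fun t => by positivity, fun j => 2 * (1 / (j + 1)),
    fun j => bumpKernel n _ (hpos j), hlim, fun j => ?_, fun f hf => ?_⟩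
  · refine ⟨isTest_bumpKernel _ _, fun t => ?_, fun t ht => ?_, ?_, fun l => ?_⟩
    · simp only [bumpKernel]
      rw [ContDiffBump.normed_neg]
    · have : t ∉ Function.support ((scaledBump n _ (hpos j)).normed volume) := by
        rw [ContDiffBump.support_normed_eq]
        simp only [Metric.mem_ball, dist_zero_right, not_lt]
        exact ht.le
      simp only [bumpKernel]
      rw [Function.notMem_support.mp this, Complex.ofReal_zero]
    · have : ∀ t, ‖bumpKernel n _ (hpos j) t‖ = (scaledBump n _ (hpos j)).normed volume t :=
        fun t => by
          rw [bumpKernel, Complex.norm_real, Real.norm_of_nonneg (ContDiffBump.nonneg_normed _ _)]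
      simp_rw [this, ContDiffBump.integral_normed]
      exact le_rfl
    · rw [moment_bumpKernel]
      exact Finset.single_le_sum (f := fun l => ∫ t, ‖t‖ * ‖pd l (bumpKernel n 1 one_pos) t‖)
        (fun l _ => integral_nonneg fun t => by positivity) (Finset.mem_univ l)
  · have := ContDiffBump.ae_convolution_tendsto_right_of_locallyIntegrable
      (φ := fun j : ℕ => scaledBump n _ (hpos j)) (K := 2) hlim
      (.of_forall fun j => le_rfl) hf
    filter_upwards [this] with x hx
    refine hx.congr fun j => ?_
    rw [convolution_def, conv]
    refine integral_congr_ae (.of_forall fun t => ?_)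
    simp [bumpKernel]

/-- Cutoffs exhausting `ℝⁿ` with a common bound on their derivatives. -/
theorem exists_cutoffs (n : ℕ) : ∃ D : ℝ, 0 ≤ D ∧ ∃ χ : ℕ → E n → ℂ,
    (∀ j, IsCutoff D (χ j)) ∧ ∀ x, ∀ᶠ j in Filter.atTop, χ j x = 1 := by
  set η : E n → ℂ := fun x => (scaledBump n 1 one_pos x : ℂ) with hη
  have tη : IsTest η := isTest_ofReal (ContDiffBump.contDiff _) (ContDiffBump.hasCompactSupport _)
  have hb : ∀ f : E n → ℂ, IsTest f → ∃ B, ∀ x, ‖f x‖ ≤ B := fun f hf =>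
    hf.1.continuous.bounded_above_of_compact_support hf.2
  choose B1 hB1 using fun k => hb _ (tη.pd k)
  choose B2 hB2 using fun l k => hb _ ((tη.pd k).pd l)
  have n1 : ∀ k, 0 ≤ B1 k := fun k => (norm_nonneg _).trans (hB1 k 0)
  have n2 : ∀ l k, 0 ≤ B2 l k := fun l k => (norm_nonneg _).trans (hB2 l k 0)
  have s1 : 0 ≤ ∑ k, B1 k := Finset.sum_nonneg fun k _ => n1 k
  have s2 : 0 ≤ ∑ l, ∑ k, B2 l k := Finset.sum_nonneg fun l _ => Finset.sum_nonneg fun k _ => n2 l k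
  have hr1 : ∀ j : ℕ, |((j : ℝ) + 1)⁻¹| ≤ 1 := fun j => by
    rw [abs_of_pos (by positivity)]
    exact inv_le_one_of_one_le₀ (by linarith [(Nat.cast_nonneg j : (0 : ℝ) ≤ j)])
  have hpd : ∀ (j : ℕ) k, pd k (fun x => η (((j : ℝ) + 1)⁻¹ • x)) =
      fun x => ((((j : ℝ) + 1)⁻¹ : ℝ) : ℂ) * pd k η (((j : ℝ) + 1)⁻¹ • x) := fun j k => by
    funext x
    rw [pd_comp_smul]
  refine ⟨(∑ k, B1 k) + ∑ l, ∑ k, B2 l k, by positivity,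
    fun j x => η (((j : ℝ) + 1)⁻¹ • x), fun j => ⟨?_, fun ξ => ?_, fun k ξ => ?_, fun l k ξ => ?_⟩,
    fun x => ?_⟩
  · have h0 : ((j : ℝ) + 1)⁻¹ ≠ 0 := by positivity
    exact ⟨tη.1.comp (contDiff_id.const_smul _),
      tη.2.comp_homeomorph (Homeomorph.smulOfNeZero _ h0)⟩
  · rw [hη]
    simp only
    rw [Complex.norm_real, Real.norm_of_nonneg (ContDiffBump.nonneg _)]
    exact ContDiffBump.le_one _
  · rw [hpd]
    rw [norm_mul, Complex.norm_real, Real.norm_eq_abs]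
    have h1 := Finset.single_le_sum (f := B1) (fun k _ => n1 k) (Finset.mem_univ k)
    have h2 := mul_le_mul (hr1 j) (hB1 k (((j : ℝ) + 1)⁻¹ • ξ)) (norm_nonneg _) zero_le_one
    linarith
  · rw [hpd, pd_const_mul l _ (differentiableAt_comp_smul (tη.pd k).differentiableAt _ _),
      pd_comp_smul, norm_mul, norm_mul, Complex.norm_real, Real.norm_eq_abs]
    have h1 := Finset.single_le_sum (f := fun k => B2 l k) (fun k _ => n2 l k) (Finset.mem_univ k)
    have h3 := Finset.single_le_sum (f := fun l => ∑ k, B2 l k)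
      (fun l _ => Finset.sum_nonneg fun k _ => n2 l k) (Finset.mem_univ l)
    have h2 := mul_le_mul (hr1 j) (hB2 l k (((j : ℝ) + 1)⁻¹ • ξ)) (norm_nonneg _) zero_le_one
    have h4 := mul_le_mul (hr1 j) h2 (by positivity) zero_le_one
    linarith
  · obtain ⟨N, hN⟩ := exists_nat_ge ‖x‖
    filter_upwards [Filter.eventually_ge_atTop N] with j hj
    have hj' : (N : ℝ) ≤ j := by exact_mod_cast hj
    rw [hη]
    simp only
    rw [ContDiffBump.one_of_mem_closedBall, Complex.ofReal_one]
    rw [mem_closedBall_zero_iff, norm_smul, Real.norm_of_nonneg (by positivity)]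
    change _ ≤ (1 : ℝ)
    rw [inv_mul_le_iff₀ (by positivity)]
    linarith

/-! ### Injectivity and density for divergence-form operators -/

section Conclusion

variable {a : Fin n → Fin n → E n → ℂ} {p m : E n → ℂ} {C c : ℝ}

/-- The numerical content of the injectivity argument: the energy inequality makes `X` at most
half of `W` once `ε` is small. -/
theorem exists_eps_half {c A B K : ℝ} (hc : 0 < c) (hA : 0 ≤ A) (hK : 0 < K) :
    ∃ ε₀ > 0, ∀ ε, 0 < ε → ε < ε₀ → ∀ X Y W : ℝ, 0 ≤ X → 0 ≤ Y → 0 ≤ W →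
      c * X ^ 2 + ε * (K * Y ^ 2) ≤ W * (ε * (A * (X + Y))) + ε * (B * (X * Y)) → X ≤ W / 2 := by
  set M := 8 * A + 8 * A ^ 2 / K + 2 * B ^ 2 / K + 1 with hM
  have hM0 : 0 < M := by positivity
  refine ⟨c / M, by positivity, fun ε hε hlt X Y W hX hY hW h => ?_⟩
  by_contra! hWX
  have hεM : ε * M < c := by rwa [lt_div_iff₀ hM0] at hlt
  have hXp : 0 < X := by linarith
  -- absorb the terms containing `Y` into `K Y ^ 2`
  have y1 : W * (A * Y) ≤ K / 2 * Y ^ 2 + A ^ 2 * W ^ 2 / (2 * K) := by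
    have : 0 ≤ (K * Y - A * W) ^ 2 / (2 * K) := by positivity
    have e : (K * Y - A * W) ^ 2 / (2 * K) =
      K / 2 * Y ^ 2 + A ^ 2 * W ^ 2 / (2 * K) - W * (A * Y) := by field_simp; ring
    linarith
  have y2 : B * (X * Y) ≤ K / 2 * Y ^ 2 + B ^ 2 * X ^ 2 / (2 * K) := by
    have : 0 ≤ (K * Y - B * X) ^ 2 / (2 * K) := by positivity
    have e : (K * Y - B * X) ^ 2 / (2 * K) =
      K / 2 * Y ^ 2 + B ^ 2 * X ^ 2 / (2 * K) - B * (X * Y) := by field_simp; ring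
    linarith
  have w1 : W * (A * X) ≤ 2 * A * X ^ 2 := by nlinarith [mul_nonneg hA hX]
  have w2 : A ^ 2 * W ^ 2 / (2 * K) ≤ A ^ 2 * (2 * X) ^ 2 / (2 * K) := by gcongr; linarith
  have e2 : A ^ 2 * (2 * X) ^ 2 / (2 * K) = 2 * (A ^ 2 / K) * X ^ 2 := by field_simp
  have e3 : B ^ 2 * X ^ 2 / (2 * K) = (B ^ 2 / K) / 2 * X ^ 2 := by field_simp
  have hq1 : 0 ≤ A ^ 2 / K := by positivity
  have hq2 : 0 ≤ B ^ 2 / K := by positivity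
  have tot : W * (A * (X + Y)) + B * (X * Y) - K * Y ^ 2 ≤ M * X ^ 2 := by
    rw [hM, mul_div_assoc, mul_div_assoc]
    nlinarith [mul_nonneg hA (sq_nonneg X), mul_nonneg hq1 (sq_nonneg X),
      mul_nonneg hq2 (sq_nonneg X), sq_nonneg X]
  have := mul_le_mul_of_nonneg_left tot hε.le
  have h2 : c * X ^ 2 ≤ ε * M * X ^ 2 := by nlinarith
  nlinarith [mul_pos hXp hXp]

/-- Cauchy–Schwarz; the denominator `n + 1` instead of `n` is nonzero also for `n = 0`. -/
theorem sum_sq_ge {Z : Fin n → ℝ} : (∑ k, Z k) ^ 2 / (n + 1) ≤ ∑ k, Z k ^ 2 := by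
  have h := sq_sum_le_card_mul_sum_sq (s := Finset.univ) (f := Z)
  rw [Finset.card_univ, Fintype.card_fin] at h
  rw [div_le_iff₀ (by positivity)]
  have : 0 ≤ ∑ k, Z k ^ 2 := Finset.sum_nonneg fun k _ => sq_nonneg _
  nlinarith

/-- The energy estimate with `(∑ ‖∂_k u‖)²` in place of `∑ ‖∂_k u‖²`. -/
theorem IsMultiplier.energy_sq_sum (H : IsMultiplier a p m C c) (hc : 0 ≤ c) {ε : ℝ} (hε : 0 < ε)
    {u : E n → ℂ} (hu : IsTest u) :
    c * l2 u ^ 2 + ε * (c / (n + 1) * (∑ k, l2 (pd k u)) ^ 2) ≤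
      ‖∫ ξ, (m ξ * starRingEnd ℂ (u ξ)) * divOp ε a p u ξ‖ +
        ε * (C ^ 2 * n * (l2 u * ∑ k, l2 (pd k u))) := by
  refine le_trans ?_ (H.energy hε hu)
  have := mul_le_mul_of_nonneg_left (sum_sq_ge (Z := fun k => l2 (pd k u))) hc
  have e : c / (n + 1) * (∑ k, l2 (pd k u)) ^ 2 = c * ((∑ k, l2 (pd k u)) ^ 2 / (n + 1)) := by ring
  rw [e]
  gcongr

/-- `divOp` is bounded below on test functions for small `ε`. -/
theorem exists_eps_bounded_below (n : ℕ) {C c : ℝ} (hC : 0 ≤ C) (hc : 0 < c) :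
    ∃ ε₀ > 0, ∀ (a : Fin n → Fin n → E n → ℂ) (p m : E n → ℂ), IsMultiplier a p m C c →
      ∀ ε, 0 < ε → ε < ε₀ → ∀ v, IsTest v → l2 v ≤ 2 * C / c * l2 (divOp ε a p v) := by
  set B := C ^ 2 * n with hB
  set K := c / (n + 1) with hK
  have hB0 : 0 ≤ B := by positivity
  have hK0 : 0 < K := by positivity
  set M := B ^ 2 / (4 * K) + 1 with hM
  have hM0 : 0 < M := by positivity
  refine ⟨c / (2 * M), by positivity, fun a p m H ε hε hlt v hv => ?_⟩
  have hεM : ε * (2 * M) < c := by rwa [lt_div_iff₀ (by positivity)] at hlt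
  have h := H.energy_sq_sum hc.le hε hv
  have tS := H.isTest_divOp ε hv
  have h1 : ‖∫ ξ, (m ξ * starRingEnd ℂ (v ξ)) * divOp ε a p v ξ‖ ≤
      C * l2 v * l2 (divOp ε a p v) := by
    refine (norm_integral_mul_le (IsTest.mul_left H.smooth_m hv.conj).memLp tS.memLp).trans ?_
    gcongr
    · exact l2_nonneg _
    · rw [← l2_conj v]
      exact l2_mul_le hv.conj.memLp hC H.norm_m
  have hX := l2_nonneg v
  have hS := l2_nonneg (divOp ε a p v)
  rw [← hB, ← hK] at h
  generalize l2 (divOp ε a p v) = S at *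
  generalize l2 v = X at *
  generalize ∑ k, l2 (pd k v) = Y at *
  have y2 : B * (X * Y) ≤ K * Y ^ 2 + B ^ 2 / (4 * K) * X ^ 2 := by
    have : 0 ≤ (2 * K * Y - B * X) ^ 2 / (4 * K) := by positivity
    have e : (2 * K * Y - B * X) ^ 2 / (4 * K) =
      K * Y ^ 2 + B ^ 2 / (4 * K) * X ^ 2 - B * (X * Y) := by field_simp; ring
    linarith
  have y3 := mul_le_mul_of_nonneg_left y2 hε.le
  have y4 : c * X ^ 2 ≤ C * X * S + ε * M * X ^ 2 := by
    have : 0 ≤ ε * X ^ 2 := by positivity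
    rw [hM]
    linarith
  have y5 : c / 2 * X ^ 2 ≤ C * X * S := by
    have : ε * (2 * M) * X ^ 2 ≤ c * X ^ 2 := by gcongr
    linarith
  rcases hX.eq_or_lt with h0 | h0
  · rw [← h0]; positivity
  · have : c / 2 * X ≤ C * S := by
      by_contra! hlt
      nlinarith
    rw [div_mul_eq_mul_div, le_div_iff₀ hc]
    linarith

/-- For small `ε`, only the zero function of `L²` annihilates the range of `divOp` on test
functions. -/
theorem exists_eps_annihilator (n : ℕ) {C c : ℝ} (hC : 0 ≤ C) (hc : 0 < c) :
    ∃ ε₀ > 0, ∀ (a : Fin n → Fin n → E n → ℂ) (p m : E n → ℂ), IsMultiplier a p m C c →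
      ∀ ε, 0 < ε → ε < ε₀ → ∀ w : E n → ℂ, MemLp w 2 →
        (∀ v, IsTest v → ∫ x, w x * divOp ε a p v x = 0) → w =ᵐ[volume] 0 := by
  obtain ⟨D1, hD1, δ, k, hδ, hk, hconv⟩ := exists_mollifiers n
  obtain ⟨D2, hD2, χ, hχ, hχ1⟩ := exists_cutoffs n
  set D := D1 + D2 with hD
  have hk' : ∀ j, IsMollifier (δ j) D (k j) := fun j =>
    ⟨(hk j).test, (hk j).even, (hk j).support, (hk j).mass, fun l => ((hk j).moment l).trans
      (by linarith)⟩
  have hχ' : ∀ j, IsCutoff D (χ j) := fun j => ⟨(hχ j).test, (hχ j).norm_le, fun l x =>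
    ((hχ j).norm_pd l x).trans (by linarith), fun l i x => ((hχ j).norm_pd_pd l i x).trans
      (by linarith)⟩
  have hD0 : 0 ≤ D := by positivity
  set A := C + 3 * C * (D + 1) * n * (2 * n * C + C) with hA
  obtain ⟨ε₀, hε₀, hnum⟩ := exists_eps_half (c := c) (A := A) (B := C ^ 2 * n)
    (K := c / (n + 1)) hc (by positivity) (by positivity)
  refine ⟨ε₀, hε₀, fun a p m H ε hε hlt w hw hann => ?_⟩
  have hF : ∀ i, MemLp (fun y => χ i y * w y) 2 := fun i =>
    hw.of_le_mul (c := 1) ((hχ i).test.1.continuous.aestronglyMeasurable.mul hw.1)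
      (.of_forall fun x => by
        rw [norm_mul]
        exact mul_le_mul_of_nonneg_right ((hχ i).norm_le x) (norm_nonneg _))
  have hFi : ∀ i, LocallyIntegrable (fun y => χ i y * w y) := fun i =>
    (hF i).locallyIntegrable (by norm_num)
  have tu : ∀ i j, IsTest (conv (k j) (fun y => χ i y * w y)) := fun i j =>
    isTest_conv (hk j).test (hFi i) (hχ i).test.2.mul_right
  -- the bound holds for all fine enough mollifications of a given truncation: `p` is uniformly
  -- continuous on compact sets only
  have hu : ∀ i, ∀ᶠ j in Filter.atTop, l2 (conv (k j) (fun y => χ i y * w y)) ≤ l2 w / 2 := by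
    intro i
    obtain ⟨R, hR⟩ := (hχ i).test.2.isCompact.isBounded.subset_closedBall (0 : E n)
    have huc := (isCompact_closedBall (0 : E n) (R + 1)).uniformContinuousOn_of_continuous
      H.smooth_p.continuous.continuousOn
    rw [Metric.uniformContinuousOn_iff_le] at huc
    obtain ⟨d, hd, hdp⟩ := huc ε hε
    have hdm : 0 < min d 1 := lt_min hd one_pos
    filter_upwards [hδ.eventually (gt_mem_nhds hdm)] with j hj
    have hp : ∀ x t, χ i x ≠ 0 → ‖t‖ ≤ δ j → ‖p (x - t) - p x‖ ≤ ε := by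
      intro x t hx ht
      have hxR : ‖x‖ ≤ R := by
        simpa using hR (subset_tsupport _ (Function.mem_support.mpr hx))
      have ht1 : ‖t‖ ≤ 1 := ht.trans (hj.le.trans (min_le_right _ _))
      have := hdp (x - t) (by
        rw [mem_closedBall_zero_iff]
        exact (norm_sub_le _ _).trans (add_le_add hxR ht1)) x (by
        rw [mem_closedBall_zero_iff]; linarith) (by
        rw [dist_eq_norm, sub_sub_cancel_left, norm_neg]
        exact ht.trans (hj.le.trans (min_le_left _ _)))
      rwa [dist_eq_norm] at this
    set u := conv (k j) (fun y => χ i y * w y) with hudef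
    have hut : IsTest u := tu i j
    set g : E n → ℂ := fun ξ => m ξ * starRingEnd ℂ (u ξ) with hg
    have tg : IsTest g := IsTest.mul_left H.smooth_m hut.conj
    have hb := H.norm_integral_mollified_le hε (hk' j) (hχ' i) hD0 hε.le hp hw tg hann
    rw [← hudef, H.divOp_symm ε hut tg] at hb
    have hen := H.energy_sq_sum hc.le hε hut
    have hgl : l2 g ≤ C * l2 u := by
      rw [← l2_conj u]
      exact l2_mul_le hut.conj.memLp hC H.norm_m
    have hgd : ∀ l, l2 (pd l g) ≤ C * l2 u + C * l2 (pd l u) := fun l => by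
      have e : pd l g = fun ξ => pd l m ξ * starRingEnd ℂ (u ξ) +
          m ξ * starRingEnd ℂ (pd l u ξ) := funext fun ξ => by
        rw [hg, pd_mul l (differentiableAt_of_smooth H.smooth_m ξ) (hut.conj.differentiableAt ξ),
          pd_conj]
      rw [e]
      refine (l2_add_le (IsTest.mul_left (contDiff_pd l H.smooth_m) hut.conj).memLp
        (IsTest.mul_left H.smooth_m (hut.pd l).conj).memLp).trans (add_le_add ?_ ?_)
      · rw [← l2_conj u]
        exact l2_mul_le hut.conj.memLp hC fun ξ => (norm_pd_le _ _ _).trans (H.fderiv_m ξ)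
      · rw [← l2_conj (pd l u)]
        exact l2_mul_le (hut.pd l).conj.memLp hC H.norm_m
    have hgs : ∑ l, l2 (pd l g) ≤ n * (C * l2 u) + C * ∑ l, l2 (pd l u) := by
      refine (Finset.sum_le_sum fun l _ => hgd l).trans (le_of_eq ?_)
      rw [Finset.sum_add_distrib, Finset.mul_sum, Finset.sum_const, Finset.card_univ,
        Fintype.card_fin, nsmul_eq_mul]
    have hX := l2_nonneg u
    have hW := l2_nonneg w
    have hY : 0 ≤ ∑ l, l2 (pd l u) := Finset.sum_nonneg fun l _ => l2_nonneg _
    refine hnum ε hε hlt _ (∑ l, l2 (pd l u)) _ hX hY hW (hen.trans ?_)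
    gcongr
    refine hb.trans (mul_le_mul_of_nonneg_left ?_ hW)
    generalize ∑ l, l2 (pd l u) = Y at *
    generalize ∑ l, l2 (pd l g) = Z at *
    generalize l2 g = G at *
    generalize l2 u = X at *
    have h1 : ε * G + ε * (3 * C * (D + 1) * n * (n * G + Z)) ≤
        ε * (C * X) + ε * (3 * C * (D + 1) * n * (n * (C * X) + (n * (C * X) + C * Y))) := by
      gcongr
    refine h1.trans ?_
    rw [← mul_add]
    gcongr
    rw [hA]
    have h2 : 0 ≤ 3 * C * (D + 1) * n * (C * X + 2 * n * C * Y) + C * Y := by positivity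
    linarith
  have hχw : ∀ i, eLpNorm (fun y => χ i y * w y) 2 volume ≤ ENNReal.ofReal (l2 w / 2) := by
    intro i
    refine (Lp.eLpNorm_lim_le_liminf_eLpNorm (fun j => (tu i j).memLp.1) _
      (hconv _ (hFi i))).trans ?_
    refine Filter.liminf_le_of_frequently_le' (Filter.Eventually.frequently ?_)
    filter_upwards [hu i] with j hj
    rw [← ENNReal.ofReal_toReal (tu i j).memLp.2.ne]
    exact ENNReal.ofReal_le_ofReal hj
  have hw2 : eLpNorm w 2 volume ≤ ENNReal.ofReal (l2 w / 2) := by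
    refine (Lp.eLpNorm_lim_le_liminf_eLpNorm (fun i => (hF i).1) w (.of_forall fun x => ?_)).trans
      (Filter.liminf_le_of_frequently_le' (Filter.Frequently.of_forall hχw))
    refine tendsto_const_nhds.congr' ?_
    filter_upwards [hχ1 x] with i hi
    rw [hi, one_mul]
  have hW := l2_nonneg w
  have h0 : l2 w = 0 := by
    have := ENNReal.toReal_mono ENNReal.ofReal_ne_top hw2
    rw [ENNReal.toReal_ofReal (by positivity)] at this
    change l2 w ≤ l2 w / 2 at this
    linarith
  rw [h0, zero_div, ENNReal.ofReal_zero, nonpos_iff_eq_zero] at hw2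
  exact (eLpNorm_eq_zero_iff hw.1 (by norm_num)).1 hw2

end Conclusion

/-! ### The profile -/

section Profile

variable {γ : ℝ} {ρ : ℝ → ℝ}

theorem IsProfile.contDiffAt (hρ : IsProfile γ ρ) {t : ℝ} (ht : 0 < t) : ContDiffAt ℝ ∞ ρ t :=
  hρ.smooth.contDiffAt (Ici_mem_nhds ht)

theorem IsProfile.differentiableAt (hρ : IsProfile γ ρ) {t : ℝ} (ht : 0 < t) :
    DifferentiableAt ℝ ρ t := (hρ.contDiffAt ht).differentiableAt (by simp)

theorem IsProfile.zero (hρ : IsProfile γ ρ) : ρ 0 = 0 := by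
  obtain ⟨r, hr, h⟩ := hρ.zero_near
  exact h 0 le_rfl hr.le

theorem IsProfile.deriv_zero_near (hρ : IsProfile γ ρ) :
    ∃ r > 0, ∀ t, 0 ≤ t → t < r → ρ t = 0 ∧ deriv ρ t = 0 := by
  obtain ⟨r, hr, h⟩ := hρ.zero_near
  refine ⟨r, hr, fun t ht htr => ⟨h t ht htr.le, ?_⟩⟩
  by_cases hdiff : DifferentiableAt ℝ ρ t
  · rw [← hdiff.derivWithin (uniqueDiffOn_Ici (0 : ℝ) t ht)]
    have : ρ =ᶠ[nhdsWithin t (Set.Ici 0)] fun _ => 0 := by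
      filter_upwards [self_mem_nhdsWithin, mem_nhdsWithin_of_mem_nhds (Iic_mem_nhds htr)]
        with x hx hx'
      exact h x hx hx'
    rw [this.derivWithin_eq (h t ht htr.le)]
    simp
  · exact deriv_zero_of_not_differentiableAt hdiff

theorem IsProfile.deriv_far (hρ : IsProfile γ ρ) :
    ∃ R > 0, ∀ t, R ≤ t → ρ t = 1 ∧ deriv ρ t = 0 := by
  obtain ⟨R, h⟩ := hρ.one_far
  refine ⟨|R| + 1, by positivity, fun t ht => ⟨h t ?_, ?_⟩⟩
  · linarith [le_abs_self R]
  · have hR : R < t := by linarith [le_abs_self R]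
    have : ρ =ᶠ[nhds t] fun _ => 1 := by
      filter_upwards [Ici_mem_nhds hR] with x hx
      exact h x hx
    rw [this.deriv_eq]
    simp

theorem IsProfile.contDiffOn_deriv (hρ : IsProfile γ ρ) : ContDiffOn ℝ ∞ (deriv ρ) (Set.Ioi 0) :=
  (hρ.smooth.mono Set.Ioi_subset_Ici_self).deriv_of_isOpen isOpen_Ioi (by simp)

/-- By compactness the strict bound on `ρ'` is a uniform one. -/
theorem IsProfile.exists_deriv_le (hρ : IsProfile γ ρ) :
    ∃ q, 0 ≤ q ∧ q < γ⁻¹ * Real.tan (Real.pi / 8) ∧ ∀ t, 0 ≤ t → deriv ρ t ≤ q := by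
  obtain ⟨r, hr, hr0⟩ := hρ.deriv_zero_near
  obtain ⟨R, hR, hR0⟩ := hρ.deriv_far
  have hc : IsCompact (Set.Icc r (r + R)) := isCompact_Icc
  obtain ⟨x, hx, hmax⟩ := hc.exists_isMaxOn ⟨r, by simp [hR.le]⟩
    (hρ.contDiffOn_deriv.continuousOn.mono fun t ht => hr.trans_le ht.1)
  have hx0 : 0 ≤ x := hr.le.trans hx.1
  refine ⟨deriv ρ x, hρ.deriv_nonneg x hx0, hρ.deriv_lt x hx0, fun t ht => ?_⟩
  rcases lt_or_ge t r with h1 | h1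
  · rw [(hr0 t ht h1).2]
    exact hρ.deriv_nonneg x hx0
  rcases le_or_gt t (r + R) with h2 | h2
  · exact hmax ⟨h1, h2⟩
  · rw [(hR0 t (by linarith)).2]
    exact hρ.deriv_nonneg x hx0

theorem IsProfile.continuousOn (hρ : IsProfile γ ρ) : ContinuousOn ρ (Set.Ici 0) :=
  hρ.smooth.continuousOn

theorem IsProfile.mono (hρ : IsProfile γ ρ) {s t : ℝ} (hs : 0 ≤ s) (hst : s ≤ t) : ρ s ≤ ρ t := by
  refine monotoneOn_of_deriv_nonneg (convex_Ici 0) hρ.continuousOn ?_ ?_ (Set.mem_Ici.2 hs)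
    (Set.mem_Ici.2 (hs.trans hst)) hst
  · rw [interior_Ici]
    exact fun x hx => (hρ.differentiableAt hx).differentiableWithinAt
  · rw [interior_Ici]
    exact fun x hx => hρ.deriv_nonneg x (le_of_lt hx)

theorem IsProfile.nonneg (hρ : IsProfile γ ρ) {t : ℝ} (ht : 0 ≤ t) : 0 ≤ ρ t := by
  rw [← hρ.zero]
  exact hρ.mono le_rfl ht

theorem IsProfile.le_one (hρ : IsProfile γ ρ) {t : ℝ} (ht : 0 ≤ t) : ρ t ≤ 1 := by
  obtain ⟨R, hR, h⟩ := hρ.deriv_far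
  rw [← (h (t + R) (by linarith)).1]
  exact hρ.mono ht (by linarith)

theorem IsProfile.sub_le (hρ : IsProfile γ ρ) {q : ℝ} (hq : ∀ t, 0 ≤ t → deriv ρ t ≤ q) {s t : ℝ}
    (hs : 0 ≤ s) (hst : s ≤ t) : ρ t - ρ s ≤ q * (t - s) := by
  refine (convex_Ici 0).image_sub_le_mul_sub_of_deriv_le hρ.continuousOn ?_ ?_ s
    (Set.mem_Ici.2 hs) t (Set.mem_Ici.2 (hs.trans hst)) hst
  · rw [interior_Ici]
    exact fun x hx => (hρ.differentiableAt hx).differentiableWithinAt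
  · rw [interior_Ici]
    exact fun x hx => hq x (le_of_lt hx)

theorem IsProfile.le_mul (hρ : IsProfile γ ρ) {q : ℝ} (hq : ∀ t, 0 ≤ t → deriv ρ t ≤ q) {t : ℝ}
    (ht : 0 ≤ t) : ρ t ≤ q * t := by
  simpa [hρ.zero] using hρ.sub_le hq le_rfl ht

end Profile

/-! ### Smooth functions with bounded derivatives -/

/-- Smooth functions that are bounded together with their first derivative. -/
structure IsBdd1 {F : Type*} [NormedAddCommGroup F] [NormedSpace ℝ F] (f : E n → F) : Prop where
  smooth : ContDiff ℝ ∞ f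
  bdd : ∃ C, ∀ ξ, ‖f ξ‖ ≤ C
  bdd_fderiv : ∃ C, ∀ ξ, ‖fderiv ℝ f ξ‖ ≤ C

namespace IsBdd1

variable {F : Type*} [NormedAddCommGroup F] [NormedSpace ℝ F]

theorem const (z : F) : IsBdd1 fun _ : E n => z :=
  ⟨contDiff_const, ⟨‖z‖, fun _ => le_rfl⟩, ⟨0, fun _ => by simp⟩⟩

theorem add {f g : E n → F} (hf : IsBdd1 f) (hg : IsBdd1 g) : IsBdd1 fun ξ => f ξ + g ξ := by
  obtain ⟨C1, h1⟩ := hf.bdd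
  obtain ⟨C2, h2⟩ := hg.bdd
  obtain ⟨D1, h3⟩ := hf.bdd_fderiv
  obtain ⟨D2, h4⟩ := hg.bdd_fderiv
  refine ⟨hf.smooth.add hg.smooth, ⟨C1 + C2, fun ξ => (norm_add_le _ _).trans
    (add_le_add (h1 ξ) (h2 ξ))⟩, ⟨D1 + D2, fun ξ => ?_⟩⟩
  rw [fderiv_fun_add (hf.smooth.differentiable (by simp) ξ) (hg.smooth.differentiable (by simp) ξ)]
  exact (norm_add_le _ _).trans (add_le_add (h3 ξ) (h4 ξ))

theorem mul {f g : E n → ℂ} (hf : IsBdd1 f) (hg : IsBdd1 g) : IsBdd1 fun ξ => f ξ * g ξ := by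
  obtain ⟨C1, h1⟩ := hf.bdd
  obtain ⟨C2, h2⟩ := hg.bdd
  obtain ⟨D1, h3⟩ := hf.bdd_fderiv
  obtain ⟨D2, h4⟩ := hg.bdd_fderiv
  have n1 : 0 ≤ C1 := (norm_nonneg _).trans (h1 0)
  have n2 : 0 ≤ C2 := (norm_nonneg _).trans (h2 0)
  refine ⟨hf.smooth.mul hg.smooth, ⟨C1 * C2, fun ξ => ?_⟩, ⟨C1 * D2 + C2 * D1, fun ξ => ?_⟩⟩
  · rw [norm_mul]
    exact mul_le_mul (h1 ξ) (h2 ξ) (norm_nonneg _) n1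
  · rw [fderiv_fun_mul (hf.smooth.differentiable (by simp) ξ)
      (hg.smooth.differentiable (by simp) ξ)]
    refine (norm_add_le _ _).trans ?_
    rw [norm_smul, norm_smul]
    exact add_le_add (mul_le_mul (h1 ξ) (h4 ξ) (norm_nonneg _) n1)
      (mul_le_mul (h2 ξ) (h3 ξ) (norm_nonneg _) n2)

theorem comp_clm {G : Type*} [NormedAddCommGroup G] [NormedSpace ℝ G] {f : E n → F}
    (hf : IsBdd1 f) (L : F →L[ℝ] G) : IsBdd1 fun ξ => L (f ξ) := by
  obtain ⟨C, h1⟩ := hf.bdd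
  obtain ⟨D, h2⟩ := hf.bdd_fderiv
  refine ⟨L.contDiff.comp hf.smooth, ⟨‖L‖ * C, fun ξ => (L.le_opNorm _).trans
    (mul_le_mul_of_nonneg_left (h1 ξ) (norm_nonneg _))⟩, ⟨‖L‖ * D, fun ξ => ?_⟩⟩
  have : fderiv ℝ (fun ξ => L (f ξ)) ξ = L.comp (fderiv ℝ f ξ) :=
    (L.hasFDerivAt.comp ξ (hf.smooth.differentiable (by simp) ξ).hasFDerivAt).fderiv
  rw [this]
  exact (L.opNorm_comp_le _).trans (mul_le_mul_of_nonneg_left (h2 ξ) (norm_nonneg _))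

theorem ofReal {f : E n → ℝ} (hf : IsBdd1 f) : IsBdd1 fun ξ => (f ξ : ℂ) :=
  hf.comp_clm Complex.ofRealCLM

theorem conj {f : E n → ℂ} (hf : IsBdd1 f) : IsBdd1 fun ξ => starRingEnd ℂ (f ξ) :=
  hf.comp_clm (Complex.conjCLE : ℂ →L[ℝ] ℂ)

theorem pow {f : E n → ℂ} (hf : IsBdd1 f) (k : ℕ) : IsBdd1 fun ξ => f ξ ^ k := by
  induction k with
  | zero => simpa using const (n := n) (1 : ℂ)
  | succ k ih => simpa only [pow_succ] using ih.mul hf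

theorem sum {ι : Type*} {s : Finset ι} {f : ι → E n → F} (hf : ∀ i, IsBdd1 (f i)) :
    IsBdd1 fun ξ => ∑ i ∈ s, f i ξ := by
  classical
  induction s using Finset.induction_on with
  | empty => simpa using const (n := n) (0 : F)
  | insert i s hi ih => simpa only [Finset.sum_insert hi] using (hf i).add ih

theorem inv {f : E n → ℂ} (hf : IsBdd1 f) (h : ∀ ξ, 1 ≤ ‖f ξ‖) : IsBdd1 fun ξ => (f ξ)⁻¹ := by
  obtain ⟨D, h2⟩ := hf.bdd_fderiv
  have h0 : ∀ ξ, f ξ ≠ 0 := fun ξ => norm_pos_iff.1 (one_pos.trans_le (h ξ))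
  refine ⟨hf.smooth.inv h0, ⟨1, fun ξ => ?_⟩, ⟨D, fun ξ => ?_⟩⟩
  · rw [norm_inv]
    exact inv_le_one_of_one_le₀ (h ξ)
  · have h3 := ((hasDerivAt_inv (h0 ξ)).comp_hasFDerivAt_of_eq (𝕜' := ℂ) ξ
      ((hf.smooth.differentiable (by simp) ξ).hasFDerivAt) rfl)
    have h4 : fderiv ℝ (fun ξ => (f ξ)⁻¹) ξ = _ := h3.fderiv
    rw [h4, norm_smul]
    have h5 : ‖-(f ξ ^ 2)⁻¹‖ ≤ 1 := by
      rw [norm_neg, norm_inv, norm_pow]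
      exact inv_le_one_of_one_le₀ (one_le_pow₀ (h ξ))
    have := mul_le_mul h5 (h2 ξ) (norm_nonneg _) zero_le_one
    rwa [one_mul] at this

theorem of_hasCompactSupport {f : E n → F} (hf : ContDiff ℝ ∞ f) (hc : HasCompactSupport f) :
    IsBdd1 f :=
  ⟨hf, hf.continuous.bounded_above_of_compact_support hc,
    (hf.continuous_fderiv (by simp)).bounded_above_of_compact_support (hc.fderiv ℝ)⟩

end IsBdd1

/-- Positive homogeneity of degree `-k` outside some ball. -/
def HomogOutside {F : Type*} [NormedAddCommGroup F] [NormedSpace ℝ F] (k : ℕ) (f : E n → F) :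
    Prop :=
  ∃ R : ℝ, 0 < R ∧ ∀ t : ℝ, 1 ≤ t → ∀ ξ, R < ‖ξ‖ → f (t • ξ) = (t⁻¹) ^ k • f ξ

section Homogeneous

variable {F : Type*} [NormedAddCommGroup F] [NormedSpace ℝ F] {f : E n → F} {k : ℕ}

theorem HomogOutside.fderiv (hf : HomogOutside k f) :
    HomogOutside (k + 1) (fderiv ℝ f) := by
  obtain ⟨R, hR, h⟩ := hf
  refine ⟨R, hR, fun t ht ξ hξ => ?_⟩
  have ht0 : t ≠ 0 := by positivity
  have e : (fun η => f (t • η)) =ᶠ[nhds ξ] fun η => (t⁻¹) ^ k • f η := by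
    filter_upwards [continuous_norm.continuousAt.eventually (lt_mem_nhds hξ)] with η hη
    exact h t ht η hη
  have h1 := e.fderiv_eq (𝕜 := ℝ)
  rw [fderiv_comp_smul, show (fun η => (t⁻¹) ^ k • f η) = (t⁻¹) ^ k • f from rfl,
    fderiv_const_smul_field, Pi.smul_apply] at h1
  rw [pow_succ', mul_smul, ← h1, smul_smul, inv_mul_cancel₀ ht0, one_smul]

theorem HomogOutside.bounded (hf : HomogOutside k f) (hc : Continuous f) :
    ∃ C, ∀ ξ, ‖f ξ‖ ≤ C := by
  obtain ⟨R, hR, h⟩ := hf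
  obtain ⟨C, hC⟩ := (isCompact_closedBall (0 : E n) (R + 1)).exists_bound_of_continuousOn
    hc.continuousOn
  refine ⟨C, fun ξ => ?_⟩
  rcases le_or_gt ‖ξ‖ (R + 1) with h1 | h1
  · exact hC ξ (by simpa using h1)
  have hξ : 0 < ‖ξ‖ := by linarith
  have hR1 : 0 < R + 1 := by linarith
  set t := ‖ξ‖ / (R + 1) with ht
  have ht1 : 1 ≤ t := by rw [ht, le_div_iff₀ hR1]; linarith
  have ht0 : 0 < t := by positivity
  have hn : ‖t⁻¹ • ξ‖ = R + 1 := by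
    rw [norm_smul, norm_inv, Real.norm_of_nonneg ht0.le, ht]
    field_simp
  have h2 := h t ht1 (t⁻¹ • ξ) (by rw [hn]; linarith)
  rw [smul_smul, mul_inv_cancel₀ ht0.ne', one_smul] at h2
  rw [h2, norm_smul, norm_pow, norm_inv, Real.norm_of_nonneg ht0.le]
  have h3 := hC (t⁻¹ • ξ) (by rw [mem_closedBall_zero_iff, hn])
  have h4 : (t⁻¹) ^ k ≤ 1 := pow_le_one₀ (by positivity) (inv_le_one_of_one_le₀ ht1)
  calc (t⁻¹) ^ k * ‖f (t⁻¹ • ξ)‖ ≤ 1 * ‖f (t⁻¹ • ξ)‖ := by gcongr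
    _ ≤ C := by rwa [one_mul]

theorem HomogOutside.isBdd1 (hf : HomogOutside k f) (hs : ContDiff ℝ ∞ f) : IsBdd1 f :=
  ⟨hs, hf.bounded hs.continuous, hf.fderiv.bounded (hs.continuous_fderiv (by simp))⟩

end Homogeneous

/-! ### The Jacobian matrix of the deformation -/

/-- A radial function whose profile is smooth on `(0, ∞)` and vanishes near `0` is smooth. -/
theorem contDiff_radial {f : ℝ → ℝ} (hf : ContDiffOn ℝ ∞ f (Set.Ioi 0)) {r : ℝ} (hr : 0 < r)
    (h0 : ∀ t, 0 ≤ t → t < r → f t = 0) : ContDiff ℝ ∞ fun ξ : E n => f ‖ξ‖ := by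
  rw [contDiff_iff_contDiffAt]
  intro ξ
  by_cases hξ : ξ = 0
  · subst hξ
    have : (fun ξ : E n => f ‖ξ‖) =ᶠ[nhds 0] fun _ => 0 := by
      filter_upwards [Metric.ball_mem_nhds (0 : E n) hr] with ξ hξ
      exact h0 _ (norm_nonneg _) (by simpa using hξ)
    exact contDiffAt_const.congr_of_eventuallyEq this
  · have := hf.contDiffAt (Ioi_mem_nhds (norm_pos_iff.2 hξ))
    exact this.comp ξ (contDiffAt_norm ℝ hξ)

section Coefficients

variable {γ : ℝ} {ρ : ℝ → ℝ}

/-- The radial derivative `ρ'(|ξ|)`. -/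
noncomputable def radDeriv (ρ : ℝ → ℝ) (ξ : E n) : ℝ := deriv ρ ‖ξ‖

/-- The quotient `ρ(|ξ|) / |ξ|`. -/
noncomputable def radQuot (ρ : ℝ → ℝ) (ξ : E n) : ℝ := ‖ξ‖⁻¹ * ρ ‖ξ‖

theorem contDiff_radDeriv (hρ : IsProfile γ ρ) : ContDiff ℝ ∞ (radDeriv (n := n) ρ) := by
  obtain ⟨r, hr, h⟩ := hρ.deriv_zero_near
  exact contDiff_radial hρ.contDiffOn_deriv hr fun t ht htr => (h t ht htr).2

theorem isBdd1_radDeriv (hρ : IsProfile γ ρ) : IsBdd1 (radDeriv (n := n) ρ) := by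
  refine .of_hasCompactSupport (contDiff_radDeriv hρ) ?_
  obtain ⟨R, hR, h⟩ := hρ.deriv_far
  refine HasCompactSupport.of_support_subset_isCompact (isCompact_closedBall (0 : E n) R) ?_
  intro ξ hξ
  rw [mem_closedBall_zero_iff]
  by_contra! hlt
  exact hξ (h _ hlt.le).2

theorem contDiff_radQuot (hρ : IsProfile γ ρ) : ContDiff ℝ ∞ (radQuot (n := n) ρ) := by
  obtain ⟨r, hr, h⟩ := hρ.deriv_zero_near
  refine contDiff_radial (f := fun t => t⁻¹ * ρ t) ?_ hr fun t ht htr => by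
    rw [(h t ht htr).1, mul_zero]
  exact (contDiffOn_id.inv fun t ht => (ne_of_gt ht)).mul
    (hρ.smooth.mono Set.Ioi_subset_Ici_self)

theorem homogOutside_radQuot (hρ : IsProfile γ ρ) : HomogOutside 1 (radQuot (n := n) ρ) := by
  obtain ⟨R, hR, h⟩ := hρ.deriv_far
  refine ⟨R, hR, fun t ht ξ hξ => ?_⟩
  have ht0 : 0 < t := by linarith
  have h1 : R ≤ t * ‖ξ‖ := by nlinarith
  rw [radQuot, radQuot, norm_smul, Real.norm_of_nonneg ht0.le, (h _ h1).1, (h _ hξ.le).1]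
  simp [mul_comm]

theorem psi_eq (ξ : E n) : psi ρ ξ = radQuot ρ ξ • ξ := rfl

theorem contDiff_psi (hρ : IsProfile γ ρ) : ContDiff ℝ ∞ (psi (n := n) ρ) :=
  (contDiff_radQuot hρ).smul contDiff_id

theorem homogOutside_psi (hρ : IsProfile γ ρ) : HomogOutside 0 (psi (n := n) ρ) := by
  obtain ⟨R, hR, h⟩ := homogOutside_radQuot (n := n) hρ
  refine ⟨R, hR, fun t ht ξ hξ => ?_⟩
  have ht0 : t ≠ 0 := by positivity
  rw [psi_eq, psi_eq, h t ht ξ hξ, smul_smul, smul_eq_mul, pow_one, pow_zero, one_smul]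
  congr 1
  field_simp

theorem isBdd1_Dpsi (hρ : IsProfile γ ρ) (j k : Fin n) : IsBdd1 fun ξ : E n => Dpsi ρ ξ j k := by
  have h : IsBdd1 (fderiv ℝ (psi (n := n) ρ)) :=
    (homogOutside_psi hρ).fderiv.isBdd1 ((contDiff_psi hρ).fderiv_right (m := ∞) (by simp))
  have h1 := h.comp_clm (ContinuousLinearMap.apply ℝ (E n) (EuclideanSpace.single k (1 : ℝ)))
  exact h1.comp_clm (EuclideanSpace.proj j : E n →L[ℝ] ℝ)

/-- `Dψ` has the eigenvalues `ρ'(|ξ|)` (radial direction) and `ρ(|ξ|)/|ξ|`. -/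
theorem Dpsi_mul_self (hρ : IsProfile γ ρ) (ξ : E n) :
    Dpsi ρ ξ * Dpsi ρ ξ = (radDeriv ρ ξ + radQuot ρ ξ) • Dpsi ρ ξ -
      (radDeriv ρ ξ * radQuot ρ ξ) • (1 : Matrix (Fin n) (Fin n) ℝ) := by
  by_cases hξ : ξ = 0
  · subst hξ
    rw [Dpsi_zero hρ]
    simp [radQuot]
  · have hr : ‖ξ‖ ≠ 0 := by simpa using hξ
    have hv : Matrix.vecMulVec ξ ξ * Matrix.vecMulVec ξ ξ = ‖ξ‖ ^ 2 • Matrix.vecMulVec ξ ξ := by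
      rw [Matrix.vecMulVec_mul_vecMulVec]
      ext i j
      simp only [Matrix.vecMulVec_apply, Matrix.smul_apply, smul_eq_mul,
        EuclideanSpace.real_norm_sq_eq, dotProduct, Pi.smul_apply]
      rw [Finset.sum_congr rfl fun x _ => (sq (ξ.ofLp x)).symm]
      ring
    rw [Dpsi_of_ne hρ hξ]
    simp only [mul_add, add_mul, smul_mul_smul_comm, mul_one, one_mul, hv, smul_smul, smul_add]
    ext i j
    simp only [Matrix.add_apply, Matrix.sub_apply, Matrix.smul_apply, smul_eq_mul, radDeriv,
      radQuot]
    field_simp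
    ring

end Coefficients

/-! ### The deformed operator in divergence form -/

section Deformed

variable {γ : ℝ} {ρ : ℝ → ℝ} {θ : ℂ}

/-- The eigenvalue `1 + θ ρ'(|ξ|)` of `Dφ_θ` in the radial direction. -/
noncomputable def eigRad (ρ : ℝ → ℝ) (θ : ℂ) (ξ : E n) : ℂ := 1 + θ * (radDeriv ρ ξ : ℂ)

/-- The eigenvalue `1 + θ ρ(|ξ|)/|ξ|` of `Dφ_θ` in the directions orthogonal to `ξ`. -/
noncomputable def eigTan (ρ : ℝ → ℝ) (θ : ℂ) (ξ : E n) : ℂ := 1 + θ * (radQuot ρ ξ : ℂ)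

theorem one_le_norm_one_add (hθ : θ.re = 0) (x : ℝ) : 1 ≤ ‖1 + θ * (x : ℂ)‖ := by
  have : (1 + θ * (x : ℂ)).re = 1 := by simp [hθ]
  calc (1 : ℝ) = (1 + θ * (x : ℂ)).re := this.symm
    _ ≤ _ := Complex.re_le_norm _

theorem one_le_norm_eigRad (hθ : θ.re = 0) (ξ : E n) : 1 ≤ ‖eigRad ρ θ ξ‖ :=
  one_le_norm_one_add hθ _

theorem one_le_norm_eigTan (hθ : θ.re = 0) (ξ : E n) : 1 ≤ ‖eigTan ρ θ ξ‖ :=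
  one_le_norm_one_add hθ _

theorem eigRad_ne_zero (hθ : θ.re = 0) (ξ : E n) : eigRad ρ θ ξ ≠ 0 :=
  norm_pos_iff.1 (one_pos.trans_le (one_le_norm_eigRad hθ ξ))

theorem eigTan_ne_zero (hθ : θ.re = 0) (ξ : E n) : eigTan ρ θ ξ ≠ 0 :=
  norm_pos_iff.1 (one_pos.trans_le (one_le_norm_eigTan hθ ξ))

theorem isBdd1_eigRad (hρ : IsProfile γ ρ) (θ : ℂ) : IsBdd1 (eigRad (n := n) ρ θ) :=
  (IsBdd1.const 1).add ((IsBdd1.const θ).mul (isBdd1_radDeriv hρ).ofReal)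

theorem isBdd1_eigTan (hρ : IsProfile γ ρ) (θ : ℂ) : IsBdd1 (eigTan (n := n) ρ θ) :=
  (IsBdd1.const 1).add ((IsBdd1.const θ).mul
    ((homogOutside_radQuot hρ).isBdd1 (contDiff_radQuot hρ)).ofReal)

theorem jac_eq (hρ : IsProfile γ ρ) (hn : 1 ≤ n) (θ : ℂ) (ξ : E n) :
    jac ρ θ ξ = eigRad ρ θ ξ * eigTan ρ θ ξ ^ (n - 1) := by
  have hsq : ∀ z : ℂ, (z ^ (1 / 2 : ℂ)) ^ 2 = z := fun z => by
    rw [← Complex.cpow_nat_mul]; norm_num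
  rw [← sqrtJac_sq hρ hn, sqrtJac, mul_pow, hsq, ← pow_mul, mul_comm (n - 1), pow_mul, hsq]
  rfl

theorem one_le_norm_jac (hρ : IsProfile γ ρ) (hn : 1 ≤ n) (hθ : θ.re = 0) (ξ : E n) :
    1 ≤ ‖jac ρ θ ξ‖ := by
  rw [jac_eq hρ hn, norm_mul, norm_pow]
  exact one_le_mul_of_one_le_of_one_le (one_le_norm_eigRad hθ ξ)
    (one_le_pow₀ (one_le_norm_eigTan hθ ξ))

theorem isBdd1_jac (hρ : IsProfile γ ρ) (hn : 1 ≤ n) (θ : ℂ) : IsBdd1 (jac (n := n) ρ θ) := by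
  have : jac (n := n) ρ θ = fun ξ => eigRad ρ θ ξ * eigTan ρ θ ξ ^ (n - 1) :=
    funext fun ξ => jac_eq hρ hn θ ξ
  rw [this]
  exact (isBdd1_eigRad hρ θ).mul ((isBdd1_eigTan hρ θ).pow _)

theorem contDiff_sqrtJac (hρ : IsProfile γ ρ) (hθ : θ.re = 0) :
    ContDiff ℝ ∞ (sqrtJac (n := n) ρ θ) := by
  have h : ∀ f : E n → ℂ, ContDiff ℝ ∞ f → (∀ ξ, (f ξ).re = 1) →
      ContDiff ℝ ∞ fun ξ => f ξ ^ (1 / 2 : ℂ) := fun f hf hre => by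
    have hs : ∀ ξ, f ξ ∈ Complex.slitPlane := fun ξ => Or.inl (by rw [hre]; exact one_pos)
    rw [contDiff_iff_contDiffAt]
    intro ξ
    have h1 : AnalyticAt ℂ (fun z : ℂ => z ^ (1 / 2 : ℂ)) (f ξ) :=
      analyticAt_id.cpow analyticAt_const (hs ξ)
    exact (h1.contDiffAt.restrict_scalars ℝ).comp ξ hf.contDiffAt
  have h1 := h (eigRad ρ θ) (isBdd1_eigRad hρ θ).smooth fun ξ => by simp [eigRad, hθ]
  have h2 := h (eigTan ρ θ) (isBdd1_eigTan hρ θ).smooth fun ξ => by simp [eigTan, hθ]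
  exact h1.mul (h2.pow (n - 1))

theorem sqrtJac_ne_zero (hρ : IsProfile γ ρ) (hn : 1 ≤ n) (hθ : θ.re = 0) (ξ : E n) :
    sqrtJac ρ θ ξ ≠ 0 := by
  intro h
  have h1 := one_le_norm_jac hρ hn hθ ξ
  rw [← sqrtJac_sq hρ hn, h] at h1
  norm_num at h1

/-- The inverse of `Dφ_θ`, by the Cayley–Hamilton relation of its two eigenvalues. -/
theorem Dphi_inv (hρ : IsProfile γ ρ) (hθ : θ.re = 0) (ξ : E n) :
    (Dphi ρ θ ξ)⁻¹ = ((eigRad ρ θ ξ * eigTan ρ θ ξ)⁻¹) •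
      ((eigRad ρ θ ξ + θ * (radQuot ρ ξ : ℂ)) • (1 : Matrix (Fin n) (Fin n) ℂ) -
        θ • (Dpsi ρ ξ).map (fun x : ℝ => (x : ℂ))) := by
  refine Matrix.inv_eq_right_inv ?_
  set N : Matrix (Fin n) (Fin n) ℂ := (Dpsi ρ ξ).map (fun x : ℝ => (x : ℂ)) with hN
  have hNN : N * N = ((radDeriv ρ ξ : ℂ) + (radQuot ρ ξ : ℂ)) • N -
      ((radDeriv ρ ξ : ℂ) * (radQuot ρ ξ : ℂ)) • (1 : Matrix (Fin n) (Fin n) ℂ) := by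
    have h := congrArg (fun A : Matrix (Fin n) (Fin n) ℝ => A.map (fun x : ℝ => (x : ℂ)))
      (Dpsi_mul_self hρ ξ)
    have h2 : (Dpsi ρ ξ * Dpsi ρ ξ).map (fun x : ℝ => (x : ℂ)) = N * N :=
      Matrix.map_mul (f := Complex.ofRealHom)
    rw [← h2, h]
    ext i j
    by_cases hij : i = j <;>
      simp [hN, hij]
  have hne : eigRad ρ θ ξ * eigTan ρ θ ξ ≠ 0 :=
    mul_ne_zero (eigRad_ne_zero hθ ξ) (eigTan_ne_zero hθ ξ)
  rw [Dphi, ← hN, mul_smul_comm, add_mul, one_mul, mul_sub, smul_mul_smul_comm,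
    smul_mul_smul_comm, hNN, mul_one]
  rw [inv_smul_eq_iff₀ hne]
  ext i j
  simp only [Matrix.add_apply, Matrix.sub_apply, Matrix.smul_apply, smul_eq_mul]
  simp only [eigRad, eigTan]
  ring

/-- The coefficient `J_θ ∑_j J^{lj} J^{kj}` of the principal part. -/
noncomputable def coeffA (ρ : ℝ → ℝ) (θ : ℂ) (l k : Fin n) (ξ : E n) : ℂ :=
  ∑ j, (Dphi ρ θ ξ)⁻¹ j l * jac ρ θ ξ * (Dphi ρ θ ξ)⁻¹ j k

theorem isBdd1_Dphi_inv (hρ : IsProfile γ ρ) (hθ : θ.re = 0) (j k : Fin n) :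
    IsBdd1 fun ξ : E n => (Dphi ρ θ ξ)⁻¹ j k := by
  have h1 : IsBdd1 fun ξ : E n => (eigRad ρ θ ξ * eigTan ρ θ ξ)⁻¹ :=
    ((isBdd1_eigRad hρ θ).mul (isBdd1_eigTan hρ θ)).inv fun ξ => by
      rw [norm_mul]
      exact one_le_mul_of_one_le_of_one_le (one_le_norm_eigRad hθ ξ) (one_le_norm_eigTan hθ ξ)
  have h2 : IsBdd1 fun ξ : E n => (radQuot ρ ξ : ℂ) :=
    ((homogOutside_radQuot hρ).isBdd1 (contDiff_radQuot hρ)).ofReal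
  have h3 := h1.mul ((((isBdd1_eigRad hρ θ).add ((IsBdd1.const θ).mul h2)).mul
    (IsBdd1.const ((1 : Matrix (Fin n) (Fin n) ℂ) j k))).add
    ((IsBdd1.const (-θ)).mul (isBdd1_Dpsi hρ j k).ofReal))
  have e : (fun ξ : E n => (Dphi ρ θ ξ)⁻¹ j k) = fun ξ : E n =>
      (eigRad ρ θ ξ * eigTan ρ θ ξ)⁻¹ * ((eigRad ρ θ ξ + θ * (radQuot ρ ξ : ℂ)) *
        (1 : Matrix (Fin n) (Fin n) ℂ) j k + -θ * (Dpsi ρ ξ j k : ℂ)) := by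
    funext ξ
    rw [Dphi_inv hρ hθ]
    simp only [Matrix.sub_apply, Matrix.smul_apply, smul_eq_mul, Matrix.map_apply]
    ring
  rw [e]
  exact h3

theorem isBdd1_coeffA (hρ : IsProfile γ ρ) (hn : 1 ≤ n) (hθ : θ.re = 0) (l k : Fin n) :
    IsBdd1 (coeffA (n := n) ρ θ l k) :=
  IsBdd1.sum fun j => ((isBdd1_Dphi_inv hρ hθ j l).mul (isBdd1_jac hρ hn θ)).mul
    (isBdd1_Dphi_inv hρ hθ j k)

theorem coeffA_symm (l k : Fin n) (ξ : E n) : coeffA ρ θ l k ξ = coeffA ρ θ k l ξ :=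
  Finset.sum_congr rfl fun j _ => by ring

/-- The principal form is diagonal in the splitting of `ℂⁿ` into the direction of `ξ` and its
orthogonal complement; `q₁` and `q₂` are the squared norms of the two components of `ζ`. -/
theorem sum_coeffA (hρ : IsProfile γ ρ) (hθ : θ.re = 0) (ξ : E n) (ζ : Fin n → ℂ) :
    ∃ q₁ q₂ : ℝ, 0 ≤ q₁ ∧ 0 ≤ q₂ ∧ q₁ + q₂ = ∑ k, ‖ζ k‖ ^ 2 ∧
      ∑ l, ∑ k, coeffA ρ θ l k ξ * ζ k * starRingEnd ℂ (ζ l) =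
        jac ρ θ ξ * ((eigRad ρ θ ξ)⁻¹ ^ 2 * q₁ + (eigTan ρ θ ξ)⁻¹ ^ 2 * q₂) := by
  set M := (Dphi ρ θ ξ)⁻¹ with hM
  have e1 : ∑ l, ∑ k, coeffA ρ θ l k ξ * ζ k * starRingEnd ℂ (ζ l) =
      jac ρ θ ξ * ∑ j, (∑ k, M j k * ζ k) * ∑ l, M j l * starRingEnd ℂ (ζ l) := by
    simp only [coeffA, ← hM, Finset.sum_mul, Finset.mul_sum]
    rw [Finset.sum_congr rfl fun l _ => Finset.sum_comm, Finset.sum_comm]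
    refine Finset.sum_congr rfl fun j _ => ?_
    refine Finset.sum_congr rfl fun l _ => Finset.sum_congr rfl fun k _ => ?_
    ring
  have hζ : ∑ k, ζ k * starRingEnd ℂ (ζ k) = ((∑ k, ‖ζ k‖ ^ 2 : ℝ) : ℂ) := by
    push_cast
    exact Finset.sum_congr rfl fun k _ => Complex.mul_conj' _
  rw [e1]
  by_cases hξ : ξ = 0
  · subst hξ
    obtain ⟨r, hr, h0⟩ := hρ.deriv_zero_near
    refine ⟨0, ∑ k, ‖ζ k‖ ^ 2, le_rfl, Finset.sum_nonneg fun k _ => sq_nonneg _, zero_add _, ?_⟩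
    have hM1 : M = 1 := by
      rw [hM, Dphi, Dpsi_zero hρ]
      simp
    rw [hM1]
    simp only [Matrix.one_apply, ite_mul, one_mul, zero_mul, Finset.sum_ite_eq, Finset.mem_univ,
      if_true, hζ]
    simp [eigTan, radQuot]
  · have hr : ‖ξ‖ ≠ 0 := by simpa using hξ
    have hr' : (‖ξ‖ : ℂ) ≠ 0 := by exact_mod_cast hr
    have hc1 := eigRad_ne_zero (ρ := ρ) hθ ξ
    have hc2 := eigTan_ne_zero (ρ := ρ) hθ ξ
    set x := (eigTan ρ θ ξ)⁻¹ with hx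
    set y := ((eigRad ρ θ ξ)⁻¹ - x) / (‖ξ‖ : ℂ) ^ 2 with hy
    set s : ℂ := ∑ k, (ξ k : ℂ) * ζ k with hs
    have hMe : ∀ j k, M j k = x * (1 : Matrix (Fin n) (Fin n) ℂ) j k + y * ((ξ j : ℂ) * ξ k) := by
      intro j k
      rw [hM, Dphi_inv hρ hθ, Dpsi_of_ne hρ hξ]
      have key : y = (eigRad ρ θ ξ * eigTan ρ θ ξ)⁻¹ * (-θ) *
          (((‖ξ‖ ^ 2)⁻¹ * deriv ρ ‖ξ‖ - (‖ξ‖ ^ 3)⁻¹ * ρ ‖ξ‖ : ℝ) : ℂ) := by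
        rw [hy, hx]
        have : eigTan ρ θ ξ - eigRad ρ θ ξ =
          θ * ((‖ξ‖ : ℂ)⁻¹ * ρ ‖ξ‖ - deriv ρ ‖ξ‖) := by
          simp only [eigTan, eigRad, radQuot, radDeriv]
          push_cast
          ring
        have e2 : (eigRad ρ θ ξ)⁻¹ - (eigTan ρ θ ξ)⁻¹ =
          (eigRad ρ θ ξ * eigTan ρ θ ξ)⁻¹ * (eigTan ρ θ ξ - eigRad ρ θ ξ) := by
          field_simp
        rw [e2, this]
        push_cast
        field_simp
        ring
      have key2 : x = (eigRad ρ θ ξ * eigTan ρ θ ξ)⁻¹ * eigRad ρ θ ξ := by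
        rw [hx]
        field_simp
      rw [key, key2]
      by_cases hjk : j = k
      · subst hjk
        simp [Matrix.vecMulVec_apply, radQuot]
        ring
      · simp [Matrix.vecMulVec_apply, hjk]
        ring
    have hnorm : ∑ j, (ξ j : ℂ) * (ξ j : ℂ) = (‖ξ‖ : ℂ) ^ 2 := by
      rw [← Complex.ofReal_pow, EuclideanSpace.real_norm_sq_eq ξ]
      push_cast
      exact Finset.sum_congr rfl fun j _ => by ring
    have hMv : ∀ (v : Fin n → ℂ) j, ∑ k, M j k * v k =
        x * v j + y * (ξ j : ℂ) * ∑ k, (ξ k : ℂ) * v k := by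
      intro v j
      simp only [hMe, add_mul, Finset.sum_add_distrib, Matrix.one_apply, Finset.mul_sum]
      congr 1
      · simp
      · exact Finset.sum_congr rfl fun k _ => by ring
    have hsc : ∑ k, (ξ k : ℂ) * starRingEnd ℂ (ζ k) = starRingEnd ℂ s := by
      rw [hs, map_sum]
      exact Finset.sum_congr rfl fun k _ => by simp
    have hss : s * starRingEnd ℂ s = ((‖s‖ ^ 2 : ℝ) : ℂ) := by
      push_cast
      exact Complex.mul_conj' s
    have hCS : ‖s‖ ^ 2 ≤ ‖ξ‖ ^ 2 * ∑ k, ‖ζ k‖ ^ 2 := by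
      have h1 : ‖s‖ ≤ ∑ k, |ξ k| * ‖ζ k‖ := by
        refine (norm_sum_le _ _).trans (le_of_eq (Finset.sum_congr rfl fun k _ => ?_))
        rw [norm_mul, Complex.norm_real, Real.norm_eq_abs]
      have h2 := Finset.sum_mul_sq_le_sq_mul_sq Finset.univ (fun k => |ξ k|) fun k => ‖ζ k‖
      simp only [sq_abs] at h2
      rw [EuclideanSpace.real_norm_sq_eq]
      exact (pow_le_pow_left₀ (norm_nonneg _) h1 2).trans h2
    refine ⟨‖s‖ ^ 2 / ‖ξ‖ ^ 2, ∑ k, ‖ζ k‖ ^ 2 - ‖s‖ ^ 2 / ‖ξ‖ ^ 2, by positivity, ?_, by ring, ?_⟩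
    · rw [sub_nonneg, div_le_iff₀ (by positivity), mul_comm]
      exact hCS
    · congr 1
      have e3 : ∀ j, (∑ k, M j k * ζ k) * ∑ l, M j l * starRingEnd ℂ (ζ l) =
          x ^ 2 * (ζ j * starRingEnd ℂ (ζ j)) + (x * y * starRingEnd ℂ s * ((ξ j : ℂ) * ζ j) +
          x * y * s * ((ξ j : ℂ) * starRingEnd ℂ (ζ j)) +
            y ^ 2 * (s * starRingEnd ℂ s) * ((ξ j : ℂ) * ξ j)) := fun j => by
        rw [hMv, hMv, hsc]
        ring
      simp only [e3, Finset.sum_add_distrib, ← Finset.mul_sum]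
      rw [hζ, ← hs, hsc, hnorm]
      have e4 : (eigRad ρ θ ξ)⁻¹ = x + y * (‖ξ‖ : ℂ) ^ 2 := by
        rw [hy]
        field_simp
        ring
      rw [e4]
      have e5 : x * y * starRingEnd ℂ s * s + x * y * s * starRingEnd ℂ s +
        y ^ 2 * (s * starRingEnd ℂ s) * (‖ξ‖ : ℂ) ^ 2 =
        (2 * x * y + y ^ 2 * (‖ξ‖ : ℂ) ^ 2) * ((‖s‖ ^ 2 : ℝ) : ℂ) := by
        rw [← hss]
        ring
      rw [e5]
      push_cast
      field_simp
      ring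

theorem phiSq_eq (hρ : IsProfile γ ρ) (θ : ℂ) (ξ : E n) :
    phiSq ρ θ ξ = ((‖ξ‖ : ℂ) + θ * (ρ ‖ξ‖ : ℂ)) ^ 2 := by
  have hnorm : ∑ j, (ξ j : ℂ) ^ 2 = (‖ξ‖ : ℂ) ^ 2 := by
    rw [← Complex.ofReal_pow, EuclideanSpace.real_norm_sq_eq ξ]
    push_cast
    rfl
  have h1 : ∀ j, phi ρ θ ξ j ^ 2 = (1 + θ * (radQuot ρ ξ : ℂ)) ^ 2 * (ξ j : ℂ) ^ 2 := fun j => by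
    rw [phi, psi_eq]
    simp only [PiLp.smul_apply, smul_eq_mul]
    push_cast
    ring
  rw [phiSq, Finset.sum_congr rfl fun j _ => h1 j, ← Finset.mul_sum, hnorm, ← mul_pow]
  congr 1
  by_cases hξ : ξ = 0
  · subst hξ
    simp [hρ.zero]
  · have hr' : (‖ξ‖ : ℂ) ≠ 0 := by simpa using hξ
    rw [radQuot]
    push_cast
    field_simp

theorem contDiff_phiSq (hρ : IsProfile γ ρ) (θ : ℂ) : ContDiff ℝ ∞ (phiSq (n := n) ρ θ) := by
  have h1 : ∀ j : Fin n, ContDiff ℝ ∞ fun ξ : E n => (ξ j : ℂ) := fun j =>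
    Complex.ofRealCLM.contDiff.comp ((EuclideanSpace.proj j : E n →L[ℝ] ℝ).contDiff)
  have h2 : ∀ j : Fin n, ContDiff ℝ ∞ fun ξ : E n => ((psi ρ ξ) j : ℂ) := fun j =>
    Complex.ofRealCLM.contDiff.comp
      ((EuclideanSpace.proj j : E n →L[ℝ] ℝ).contDiff.comp (contDiff_psi hρ))
  exact ContDiff.sum fun j _ => ((h1 j).add (contDiff_const.mul (h2 j))).pow 2

/-- The potential of the deformed operator, after conjugation by `J_θ^{1/2}`. -/
noncomputable def coeffP (ρ : ℝ → ℝ) (θ μ : ℂ) (ξ : E n) : ℂ := (phiSq ρ θ ξ - μ) * jac ρ θ ξ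

theorem contDiff_coeffP (hρ : IsProfile γ ρ) (hn : 1 ≤ n) (θ μ : ℂ) :
    ContDiff ℝ ∞ (coeffP (n := n) ρ θ μ) :=
  ((contDiff_phiSq hρ θ).sub contDiff_const).mul (isBdd1_jac hρ hn θ).smooth

/-- A scalar phase `κ` rotating the symbol of the deformed operator into the right half plane
provides a multiplier, with bounds that do not depend on the spectral parameter. -/
theorem exists_isMultiplier (hρ : IsProfile γ ρ) (hn : 1 ≤ n) (hθ : θ.re = 0) {κ : E n → ℂ}
    (hκ : IsBdd1 κ) {c : ℝ} (hc : 0 ≤ c)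
    (h1 : ∀ ξ, c ≤ (-Complex.I * κ ξ * (eigRad ρ θ ξ)⁻¹ ^ 2).re)
    (h2 : ∀ ξ, c ≤ (-Complex.I * κ ξ * (eigTan ρ θ ξ)⁻¹ ^ 2).re) :
    ∃ C, ∀ μ, (∀ ξ, c ≤ (κ ξ * (phiSq ρ θ ξ - μ)).re) →
      IsMultiplier (coeffA ρ θ) (coeffP ρ θ μ)
        (fun ξ => κ ξ * starRingEnd ℂ (jac ρ θ ξ)) C c := by
  have hJ := isBdd1_jac (n := n) hρ hn θ
  have hm : IsBdd1 fun ξ => κ ξ * starRingEnd ℂ (jac ρ θ ξ) := hκ.mul hJ.conj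
  have hA := fun l k => isBdd1_coeffA (n := n) hρ hn hθ l k
  choose C1 hC1 using fun l k => (hA l k).bdd
  choose C2 hC2 using fun l k => (hA l k).bdd_fderiv
  obtain ⟨C3, hC3⟩ := hm.bdd
  obtain ⟨C4, hC4⟩ := hm.bdd_fderiv
  have p1 : ∀ l k, 0 ≤ C1 l k := fun l k => (norm_nonneg _).trans (hC1 l k 0)
  have p2 : ∀ l k, 0 ≤ C2 l k := fun l k => (norm_nonneg _).trans (hC2 l k 0)
  have p3 : 0 ≤ C3 := (norm_nonneg _).trans (hC3 0)
  have p4 : 0 ≤ C4 := (norm_nonneg _).trans (hC4 0)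
  have hle : ∀ (f : Fin n → Fin n → ℝ), (∀ l k, 0 ≤ f l k) → ∀ l k, f l k ≤ ∑ l, ∑ k, f l k :=
    fun f hf l k => (Finset.single_le_sum (f := fun k => f l k) (fun k _ => hf l k)
      (Finset.mem_univ k)).trans (Finset.single_le_sum (f := fun l => ∑ k, f l k)
        (fun l _ => Finset.sum_nonneg fun k _ => hf l k) (Finset.mem_univ l))
  have s1 : 0 ≤ ∑ l, ∑ k, C1 l k := Finset.sum_nonneg fun l _ => Finset.sum_nonneg fun k _ => p1 l k
  have s2 : 0 ≤ ∑ l, ∑ k, C2 l k := Finset.sum_nonneg fun l _ => Finset.sum_nonneg fun k _ => p2 l k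
  have hJ1 : ∀ ξ, 1 ≤ ‖jac (n := n) ρ θ ξ‖ ^ 2 := fun ξ =>
    one_le_pow₀ (one_le_norm_jac hρ hn hθ ξ)
  have hJJ : ∀ ξ, starRingEnd ℂ (jac (n := n) ρ θ ξ) * jac ρ θ ξ =
      ((‖jac (n := n) ρ θ ξ‖ ^ 2 : ℝ) : ℂ) := fun ξ => by
    push_cast
    exact Complex.conj_mul' _
  refine ⟨(∑ l, ∑ k, C1 l k) + (∑ l, ∑ k, C2 l k) + C3 + C4, fun μ hμ => ⟨?_, ?_, ?_, ?_, ?_, ?_,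
    ?_, ?_, ?_, ?_⟩⟩
  · exact fun l k => (hA l k).smooth
  · exact contDiff_coeffP hρ hn θ μ
  · exact hm.smooth
  · exact fun l k ξ => coeffA_symm l k ξ
  · intro l k ξ
    have := hC1 l k ξ
    have := hle C1 p1 l k
    linarith
  · intro l k ξ
    have := hC2 l k ξ
    have := hle C2 p2 l k
    linarith
  · intro ξ
    have := hC3 ξ
    linarith
  · intro ξ
    have := hC4 ξ
    linarith
  · intro ξ
    have e : κ ξ * starRingEnd ℂ (jac ρ θ ξ) * coeffP ρ θ μ ξ =
        (κ ξ * (phiSq ρ θ ξ - μ)) * ((‖jac (n := n) ρ θ ξ‖ ^ 2 : ℝ) : ℂ) := by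
      rw [← hJJ, coeffP]
      ring
    rw [e, Complex.re_mul_ofReal]
    nlinarith [hμ ξ, hJ1 ξ]
  · intro ξ ζ
    obtain ⟨q₁, q₂, hq1, hq2, hq, hsum⟩ := sum_coeffA hρ hθ ξ ζ
    have e : -Complex.I * (κ ξ * starRingEnd ℂ (jac ρ θ ξ)) * (jac ρ θ ξ *
        ((eigRad ρ θ ξ)⁻¹ ^ 2 * q₁ + (eigTan ρ θ ξ)⁻¹ ^ 2 * q₂)) =
        ((-Complex.I * κ ξ * (eigRad ρ θ ξ)⁻¹ ^ 2) * (q₁ : ℂ) +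
        (-Complex.I * κ ξ * (eigTan ρ θ ξ)⁻¹ ^ 2) * (q₂ : ℂ)) *
          ((‖jac (n := n) ρ θ ξ‖ ^ 2 : ℝ) : ℂ) := by
      rw [← hJJ]
      ring
    rw [hsum, e, Complex.re_mul_ofReal, Complex.add_re, Complex.re_mul_ofReal,
      Complex.re_mul_ofReal, ← hq]
    have i1 := mul_le_mul_of_nonneg_right (h1 ξ) hq1
    have i2 := mul_le_mul_of_nonneg_right (h2 ξ) hq2
    have i3 : c * (q₁ + q₂) ≤ (-Complex.I * κ ξ * (eigRad ρ θ ξ)⁻¹ ^ 2).re * q₁ +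
      (-Complex.I * κ ξ * (eigTan ρ θ ξ)⁻¹ ^ 2).re * q₂ := by linarith
    have i4 : 0 ≤ c * (q₁ + q₂) := by positivity
    nlinarith [hJ1 ξ]

/-- Conjugation by `J_θ^{1/2}` turns `Q_{ε,θ} - μ` into divergence form. -/
theorem Qexpr_sub_eq (hρ : IsProfile γ ρ) (hn : 1 ≤ n) (hθ : θ.re = 0) (ε : ℝ) (μ : ℂ)
    {v : E n → ℂ} (hv : IsTest v) (ξ : E n) :
    Qexpr ρ ε θ v ξ - μ * v ξ = (sqrtJac ρ θ ξ)⁻¹ *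
      divOp ε (coeffA ρ θ) (coeffP ρ θ μ) (fun η => (sqrtJac ρ θ η)⁻¹ * v η) ξ := by
  set w : E n → ℂ := fun η => (sqrtJac ρ θ η)⁻¹ * v η with hw
  have tw : IsTest w := IsTest.mul_left
    ((contDiff_sqrtJac hρ hθ).inv fun ξ => sqrtJac_ne_zero hρ hn hθ ξ) hv
  have hv' : v ξ = sqrtJac ρ θ ξ * w ξ := by
    rw [hw]
    simp only
    rw [mul_inv_cancel_left₀ (sqrtJac_ne_zero hρ hn hθ ξ)]
  have hJ : jac ρ θ ξ = sqrtJac ρ θ ξ ^ 2 := (sqrtJac_sq hρ hn θ ξ).symm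
  have hD : ∀ (k : Fin n) (f : E n → ℂ), Dcoord k f = fun η => -Complex.I * pd k f η :=
    fun k f => rfl
  have smooth : ∀ l j k : Fin n, ContDiff ℝ ∞ fun η : E n =>
      (Dphi ρ θ η)⁻¹ j l * jac ρ θ η * (Dphi ρ θ η)⁻¹ j k := fun l j k =>
    (((isBdd1_Dphi_inv hρ hθ j l).mul (isBdd1_jac hρ hn θ)).mul (isBdd1_Dphi_inv hρ hθ j k)).smooth
  have tflux : ∀ l j k : Fin n, IsTest fun η : E n =>
      (Dphi ρ θ η)⁻¹ j l * jac ρ θ η * (Dphi ρ θ η)⁻¹ j k * pd k w η := fun l j k =>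
    IsTest.mul_left (smooth l j k) (tw.pd k)
  have e1 : ∀ l j k : Fin n, Dcoord l (fun η =>
      (Dphi ρ θ η)⁻¹ j l * jac ρ θ η * (Dphi ρ θ η)⁻¹ j k * Dcoord k w η) ξ =
      -pd l (fun η =>
        (Dphi ρ θ η)⁻¹ j l * jac ρ θ η * (Dphi ρ θ η)⁻¹ j k * pd k w η) ξ := by
    intro l j k
    have : (fun η => (Dphi ρ θ η)⁻¹ j l * jac ρ θ η * (Dphi ρ θ η)⁻¹ j k * Dcoord k w η) =
        fun η => -Complex.I *
          ((Dphi ρ θ η)⁻¹ j l * jac ρ θ η * (Dphi ρ θ η)⁻¹ j k * pd k w η) := by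
      funext η
      rw [hD]
      ring
    rw [this, hD]
    simp only
    rw [pd_const_mul l _ ((tflux l j k).differentiableAt ξ), ← mul_assoc]
    have : -Complex.I * -Complex.I = -1 := by rw [neg_mul_neg, Complex.I_mul_I]
    rw [this, neg_one_mul]
  have pd_sum : ∀ (l : Fin n) (f : Fin n → E n → ℂ), (∀ j, IsTest (f j)) →
      pd l (fun η => ∑ j, f j η) ξ = ∑ j, pd l (f j) ξ := fun l f hf => by
    rw [pd, fderiv_fun_sum fun j _ => (hf j).differentiableAt ξ, sum_apply]
    rfl
  have e2 : ∀ l, ∑ j, ∑ k, pd l (fun η =>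
        (Dphi ρ θ η)⁻¹ j l * jac ρ θ η * (Dphi ρ θ η)⁻¹ j k * pd k w η) ξ =
      ∑ k, pd l (fun η => coeffA ρ θ l k η * pd k w η) ξ := by
    intro l
    rw [Finset.sum_comm]
    refine Finset.sum_congr rfl fun k _ => ?_
    rw [← pd_sum l _ fun j => tflux l j k]
    congr 1
    funext η
    rw [coeffA, Finset.sum_mul]
  have e3 : Qexpr ρ ε θ v ξ = phiSq ρ θ ξ * v ξ + Complex.I * ε * ((sqrtJac ρ θ ξ)⁻¹ *
      ∑ l, ∑ k, pd l (fun η => coeffA ρ θ l k η * pd k w η) ξ) := by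
    rw [Qexpr]
    simp only [← hw, e1, mul_neg, Finset.sum_neg_distrib, ← Finset.mul_sum, e2]
    ring
  have hS := sqrtJac_ne_zero (θ := θ) hρ hn hθ ξ
  rw [e3, divOp, coeffP, hJ, hv']
  field_simp
  ring

end Deformed

/-! ### Construction of the phase -/

/-- If at every point one of `A`, `B` is positive, and `A` dominates at infinity, then a positive
combination `S A + B` with a bounded smooth weight `S` is bounded below. -/
theorem exists_weight {A B : E n → ℝ} (hA : ContDiff ℝ ∞ A) (hB : Continuous B) {R K : ℝ}
    (hfar : ∀ ξ, R ≤ ‖ξ‖ → 1 ≤ A ξ ∧ -(K * A ξ) ≤ B ξ) (hpos : ∀ ξ, 0 < A ξ ∨ 0 < B ξ) :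
    ∃ S : E n → ℝ, IsBdd1 S ∧ ∃ s > 0, ∃ c > 0, ∀ ξ, s ≤ S ξ ∧ c ≤ S ξ * A ξ + B ξ := by
  have hcp := isCompact_closedBall (0 : E n) R
  obtain ⟨A0, hA0⟩ := hcp.exists_bound_of_continuousOn hA.continuous.continuousOn
  obtain ⟨B0, hB0⟩ := hcp.exists_bound_of_continuousOn hB.continuousOn
  -- a uniform lower bound for `max A B`
  obtain ⟨e, he, he1, hmax⟩ : ∃ e > 0, e ≤ 1 ∧ ∀ ξ, e ≤ A ξ ∨ e ≤ B ξ := by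
    have hcont : ContinuousOn (fun ξ => max (A ξ) (B ξ)) (Metric.closedBall (0 : E n) R) :=
      (hA.continuous.max hB).continuousOn
    obtain ⟨e, he, hle⟩ := hcp.exists_forall_le' hcont (a := 0) fun ξ _ => lt_max_iff.2 (hpos ξ)
    refine ⟨min e 1, lt_min he one_pos, min_le_right _ _, fun ξ => ?_⟩
    rcases le_or_gt ‖ξ‖ R with h | h
    · have := hle ξ (by simpa using h)
      rw [le_max_iff] at this
      exact this.imp (fun h => (min_le_left _ _).trans h) fun h => (min_le_left _ _).trans h
    · exact Or.inl ((min_le_right _ _).trans (hfar ξ h.le).1)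
  set A1 := max A0 0 with hA1
  set B1 := max B0 0 with hB1
  have nA : 0 ≤ A1 := le_max_right _ _
  have nB : 0 ≤ B1 := le_max_right _ _
  have bA : ∀ ξ, ‖ξ‖ ≤ R → -A1 ≤ A ξ := fun ξ h => by
    have := (abs_le.1 (hA0 ξ (by simpa using h))).1
    have := le_max_left A0 0
    linarith
  have bB : ∀ ξ, ‖ξ‖ ≤ R → -B1 ≤ B ξ := fun ξ h => by
    have := (abs_le.1 (hB0 ξ (by simpa using h))).1
    have := le_max_left B0 0
    linarith
  set s := e / (2 * (A1 + 1)) with hs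
  have hs0 : 0 < s := by positivity
  set M := s + (B1 / e + 1 + |K| + 1) with hM
  have hsM : s ≤ M := by
    have : 0 ≤ B1 / e + 1 + |K| + 1 := by positivity
    linarith
  set S : E n → ℝ := fun ξ => s + (M - s) * Real.smoothTransition (A ξ / e) with hS
  have hSs : ∀ ξ, s ≤ S ξ := fun ξ => by
    have := mul_nonneg (sub_nonneg.2 hsM) (Real.smoothTransition.nonneg (A ξ / e))
    simp only [hS]
    linarith
  have hSM : ∀ ξ, e ≤ A ξ → S ξ = M := fun ξ h => by
    simp only [hS]
    rw [Real.smoothTransition.one_of_one_le ((one_le_div he).2 h)]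
    ring
  have hSsm : ContDiff ℝ ∞ S :=
    contDiff_const.add (contDiff_const.mul
      ((Real.smoothTransition.contDiff (n := (⊤ : ℕ∞))).comp (hA.div_const e)))
  refine ⟨S, ?_, s, hs0, e / 2, by positivity, fun ξ => ⟨hSs ξ, ?_⟩⟩
  · have h1 : IsBdd1 fun ξ => S ξ + -M := by
      refine IsBdd1.of_hasCompactSupport (hSsm.add contDiff_const)
        (HasCompactSupport.of_support_subset_isCompact hcp fun ξ hξ => ?_)
      rw [mem_closedBall_zero_iff]
      by_contra! hlt
      exact hξ (by simp [hSM ξ (he1.trans (hfar ξ hlt.le).1)])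
    have h2 := h1.add (IsBdd1.const M)
    have e2 : (fun ξ => S ξ + -M + M) = S := by
      funext ξ
      ring
    rwa [e2] at h2
  · rcases le_or_gt e (A ξ) with h1 | h1
    · rw [hSM ξ h1]
      rcases le_or_gt ‖ξ‖ R with h | h
      · have h2 := bB ξ h
        have h3 : (B1 / e + 1) * e ≤ M * A ξ := by
          have : B1 / e + 1 ≤ M := by
            have : 0 ≤ |K| := abs_nonneg K
            linarith
          exact mul_le_mul this h1 he.le (by linarith)
        have h4 : (B1 / e + 1) * e = B1 + e := by field_simp
        linarith
      · obtain ⟨h2, h3⟩ := hfar ξ h.le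
        have h4 : (K + 1) * A ξ ≤ M * A ξ := by
          have : K + 1 ≤ M := by
            have : 0 ≤ B1 / e := by positivity
            linarith [le_abs_self K]
          gcongr
        linarith
    · have h2 : e ≤ B ξ := (hmax ξ).resolve_left (not_le.2 h1)
      rcases le_or_gt 0 (A ξ) with h3 | h3
      · have := mul_nonneg (hs0.le.trans (hSs ξ)) h3
        linarith
      · have hR : ‖ξ‖ ≤ R := by
          by_contra! h
          linarith [(hfar ξ h.le).1]
        have hSe : S ξ = s := by
          simp only [hS]
          rw [Real.smoothTransition.zero_of_nonpos (div_nonpos_of_nonpos_of_nonneg h3.le he.le)]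
          ring
        have h4 := mul_le_mul_of_nonneg_left (bA ξ hR) hs0.le
        have h5 : s * A1 ≤ e / 2 := by
          rw [hs, div_mul_eq_mul_div, div_le_div_iff₀ (by positivity) (by positivity)]
          nlinarith
        rw [hSe]
        linarith

theorem tan_pi_div_eight_pos : 0 < Real.tan (Real.pi / 8) :=
  Real.tan_pos_of_pos_of_lt_pi_div_two (by positivity) (by linarith [Real.pi_pos])

/-- The tangent of `π/8` is the positive root of `t² + 2 t = 1`; this is all that is used of it. -/
theorem tan_pi_div_eight_eq : Real.tan (Real.pi / 8) ^ 2 + 2 * Real.tan (Real.pi / 8) = 1 := by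
  have h := Real.tan_two_mul (x := Real.pi / 8)
  rw [show 2 * (Real.pi / 8) = Real.pi / 4 by ring, Real.tan_pi_div_four] at h
  have hne : 1 - Real.tan (Real.pi / 8) ^ 2 ≠ 0 := by
    intro h0
    rw [h0, div_zero] at h
    exact one_ne_zero h
  rw [eq_div_iff hne] at h
  linarith

/-- The real and imaginary parts of the squared reciprocal `(1 - i b)⁻²` of an eigenvalue. -/
theorem inv_sq_one_sub_I_mul (b : ℝ) : (1 + -(Complex.I * b))⁻¹ ^ 2 =
    (((1 - b ^ 2) / (1 + b ^ 2) ^ 2 : ℝ) : ℂ) +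
      ((2 * b / (1 + b ^ 2) ^ 2 : ℝ) : ℂ) * Complex.I := by
  have h1 : (1 + -(Complex.I * b)) ≠ 0 := by
    intro h
    have := congrArg Complex.re h
    simp at this
  have h2 : ((1 + b ^ 2 : ℝ) : ℂ) ≠ 0 := by
    exact_mod_cast (by positivity : (1 + b ^ 2 : ℝ) ≠ 0)
  have h3 : (1 + -(Complex.I * b)) * (1 + Complex.I * b) = ((1 + b ^ 2 : ℝ) : ℂ) := by
    push_cast
    linear_combination (-(b : ℂ) ^ 2) * Complex.I_sq
  have h4 : (1 + -(Complex.I * b))⁻¹ = (1 + Complex.I * b) / ((1 + b ^ 2 : ℝ) : ℂ) := by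
    rw [eq_div_iff h2, ← h3, inv_mul_cancel_left₀ h1]
  rw [h4, div_pow]
  push_cast at h2 ⊢
  field_simp
  linear_combination ((b : ℂ) ^ 2) * Complex.I_sq

/-- For `0 ≤ b ≤ b₀ < tan(π/8)` the number `(1 - i b)⁻²` stays away from the line `Im = Re`. -/
theorem exists_gap {b₀ : ℝ} (hb0 : 0 ≤ b₀) (hb : b₀ < Real.tan (Real.pi / 8)) :
    ∃ c > 0, ∀ b, 0 ≤ b → b ≤ b₀ →
      c ≤ (1 - b ^ 2) / (1 + b ^ 2) ^ 2 - 2 * b / (1 + b ^ 2) ^ 2 := by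
  have hT := tan_pi_div_eight_pos
  have hT2 := tan_pi_div_eight_eq
  generalize Real.tan (Real.pi / 8) = T at *
  have hg : 0 < 1 - b₀ ^ 2 - 2 * b₀ := by nlinarith
  refine ⟨(1 - b₀ ^ 2 - 2 * b₀) / 4, by positivity, fun b h0 h1 => ?_⟩
  rw [← sub_div, le_div_iff₀ (by positivity)]
  have h2 : b ^ 2 ≤ b₀ ^ 2 := by gcongr
  have h3 : b ^ 2 ≤ 1 := by nlinarith
  have h4 : (1 + b ^ 2) ^ 2 ≤ 4 := by nlinarith [sq_nonneg b]
  calc (1 - b₀ ^ 2 - 2 * b₀) / 4 * (1 + b ^ 2) ^ 2 ≤ (1 - b₀ ^ 2 - 2 * b₀) / 4 * 4 := by gcongr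
    _ ≤ _ := by linarith

/-- A point above the curve `x ↦ x - i β ρ(x)`, `β ≥ 0`, cannot satisfy `λ² = z² + w` with `z` on
the curve and `-π/2 ≤ arg w ≤ -π/4`: such a `λ` is reached from `z` by a displacement of slope at
most `-tan(π/8)`, and the curve is less steep. -/
theorem re_pos_or_of_nonneg {T z₁ z₂ l₁ l₂ : ℝ} (hT : 0 < T) (hT2 : T ^ 2 + 2 * T = 1)
    (hz1 : 0 ≤ z₁) (hz2 : z₂ ≤ 0) (hz : -(T * z₁) ≤ z₂) (hl1 : 0 < l₁) (hl : -(T * l₁) < l₂)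
    (habove : z₁ ≤ l₁ → z₂ - T * (l₁ - z₁) < l₂) :
    0 < (z₁ ^ 2 - z₂ ^ 2) - (l₁ ^ 2 - l₂ ^ 2) ∨
      0 < -((z₁ ^ 2 - z₂ ^ 2) - (l₁ ^ 2 - l₂ ^ 2)) - (2 * z₁ * z₂ - 2 * l₁ * l₂) := by
  by_contra! h
  obtain ⟨hA, hB⟩ := h
  set x := (l₁ ^ 2 - l₂ ^ 2) - (z₁ ^ 2 - z₂ ^ 2) with hx
  set y := 2 * z₁ * z₂ - 2 * l₁ * l₂ with hy
  have hx0 : 0 ≤ x := by linarith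
  have hxy : x ≤ y := by linarith
  have hl2 : l₂ ≤ 0 := by
    by_contra! h
    have h1 : 0 < l₁ * l₂ := mul_pos hl1 h
    have h2 : z₁ * z₂ ≤ 0 := mul_nonpos_of_nonneg_of_nonpos hz1 hz2
    linarith
  set s₁ := l₁ + z₁ with hs1
  set s₂ := l₂ + z₂ with hs2
  have p1 : 0 < s₁ := by linarith
  have p2 : s₂ ≤ 0 := by linarith
  have p3 : -(T * s₁) ≤ s₂ := by
    rw [hs1, hs2]
    linarith
  have hN : 0 < s₁ ^ 2 + s₂ ^ 2 := by positivity
  have e1 : (s₁ ^ 2 + s₂ ^ 2) * (l₁ - z₁) = x * s₁ - y * s₂ := by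
    rw [hx, hy, hs1, hs2]; ring
  have e2 : (s₁ ^ 2 + s₂ ^ 2) * (l₂ - z₂) = -(y * s₁) - x * s₂ := by
    rw [hx, hy, hs1, hs2]; ring
  have hy0 : 0 ≤ y := hx0.trans hxy
  have d1 : 0 ≤ l₁ - z₁ := by
    have : 0 ≤ (s₁ ^ 2 + s₂ ^ 2) * (l₁ - z₁) := by
      rw [e1]
      nlinarith [mul_nonneg hx0 p1.le, mul_nonneg hy0 (neg_nonneg.2 p2)]
    exact nonneg_of_mul_nonneg_right this hN
  have d2 : (l₂ - z₂) + T * (l₁ - z₁) ≤ 0 := by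
    have h1 : (s₁ ^ 2 + s₂ ^ 2) * ((l₂ - z₂) + T * (l₁ - z₁)) =
        -(y * s₁) - x * s₂ + T * (x * s₁) - T * (y * s₂) := by
      rw [mul_add, mul_left_comm, e1, e2]; ring
    have h2 : -(x * s₂) ≤ y * (T * s₁) := by
      have := mul_le_mul hxy (neg_le.1 p3) (neg_nonneg.2 p2) hy0
      linarith
    have h3 : T * (x * s₁) ≤ T * (y * s₁) := by gcongr
    have h4 : -(T * (y * s₂)) ≤ T * (y * (T * s₁)) := by
      have := mul_le_mul_of_nonneg_left (mul_le_mul_of_nonneg_left (neg_le.1 p3) hy0) hT.le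
      linarith
    have h5 : y * s₁ * (T ^ 2 + 2 * T) = y * s₁ := by rw [hT2, mul_one]
    have h6 : (s₁ ^ 2 + s₂ ^ 2) * ((l₂ - z₂) + T * (l₁ - z₁)) ≤ 0 := by
      rw [h1]
      linarith
    by_contra! h7
    have := mul_pos hN h7
    linarith
  have := habove (by linarith)
  linarith

/-- The analogue of `re_pos_or_of_nonneg` for `β < 0`: now `λ` has larger imaginary part than
every point of the curve. -/
theorem re_pos_or_of_neg {T z₁ z₂ l₁ l₂ : ℝ} (hT : 0 < T) (hT2 : T ^ 2 + 2 * T = 1)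
    (hz1 : 0 ≤ z₁) (hz2 : 0 ≤ z₂) (hz : z₂ ≤ T * z₁) (hl1 : 0 < l₁) (hl : z₂ < l₂) :
    0 < (z₁ ^ 2 - z₂ ^ 2) - (l₁ ^ 2 - l₂ ^ 2) - (2 * z₁ * z₂ - 2 * l₁ * l₂) ∨
      0 < -((z₁ ^ 2 - z₂ ^ 2) - (l₁ ^ 2 - l₂ ^ 2)) := by
  by_contra! h
  obtain ⟨hA, hB⟩ := h
  have hll : l₁ * z₂ < l₁ * l₂ := by gcongr
  have h1 : l₁ * l₂ ≤ z₁ * z₂ := by linarith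
  have hlz : l₁ < z₁ := by
    by_contra! h2
    have : z₁ * z₂ ≤ l₁ * z₂ := by gcongr
    linarith
  -- the function `p ↦ Re((1 + i) p²)` increases from `l` to `z`
  have h2 : z₂ ^ 2 < l₂ ^ 2 := by gcongr
  have h3 : 0 ≤ z₁ ^ 2 - z₂ ^ 2 - 2 * z₁ * z₂ := by
    have h4 : z₂ ^ 2 ≤ (T * z₁) ^ 2 := by gcongr
    have h5 : z₁ * z₂ ≤ z₁ * (T * z₁) := by gcongr
    have h6 : z₁ ^ 2 * (T ^ 2 + 2 * T) = z₁ ^ 2 := by rw [hT2, mul_one]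
    nlinarith
  have h7 : l₁ ^ 2 - 2 * l₁ * z₂ ≤ z₁ ^ 2 - 2 * z₁ * z₂ := by
    have h8 : 0 ≤ z₁ - 2 * z₂ := by
      by_contra! h9
      nlinarith [mul_nonneg hz1 hz2, sq_nonneg z₂, mul_nonneg hz1 (by linarith : 0 ≤ 2 * z₂ - z₁)]
    nlinarith [mul_nonneg (sub_nonneg.2 hlz.le) h8, mul_nonneg (sub_nonneg.2 hlz.le) hl1.le]
  linarith

section Phase

variable {γ β : ℝ} {ρ : ℝ → ℝ}

theorem theta_re (β : ℝ) : (-(Complex.I * (β : ℂ))).re = 0 := by simp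

theorem phiSq_sub_re (hρ : IsProfile γ ρ) (β : ℝ) (l : ℂ) (ξ : E n) :
    (phiSq ρ (-(Complex.I * β)) ξ - l ^ 2).re =
      (‖ξ‖ ^ 2 - (-(β * ρ ‖ξ‖)) ^ 2) - (l.re ^ 2 - l.im ^ 2) := by
  rw [phiSq_eq hρ]
  simp [sq]

theorem phiSq_sub_im (hρ : IsProfile γ ρ) (β : ℝ) (l : ℂ) (ξ : E n) :
    (phiSq ρ (-(Complex.I * β)) ξ - l ^ 2).im =
      2 * ‖ξ‖ * (-(β * ρ ‖ξ‖)) - 2 * l.re * l.im := by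
  rw [phiSq_eq hρ]
  simp [sq]
  ring

/-- At infinity `φ_θ²` is dominated by its real part. -/
theorem phiSq_far (hρ : IsProfile γ ρ) (β : ℝ) (l : ℂ) : ∃ R, ∀ ξ : E n, R ≤ ‖ξ‖ →
    2 * |(phiSq ρ (-(Complex.I * β)) ξ - l ^ 2).im| + 1 ≤
      (phiSq ρ (-(Complex.I * β)) ξ - l ^ 2).re := by
  set L := |l.re ^ 2 - l.im ^ 2| + 2 * |2 * l.re * l.im| with hL
  refine ⟨4 * |β| + L + β ^ 2 + 1, fun ξ hξ => ?_⟩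
  rw [phiSq_sub_re hρ, phiSq_sub_im hρ]
  have h0 : 0 ≤ ρ ‖ξ‖ := hρ.nonneg (norm_nonneg _)
  have h1 : ρ ‖ξ‖ ≤ 1 := hρ.le_one (norm_nonneg _)
  have hL0 : 0 ≤ L := by positivity
  have hr1 : 1 ≤ ‖ξ‖ := by nlinarith [abs_nonneg β, sq_nonneg β]
  generalize ‖ξ‖ = r at *
  generalize ρ r = y at *
  have h2 : (β * y) ^ 2 ≤ β ^ 2 := by
    rw [mul_pow]
    have : y ^ 2 ≤ 1 := pow_le_one₀ h0 h1
    nlinarith [sq_nonneg β]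
  have h3 : |2 * r * (-(β * y)) - 2 * l.re * l.im| ≤ 2 * r * |β| + |2 * l.re * l.im| := by
    refine (abs_sub _ _).trans ?_
    gcongr
    rw [abs_mul, abs_neg, abs_mul β, abs_of_nonneg (by positivity : 0 ≤ 2 * r), abs_of_nonneg h0]
    have : |β| * y ≤ |β| := mul_le_of_le_one_right (abs_nonneg _) h1
    gcongr
  have h4 : r * (4 * |β| + L + β ^ 2 + 1) ≤ r * r := by gcongr
  have h5 : L + β ^ 2 + 1 ≤ r * (L + β ^ 2 + 1) := le_mul_of_one_le_left (by positivity) hr1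
  have h6 := le_abs_self (l.re ^ 2 - l.im ^ 2)
  nlinarith

theorem radQuot_nonneg (hρ : IsProfile γ ρ) (ξ : E n) : 0 ≤ radQuot ρ ξ :=
  mul_nonneg (by positivity) (hρ.nonneg (norm_nonneg _))

theorem radQuot_le (hρ : IsProfile γ ρ) {q : ℝ} (hq0 : 0 ≤ q)
    (hq : ∀ t, 0 ≤ t → deriv ρ t ≤ q) (ξ : E n) : radQuot ρ ξ ≤ q := by
  rcases (norm_nonneg ξ).eq_or_lt with h | h
  · rw [radQuot, ← h]
    simpa using hq0
  · rw [radQuot, inv_mul_le_iff₀ h, mul_comm]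
    exact hρ.le_mul hq (norm_nonneg _)

/-- What the argument uses of the position of `λ`: it lies in the right half plane and in the
sector `arg > -π/8`, above the curve `x - i β ρ(x)`, and above its highest point if `β < 0`. -/
structure IsAdmissible (β : ℝ) (ρ : ℝ → ℝ) (l : ℂ) : Prop where
  re_pos : 0 < l.re
  tan_lt : -(Real.tan (Real.pi / 8) * l.re) < l.im
  above : -(β * ρ l.re) < l.im
  high : -β < l.im ∨ 0 ≤ β

/-- A bounded smooth phase that rotates the symbol of `Q_{ε,-iβ} - λ²` into the right half plane. -/
theorem exists_phase (hρ : IsProfile γ ρ) (hγ : 0 < γ) (hβ : |β| < γ) {l : ℂ}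
    (hl : IsAdmissible β ρ l) :
    ∃ κ : E n → ℂ, IsBdd1 κ ∧ ∃ c > 0,
      (∀ ξ, c ≤ (-Complex.I * κ ξ * (eigRad ρ (-(Complex.I * β)) ξ)⁻¹ ^ 2).re) ∧
      (∀ ξ, c ≤ (-Complex.I * κ ξ * (eigTan ρ (-(Complex.I * β)) ξ)⁻¹ ^ 2).re) ∧
      ∀ ξ, c ≤ (κ ξ * (phiSq ρ (-(Complex.I * β)) ξ - l ^ 2)).re := by
  obtain ⟨q, hq0, hqT, hq⟩ := hρ.exists_deriv_le
  have hT := tan_pi_div_eight_pos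
  have hT2 := tan_pi_div_eight_eq
  have hltan := hl.tan_lt
  have hbT : |β| * q < Real.tan (Real.pi / 8) := by
    rw [← div_eq_inv_mul, lt_div_iff₀ hγ] at hqT
    nlinarith
  obtain ⟨g, hg, hgap⟩ := exists_gap (mul_nonneg (abs_nonneg β) hq0) hbT
  generalize Real.tan (Real.pi / 8) = T at *
  obtain ⟨R, hR⟩ := phiSq_far (n := n) hρ β l
  set w : E n → ℂ := fun ξ => phiSq ρ (-(Complex.I * β)) ξ - l ^ 2 with hw
  have hws : ContDiff ℝ ∞ w := (contDiff_phiSq hρ _).sub contDiff_const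
  have hwre : ContDiff ℝ ∞ fun ξ => (w ξ).re := Complex.reCLM.contDiff.comp hws
  have hwim : ContDiff ℝ ∞ fun ξ => (w ξ).im := Complex.imCLM.contDiff.comp hws
  have hrho : ∀ ξ : E n, 0 ≤ ρ ‖ξ‖ ∧ ρ ‖ξ‖ ≤ 1 ∧ ρ ‖ξ‖ ≤ q * ‖ξ‖ := fun ξ =>
    ⟨hρ.nonneg (norm_nonneg _), hρ.le_one (norm_nonneg _), hρ.le_mul hq (norm_nonneg _)⟩
  -- both eigenvalues have the form `1 - i β x` with `0 ≤ x ≤ q`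
  have heig : ∀ x : ℝ, (1 + -(Complex.I * β) * (x : ℂ)) = 1 + -(Complex.I * ((β * x : ℝ) : ℂ)) :=
    fun x => by push_cast; ring
  have hx1 : ∀ ξ : E n, 0 ≤ radDeriv ρ ξ ∧ radDeriv ρ ξ ≤ q := fun ξ =>
    ⟨hρ.deriv_nonneg _ (norm_nonneg _), hq _ (norm_nonneg _)⟩
  have hx2 : ∀ ξ : E n, 0 ≤ radQuot ρ ξ ∧ radQuot ρ ξ ≤ q := fun ξ =>
    ⟨radQuot_nonneg hρ ξ, radQuot_le hρ hq0 hq ξ⟩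
  rcases le_or_gt 0 β with hβ0 | hβ0
  · -- `β ≥ 0`: the phase is `S + (-1 + i)`
    rw [abs_of_nonneg hβ0] at hbT hgap
    have hpos : ∀ ξ, 0 < (w ξ).re ∨ 0 < -(w ξ).re - (w ξ).im := fun ξ => by
      simp only [hw]
      rw [phiSq_sub_re hρ, phiSq_sub_im hρ]
      obtain ⟨h1, h2, h3⟩ := hrho ξ
      have h4 : β * ρ ‖ξ‖ ≤ β * (q * ‖ξ‖) := by gcongr
      have h5 : β * q * ‖ξ‖ ≤ T * ‖ξ‖ := by gcongr
      refine re_pos_or_of_nonneg hT hT2 (norm_nonneg _) (neg_nonpos.2 (mul_nonneg hβ0 h1))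
        (by linarith) hl.re_pos hltan fun hle => lt_of_le_of_lt ?_ hl.above
      have h6 := hρ.sub_le hq (norm_nonneg ξ) hle
      have h7 : β * (ρ l.re - ρ ‖ξ‖) ≤ β * (q * (l.re - ‖ξ‖)) := by gcongr
      have h8 : β * q * (l.re - ‖ξ‖) ≤ T * (l.re - ‖ξ‖) :=
        mul_le_mul_of_nonneg_right hbT.le (sub_nonneg.2 hle)
      linarith
    obtain ⟨S, hS, s, hs, c, hc, hSc⟩ := exists_weight (A := fun ξ => (w ξ).re)
      (B := fun ξ => -(w ξ).re - (w ξ).im) hwre (hwre.continuous.neg.sub hwim.continuous)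
      (R := R) (K := 2) (fun ξ hξ => by
        have h1 := hR ξ hξ
        have h2 := abs_nonneg (w ξ).im
        have h3 := le_abs_self (w ξ).im
        simp only [hw] at h2 h3 ⊢
        constructor <;> linarith) hpos
    have hmu : ∀ (ξ : E n) (x : ℝ), 0 ≤ x → x ≤ q →
        g ≤ (-Complex.I * ((S ξ : ℂ) + (-1 + Complex.I)) *
          (1 + -(Complex.I * β) * (x : ℂ))⁻¹ ^ 2).re := fun ξ x h0 h1 => by
      have h2 := hgap (β * x) (by positivity) (by gcongr)
      rw [heig, inv_sq_one_sub_I_mul]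
      have h3 : 0 ≤ S ξ * (2 * (β * x) / (1 + (β * x) ^ 2) ^ 2) :=
        mul_nonneg (hs.le.trans (hSc ξ).1) (by positivity)
      generalize (1 - (β * x) ^ 2) / (1 + (β * x) ^ 2) ^ 2 = X at *
      generalize 2 * (β * x) / (1 + (β * x) ^ 2) ^ 2 = Y at *
      simp
      linarith
    refine ⟨fun ξ => (S ξ : ℂ) + (-1 + Complex.I), hS.ofReal.add (IsBdd1.const _), min c g,
      lt_min hc hg, fun ξ => ?_, fun ξ => ?_, fun ξ => ?_⟩
    · exact (min_le_right _ _).trans (hmu ξ _ (hx1 ξ).1 (hx1 ξ).2)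
    · exact (min_le_right _ _).trans (hmu ξ _ (hx2 ξ).1 (hx2 ξ).2)
    · refine (min_le_left _ _).trans ((hSc ξ).2.trans (le_of_eq ?_))
      change _ = (((S ξ : ℂ) + (-1 + Complex.I)) * w ξ).re
      simp
      ring
  · -- `β < 0`: the phase is `S (1 + i) - 1`
    rw [abs_of_neg hβ0] at hbT hgap
    have hhigh : -β < l.im := hl.high.resolve_right (not_le.2 hβ0)
    have hpos : ∀ ξ, 0 < (w ξ).re - (w ξ).im ∨ 0 < -(w ξ).re := fun ξ => by
      simp only [hw]
      rw [phiSq_sub_re hρ, phiSq_sub_im hρ]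
      obtain ⟨h1, h2, h3⟩ := hrho ξ
      have h4 : -β * ρ ‖ξ‖ ≤ -β * (q * ‖ξ‖) := by
        have := neg_pos.2 hβ0
        gcongr
      have h5 : -β * q * ‖ξ‖ ≤ T * ‖ξ‖ := by gcongr
      have h6 : -β * ρ ‖ξ‖ ≤ -β * 1 := by
        have := neg_pos.2 hβ0
        gcongr
      exact re_pos_or_of_neg hT hT2 (norm_nonneg _) (by nlinarith) (by linarith) hl.re_pos
        (by linarith)
    obtain ⟨S, hS, s, hs, c, hc, hSc⟩ := exists_weight (A := fun ξ => (w ξ).re - (w ξ).im)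
      (B := fun ξ => -(w ξ).re) (hwre.sub hwim) hwre.continuous.neg
      (R := R) (K := 2) (fun ξ hξ => by
        have h1 := hR ξ hξ
        have h2 := abs_nonneg (w ξ).im
        have h3 := le_abs_self (w ξ).im
        simp only [hw] at h2 h3 ⊢
        constructor <;> linarith) hpos
    have hmu : ∀ (ξ : E n) (x : ℝ), 0 ≤ x → x ≤ q →
        s * g ≤ (-Complex.I * ((S ξ : ℂ) * (1 + Complex.I) + -1) *
          (1 + -(Complex.I * β) * (x : ℂ))⁻¹ ^ 2).re := fun ξ x h0 h1 => by
      have hnb := neg_pos.2 hβ0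
      have h2 := hgap (-β * x) (by positivity) (by gcongr)
      rw [heig, inv_sq_one_sub_I_mul]
      have h3 : 0 ≤ 2 * (-β * x) / (1 + (-β * x) ^ 2) ^ 2 := by positivity
      have e1 : (-β * x) ^ 2 = (β * x) ^ 2 := by ring
      have e2 : 2 * (-β * x) / (1 + (β * x) ^ 2) ^ 2 = -(2 * (β * x) / (1 + (β * x) ^ 2) ^ 2) := by
        ring
      rw [e1, e2] at h2 h3
      generalize (1 - (β * x) ^ 2) / (1 + (β * x) ^ 2) ^ 2 = X at *
      generalize 2 * (β * x) / (1 + (β * x) ^ 2) ^ 2 = Y at *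
      have h4 := mul_le_mul (hSc ξ).1 h2 hg.le (hs.le.trans (hSc ξ).1)
      simp
      linarith
    refine ⟨fun ξ => (S ξ : ℂ) * (1 + Complex.I) + -1,
      (hS.ofReal.mul (IsBdd1.const _)).add (IsBdd1.const _), min c (s * g),
      lt_min hc (mul_pos hs hg), fun ξ => ?_, fun ξ => ?_, fun ξ => ?_⟩
    · exact (min_le_right _ _).trans (hmu ξ _ (hx1 ξ).1 (hx1 ξ).2)
    · exact (min_le_right _ _).trans (hmu ξ _ (hx2 ξ).1 (hx2 ξ).2)
    · refine (min_le_left _ _).trans ((hSc ξ).2.trans (le_of_eq ?_))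
      change _ = (((S ξ : ℂ) * (1 + Complex.I) + -1) * w ξ).re
      simp
      ring

end Phase

/-! ### From estimates on test functions to the resolvent -/

/-- The space of test functions. -/
def testSpace (n : ℕ) : Submodule ℂ (E n → ℂ) where
  carrier := {v | IsTest v}
  zero_mem' := ⟨contDiff_const, HasCompactSupport.zero⟩
  add_mem' hf hg := IsTest.add hf hg
  smul_mem' c _ hf := IsTest.mul_left (contDiff_const (c := c)) hf

/-- The inclusion of the test functions into `L²`. -/
noncomputable def testToL2 (n : ℕ) : testSpace n →ₗ[ℂ] L2 n where
  toFun v := (IsTest.memLp v.2).toLp v.1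
  map_add' _ _ := rfl
  map_smul' _ _ := rfl

theorem coeFn_testToL2 (v : testSpace n) : testToL2 n v =ᵐ[volume] v.1 :=
  MemLp.coeFn_toLp (IsTest.memLp v.2)

theorem norm_testToL2 (v : testSpace n) : ‖testToL2 n v‖ = l2 v.1 := by
  have h : IsTest v.1 := v.2
  exact Lp.norm_toLp v.1 h.memLp

/-- The bilinear pairing `∫ f g` on `L²`, through the inner product. -/
theorem inner_star_eq (f g : L2 n) : inner ℂ (star f) g = ∫ ξ, f ξ * g ξ := by
  rw [L2.inner_def]
  refine integral_congr_ae ?_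
  filter_upwards [Lp.coeFn_star f] with ξ hξ
  rw [hξ]
  simp [mul_comm]

theorem star_add_L2 (f g : L2 n) : star (f + g) = star f + star g := by
  refine Lp.ext ?_
  filter_upwards [Lp.coeFn_star (f + g), Lp.coeFn_add f g, Lp.coeFn_add (star f) (star g),
    Lp.coeFn_star f, Lp.coeFn_star g] with ξ h1 h2 h3 h4 h5
  rw [h1, h3, Pi.star_apply, h2]
  simp [h4, h5]

theorem star_smul_L2 (c : ℂ) (f : L2 n) : star (c • f) = starRingEnd ℂ c • star f := by
  refine Lp.ext ?_
  filter_upwards [Lp.coeFn_star (c • f), Lp.coeFn_smul c f,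
    Lp.coeFn_smul (starRingEnd ℂ c) (star f), Lp.coeFn_star f] with ξ h1 h2 h3 h4
  rw [h1, h3, Pi.star_apply, h2]
  simp [h4]

theorem norm_star_L2 (f : L2 n) : ‖star f‖ = ‖f‖ := by
  rw [Lp.norm_def, Lp.norm_def]
  congr 1
  refine eLpNorm_congr_norm_ae ?_
  filter_upwards [Lp.coeFn_star f] with ξ h
  rw [h]
  simp

/-- The transpose of a bounded operator for the bilinear pairing `∫ f g`. -/
noncomputable def transposeL2 (G : L2 n →L[ℂ] L2 n) : L2 n →L[ℂ] L2 n :=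
  LinearMap.mkContinuous
    { toFun := fun f => star (ContinuousLinearMap.adjoint G (star f))
      map_add' := fun f g => by rw [star_add_L2, map_add, star_add_L2]
      map_smul' := fun c f => by
        rw [star_smul_L2, map_smul, star_smul_L2, Complex.conj_conj]
        rfl }
    ‖ContinuousLinearMap.adjoint G‖ fun f => by
      simp only [LinearMap.coe_mk, AddHom.coe_mk]
      rw [norm_star_L2, ← norm_star_L2 f]
      exact ContinuousLinearMap.le_opNorm _ _

theorem integral_transposeL2 (G : L2 n →L[ℂ] L2 n) (f g : L2 n) :
    ∫ ξ, transposeL2 G f ξ * g ξ = ∫ ξ, f ξ * G g ξ := by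
  rw [← inner_star_eq, ← inner_star_eq]
  change inner ℂ (star (star (ContinuousLinearMap.adjoint G (star f)))) g = _
  rw [star_star, ContinuousLinearMap.adjoint_inner_left]

section Resolvent

variable {γ : ℝ} {ρ : ℝ → ℝ} {θ : ℂ}

theorem isTest_Qexpr (hρ : IsProfile γ ρ) (hn : 1 ≤ n) (hθ : θ.re = 0) (ε : ℝ)
    {v : E n → ℂ} (hv : IsTest v) : IsTest (Qexpr ρ ε θ v) := by
  have hsm : ContDiff ℝ ∞ fun ξ : E n => (sqrtJac ρ θ ξ)⁻¹ :=
    (contDiff_sqrtJac hρ hθ).inv fun ξ => sqrtJac_ne_zero hρ hn hθ ξ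
  have tw : IsTest fun η => (sqrtJac ρ θ η)⁻¹ * v η := IsTest.mul_left hsm hv
  have e : Qexpr ρ ε θ v = fun ξ => (sqrtJac ρ θ ξ)⁻¹ *
      divOp ε (coeffA ρ θ) (coeffP ρ θ 0) (fun η => (sqrtJac ρ θ η)⁻¹ * v η) ξ := by
    funext ξ
    rw [← Qexpr_sub_eq hρ hn hθ ε 0 hv, zero_mul, sub_zero]
  rw [e]
  refine IsTest.mul_left hsm ?_
  refine (IsTest.mul_left (contDiff_coeffP hρ hn θ 0) tw).add (IsTest.mul_left contDiff_const ?_)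
  exact IsTest.sum fun l => IsTest.sum fun k =>
    (IsTest.mul_left (isBdd1_coeffA hρ hn hθ l k).smooth (tw.pd k)).pd l

theorem isTest_Qexpr_sub (hρ : IsProfile γ ρ) (hn : 1 ≤ n) (hθ : θ.re = 0) (ε : ℝ) (μ : ℂ)
    {v : E n → ℂ} (hv : IsTest v) : IsTest fun ξ => Qexpr ρ ε θ v ξ - μ * v ξ :=
  (isTest_Qexpr hρ hn hθ ε hv).sub (IsTest.mul_left contDiff_const hv)

/-- `v ↦ Q_{ε,θ} v - μ v` is additive and homogeneous; this is read off from its divergence form. -/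
theorem Qexpr_sub_linear (hρ : IsProfile γ ρ) (hn : 1 ≤ n) (hθ : θ.re = 0) (ε : ℝ) (μ : ℂ)
    {v w : E n → ℂ} (hv : IsTest v) (hw : IsTest w) (c : ℂ) (ξ : E n) :
    Qexpr ρ ε θ (fun η => c * v η + w η) ξ - μ * (c * v ξ + w ξ) =
      c * (Qexpr ρ ε θ v ξ - μ * v ξ) + (Qexpr ρ ε θ w ξ - μ * w ξ) := by
  have hcv : IsTest fun η => c * v η := IsTest.mul_left contDiff_const hv
  have hsm : ContDiff ℝ ∞ fun ξ : E n => (sqrtJac ρ θ ξ)⁻¹ :=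
    (contDiff_sqrtJac hρ hθ).inv fun ξ => sqrtJac_ne_zero hρ hn hθ ξ
  have tv : IsTest fun η => (sqrtJac ρ θ η)⁻¹ * v η := IsTest.mul_left hsm hv
  have tw : IsTest fun η => (sqrtJac ρ θ η)⁻¹ * w η := IsTest.mul_left hsm hw
  rw [Qexpr_sub_eq hρ hn hθ ε μ hv, Qexpr_sub_eq hρ hn hθ ε μ hw,
    Qexpr_sub_eq hρ hn hθ ε μ (hcv.add hw)]
  set V : E n → ℂ := fun η => (sqrtJac ρ θ η)⁻¹ * v η with hV
  set W : E n → ℂ := fun η => (sqrtJac ρ θ η)⁻¹ * w η with hW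
  have e0 : (fun η => (sqrtJac ρ θ η)⁻¹ * (c * v η + w η)) = fun η => c * V η + W η := by
    funext η
    simp only [hV, hW]
    ring
  have tcV : IsTest fun η => c * V η := IsTest.mul_left contDiff_const tv
  have e1 : ∀ k, pd k (fun η => c * V η + W η) = fun η => c * pd k V η + pd k W η := fun k => by
    funext η
    rw [pd_add k (tcV.differentiableAt η) (tw.differentiableAt η),
      pd_const_mul k c (tv.differentiableAt η)]
  have e2 : ∀ l k, pd l (fun η => coeffA ρ θ l k η * pd k (fun η => c * V η + W η) η) ξ =
      c * pd l (fun η => coeffA ρ θ l k η * pd k V η) ξ +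
        pd l (fun η => coeffA ρ θ l k η * pd k W η) ξ := fun l k => by
    have f1 : IsTest fun η => coeffA ρ θ l k η * pd k V η :=
      IsTest.mul_left (isBdd1_coeffA hρ hn hθ l k).smooth (tv.pd k)
    have f2 : IsTest fun η => coeffA ρ θ l k η * pd k W η :=
      IsTest.mul_left (isBdd1_coeffA hρ hn hθ l k).smooth (tw.pd k)
    have f3 : IsTest fun η => c * (coeffA ρ θ l k η * pd k V η) :=
      IsTest.mul_left contDiff_const f1
    have : (fun η => coeffA ρ θ l k η * pd k (fun η => c * V η + W η) η) =
        fun η => c * (coeffA ρ θ l k η * pd k V η) + coeffA ρ θ l k η * pd k W η := by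
      funext η
      rw [e1]
      ring
    rw [this, pd_add l (f3.differentiableAt ξ) (f2.differentiableAt ξ),
      pd_const_mul l c (f1.differentiableAt ξ)]
  rw [e0]
  simp only [divOp, e2, Finset.sum_add_distrib, ← Finset.mul_sum]
  ring

/-- The operator `Q_{ε,θ} - μ` as an endomorphism of the space of test functions. -/
noncomputable def testEnd (hρ : IsProfile γ ρ) (hn : 1 ≤ n) (hθ : θ.re = 0) (ε : ℝ) (μ : ℂ) :
    testSpace n →ₗ[ℂ] testSpace n where
  toFun v := ⟨fun ξ => Qexpr ρ ε θ v.1 ξ - μ * v.1 ξ, isTest_Qexpr_sub hρ hn hθ ε μ v.2⟩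
  map_add' v w := Subtype.ext <| funext fun ξ => by
    have := Qexpr_sub_linear hρ hn hθ ε μ v.2 w.2 1 ξ
    simp only [one_mul] at this
    exact this
  map_smul' c v := Subtype.ext <| funext fun ξ => by
    have h0 : IsTest fun _ : E n => (0 : ℂ) := (testSpace n).zero_mem
    have h1 := Qexpr_sub_linear hρ hn hθ ε μ v.2 h0 c ξ
    have h2 := Qexpr_sub_linear hρ hn hθ ε μ h0 h0 1 ξ
    simp only [mul_zero, add_zero, one_mul, sub_zero] at h1 h2
    have h3 : Qexpr ρ ε θ (fun _ => 0) ξ = 0 := left_eq_add.1 h2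
    rw [h3, add_zero] at h1
    exact h1

/-- The operator `Q_{ε,θ} - μ` on test functions, with values in `L²`. -/
noncomputable def testOp (hρ : IsProfile γ ρ) (hn : 1 ≤ n) (hθ : θ.re = 0) (ε : ℝ) (μ : ℂ) :
    testSpace n →ₗ[ℂ] L2 n :=
  testToL2 n ∘ₗ testEnd hρ hn hθ ε μ

/-- A spectral parameter is in the resolvent set as soon as `Q_{ε,θ} - μ` is bounded below on test
functions and only `0` annihilates its range there: the resolvent is the transpose of the
continuous extension of `(Q_{ε,θ} - μ) v ↦ v`. -/
theorem notMem_opSpectrum (hρ : IsProfile γ ρ) (hn : 1 ≤ n) (hθ : θ.re = 0) {ε : ℝ} {μ : ℂ}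
    {K : ℝ} (hbound : ∀ v : E n → ℂ, IsTest v →
      l2 v ≤ K * l2 (fun ξ => Qexpr ρ ε θ v ξ - μ * v ξ))
    (hann : ∀ w : E n → ℂ, MemLp w 2 →
      (∀ v, IsTest v → ∫ ξ, w ξ * (Qexpr ρ ε θ v ξ - μ * v ξ) = 0) → w =ᵐ[volume] 0) :
    μ ∉ opSpectrum (Qop n ρ ε θ) := by
  have hTint : ∀ (f : L2 n) (v : testSpace n), ∫ ξ, f ξ * testOp hρ hn hθ ε μ v ξ =
      ∫ ξ, f ξ * (Qexpr ρ ε θ v.1 ξ - μ * v.1 ξ) := fun f v => by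
    refine integral_congr_ae ?_
    filter_upwards [coeFn_testToL2 ⟨_, isTest_Qexpr_sub hρ hn hθ ε μ v.2⟩] with ξ hξ
    exact congrArg (f ξ * ·) hξ
  have hVint : ∀ (f : L2 n) (v : testSpace n), ∫ ξ, f ξ * testToL2 n v ξ =
      ∫ ξ, f ξ * v.1 ξ := fun f v => by
    refine integral_congr_ae ?_
    filter_upwards [coeFn_testToL2 v] with ξ hξ
    rw [hξ]
  have hzero : ∀ f : L2 n, (∀ v : testSpace n, ∫ ξ, f ξ * testOp hρ hn hθ ε μ v ξ = 0) →
      f = 0 := fun f hf => by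
    refine Lp.ext ((hann f (Lp.memLp f) fun v hv => ?_).trans (Lp.coeFn_zero _ _ _).symm)
    rw [← hTint f ⟨v, hv⟩]
    exact hf ⟨v, hv⟩
  have hdense : DenseRange (testOp hρ hn hθ ε μ) := by
    have : (LinearMap.range (testOp hρ hn hθ ε μ)).topologicalClosure = ⊤ := by
      rw [Submodule.topologicalClosure_eq_top_iff, Submodule.eq_bot_iff]
      intro f hf
      have h0 : star f = 0 := hzero _ fun v => by
        rw [← inner_star_eq, star_star]
        exact Submodule.inner_left_of_mem_orthogonal (LinearMap.mem_range_self _ v) hf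
      rw [← star_star f, h0]
      refine Lp.ext ?_
      filter_upwards [Lp.coeFn_star (0 : L2 n), Lp.coeFn_zero ℂ 2 (volume : Measure (E n))]
        with ξ h1 h2
      rw [h1, Pi.star_apply, h2]
      simp
    rw [DenseRange, ← LinearMap.coe_range]
    exact Submodule.dense_iff_topologicalClosure_eq_top.2 this
  have hnorm : ∀ v : testSpace n, ‖testToL2 n v‖ ≤ K * ‖testOp hρ hn hθ ε μ v‖ := fun v => by
    have h1 : ‖testOp hρ hn hθ ε μ v‖ = l2 (fun ξ => Qexpr ρ ε θ v.1 ξ - μ * v.1 ξ) :=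
      norm_testToL2 ⟨_, isTest_Qexpr_sub hρ hn hθ ε μ v.2⟩
    rw [norm_testToL2, h1]
    exact hbound v.1 v.2
  set G : L2 n →L[ℂ] L2 n := (testToL2 n).extendOfNorm (testOp hρ hn hθ ε μ) with hG
  have hGT : ∀ v, G (testOp hρ hn hθ ε μ v) = testToL2 n v := fun v =>
    LinearMap.extendOfNorm_eq hdense ⟨K, hnorm⟩ v
  have hR : ∀ (f : L2 n) (v : testSpace n),
      ∫ ξ, transposeL2 G f ξ * testOp hρ hn hθ ε μ v ξ = ∫ ξ, f ξ * v.1 ξ := fun f v => by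
    rw [integral_transposeL2, hGT, hVint]
  have hmul : ∀ (u : L2 n) {v : E n → ℂ}, IsTest v → Integrable fun ξ => u ξ * v ξ :=
    fun u v hv => integrable_mul_test u hv
  have hcomb : ∀ (f u : L2 n) (z : ℂ) {v : E n → ℂ}, IsTest v →
      ∫ ξ, (f + z • u : L2 n) ξ * v ξ = (∫ ξ, f ξ * v ξ) + z * ∫ ξ, u ξ * v ξ :=
    fun f u z v hv => by
      rw [← integral_const_mul, ← integral_add (hmul f hv) ((hmul u hv).const_mul z)]
      refine integral_congr_ae ?_
      filter_upwards [Lp.coeFn_add f (z • u), Lp.coeFn_smul z u] with ξ h1 h2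
      rw [h1, Pi.add_apply, h2, Pi.smul_apply, smul_eq_mul]
      ring
  have hQsplit : ∀ (u : L2 n) {v : E n → ℂ}, IsTest v →
      ∫ ξ, u ξ * (Qexpr ρ ε θ v ξ - μ * v ξ) =
        (∫ ξ, u ξ * Qexpr ρ ε θ v ξ) - μ * ∫ ξ, u ξ * v ξ := fun u v hv => by
    rw [← integral_const_mul, ← integral_sub (hmul u (isTest_Qexpr hρ hn hθ ε hv))
      ((hmul u hv).const_mul μ)]
    refine integral_congr_ae (.of_forall fun ξ => ?_)
    simp only
    ring
  rw [opSpectrum, Set.mem_ofPred_eq, not_not]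
  refine ⟨transposeL2 G, fun f => ?_, fun u => ?_⟩
  · have hmem : (transposeL2 G f, f + μ • transposeL2 G f) ∈ (Qop n ρ ε θ).graph := by
      rw [graph_Qop]
      intro v hv
      refine ⟨hmul _ (isTest_Qexpr hρ hn hθ ε hv), ?_⟩
      have h1 := hR f ⟨v, hv⟩
      rw [hTint, hQsplit _ hv] at h1
      simp only at h1 ⊢
      rw [hcomb _ _ _ hv, ← h1]
      ring
    rw [LinearPMap.mem_graph_iff] at hmem
    obtain ⟨u, hu1, hu2⟩ := hmem
    simp only at hu1 hu2
    refine ⟨u, hu1, ?_⟩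
    rw [hu2, hu1]
    abel
  · have hmem : ((u : L2 n), Qop n ρ ε θ u) ∈ (Qop n ρ ε θ).graph := LinearPMap.mem_graph _ u
    rw [graph_Qop] at hmem
    refine sub_eq_zero.1 (hzero _ fun v => ?_)
    set f := Qop n ρ ε θ u - μ • (u : L2 n) with hf
    have h1 := hR f v
    obtain ⟨-, h2⟩ := hmem v.1 v.2
    simp only at h2
    have h3 : ∫ ξ, f ξ * v.1 ξ = ∫ ξ, (u : L2 n) ξ * testOp hρ hn hθ ε μ v ξ := by
      rw [hTint, hQsplit _ v.2, h2, hf, sub_eq_add_neg, ← neg_smul, hcomb _ _ _ v.2]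
      ring
    have h4 : ∀ (f g h : L2 n), ∫ ξ, (f - g : L2 n) ξ * h ξ =
        (∫ ξ, f ξ * h ξ) - ∫ ξ, g ξ * h ξ := fun f g h => by
      have hi : ∀ f : L2 n, Integrable fun ξ => f ξ * h ξ := fun f =>
        (Lp.memLp f).integrable_mul (Lp.memLp h)
      rw [← integral_sub (hi f) (hi g)]
      refine integral_congr_ae ?_
      filter_upwards [Lp.coeFn_sub f g] with ξ hξ
      simp only [hξ, Pi.sub_apply]
      ring
    rw [h4, h1, h3, sub_self]

end Resolvent

/-! ### Uniformity in the spectral parameter -/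

section Main

variable {γ β : ℝ} {ρ : ℝ → ℝ}

/-- Around an admissible point, `ε₀` can be chosen uniformly. -/
theorem exists_eps_near (hn : 1 ≤ n) (hρ : IsProfile γ ρ) (hγ : 0 < γ) (hβ : |β| < γ) {l₀ : ℂ}
    (hl : IsAdmissible β ρ l₀) :
    ∃ U ∈ nhds l₀, ∃ ε₀ > 0, ∀ ε, 0 < ε → ε < ε₀ → ∀ l ∈ U,
      l ^ 2 ∉ opSpectrum (Qop n ρ ε (-(Complex.I * (β : ℂ)))) := by
  obtain ⟨κ, hκ, c, hc, h1, h2, h3⟩ := exists_phase (n := n) hρ hγ hβ hl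
  have hθ := theta_re β
  set θ : ℂ := -(Complex.I * (β : ℂ)) with hθd
  obtain ⟨C, hC⟩ := exists_isMultiplier hρ hn hθ hκ (half_pos hc).le
    (fun ξ => (half_le_self hc.le).trans (h1 ξ)) (fun ξ => (half_le_self hc.le).trans (h2 ξ))
  obtain ⟨B, hB⟩ := hκ.bdd
  have hB0 : 0 ≤ B := (norm_nonneg _).trans (hB 0)
  have hmult0 := hC (l₀ ^ 2) fun ξ => (half_le_self hc.le).trans (h3 ξ)
  have hC0 := hmult0.C_nonneg
  obtain ⟨ε₁, hε₁, hbd⟩ := exists_eps_bounded_below n hC0 (half_pos hc)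
  obtain ⟨ε₂, hε₂, han⟩ := exists_eps_annihilator n hC0 (half_pos hc)
  have hU : {l : ℂ | B * ‖l ^ 2 - l₀ ^ 2‖ < c / 2} ∈ nhds l₀ := by
    refine (isOpen_lt (by fun_prop) continuous_const).mem_nhds ?_
    simp [hc]
  refine ⟨_, hU, min ε₁ ε₂, lt_min hε₁ hε₂, fun ε hε hlt l hlU => ?_⟩
  have hmult := hC (l ^ 2) fun ξ => by
    have e : κ ξ * (phiSq ρ θ ξ - l ^ 2) =
      κ ξ * (phiSq ρ θ ξ - l₀ ^ 2) - κ ξ * (l ^ 2 - l₀ ^ 2) := by ring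
    have h4 : (κ ξ * (l ^ 2 - l₀ ^ 2)).re ≤ B * ‖l ^ 2 - l₀ ^ 2‖ := by
      refine (Complex.re_le_norm _).trans ?_
      rw [norm_mul]
      exact mul_le_mul_of_nonneg_right (hB ξ) (norm_nonneg _)
    have h5 : B * ‖l ^ 2 - l₀ ^ 2‖ < c / 2 := hlU
    rw [e, Complex.sub_re]
    linarith [h3 ξ]
  have hsm : ContDiff ℝ ∞ fun ξ : E n => (sqrtJac ρ θ ξ)⁻¹ :=
    (contDiff_sqrtJac hρ hθ).inv fun ξ => sqrtJac_ne_zero hρ hn hθ ξ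
  have hS0 := fun ξ : E n => sqrtJac_ne_zero hρ hn hθ ξ
  have hSsq : ∀ ξ : E n, ‖sqrtJac ρ θ ξ‖ ^ 2 = ‖jac ρ θ ξ‖ := fun ξ => by
    rw [← norm_pow, sqrtJac_sq hρ hn]
  have hS1 : ∀ ξ : E n, 1 ≤ ‖sqrtJac ρ θ ξ‖ := fun ξ => by
    have := one_le_norm_jac hρ hn hθ ξ
    rw [← hSsq] at this
    exact (one_le_sq_iff₀ (norm_nonneg _)).1 this
  obtain ⟨J, hJ⟩ := (isBdd1_jac (n := n) hρ hn θ).bdd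
  have hJ1 : 1 ≤ J := (one_le_norm_jac hρ hn hθ 0).trans (hJ 0)
  have hSJ : ∀ ξ : E n, ‖sqrtJac ρ θ ξ‖ ≤ J := fun ξ => by
    refine le_trans ?_ ((hSsq ξ).le.trans (hJ ξ))
    exact le_self_pow₀ (hS1 ξ) two_ne_zero
  have tdiv : ∀ {v : E n → ℂ}, IsTest v → IsTest fun η => (sqrtJac ρ θ η)⁻¹ * v η :=
    fun hv => IsTest.mul_left hsm hv
  refine notMem_opSpectrum (K := J * (2 * C / (c / 2) * J)) hρ hn hθ (fun v hv => ?_)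
    fun w hw hann => ?_
  · set V : E n → ℂ := fun η => (sqrtJac ρ θ η)⁻¹ * v η with hV
    have tV : IsTest V := tdiv hv
    have b1 : l2 v ≤ J * l2 V := by
      have := l2_mul_le tV.memLp (by linarith) hSJ
      have e : (fun ξ => sqrtJac ρ θ ξ * V ξ) = v := by
        funext ξ
        simp only [hV]
        rw [mul_inv_cancel_left₀ (hS0 ξ)]
      rwa [e] at this
    have b2 := hbd _ _ _ hmult ε hε (hlt.trans_le (min_le_left _ _)) V tV
    have b3 : l2 (divOp ε (coeffA ρ θ) (coeffP ρ θ (l ^ 2)) V) ≤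
        J * l2 (fun ξ => Qexpr ρ ε θ v ξ - l ^ 2 * v ξ) := by
      have := l2_mul_le (isTest_Qexpr_sub hρ hn hθ ε (l ^ 2) hv).memLp (by linarith) hSJ
      have e : (fun ξ => sqrtJac ρ θ ξ * (Qexpr ρ ε θ v ξ - l ^ 2 * v ξ)) =
          divOp ε (coeffA ρ θ) (coeffP ρ θ (l ^ 2)) V := by
        funext ξ
        rw [Qexpr_sub_eq hρ hn hθ ε (l ^ 2) hv, mul_inv_cancel_left₀ (hS0 ξ)]
      rwa [e] at this
    have hJ0 : 0 ≤ J := by linarith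
    have hK0 : 0 ≤ 2 * C / (c / 2) := by positivity
    calc l2 v ≤ J * l2 V := b1
      _ ≤ J * (2 * C / (c / 2) * (J * l2 (fun ξ => Qexpr ρ ε θ v ξ - l ^ 2 * v ξ))) := by
        gcongr
        exact b2.trans (by gcongr)
      _ = _ := by ring
  · have hW : MemLp (fun ξ => (sqrtJac ρ θ ξ)⁻¹ * w ξ) 2 :=
      hw.of_le_mul (c := 1) (hsm.continuous.aestronglyMeasurable.mul hw.1) (.of_forall fun ξ => by
        rw [norm_mul, norm_inv]
        exact mul_le_mul_of_nonneg_right (inv_le_one_of_one_le₀ (hS1 ξ)) (norm_nonneg _))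
    have h0 := han _ _ _ hmult ε hε (hlt.trans_le (min_le_right _ _)) _ hW fun v hv => by
      have tv : IsTest fun ξ => sqrtJac ρ θ ξ * v ξ :=
        IsTest.mul_left (contDiff_sqrtJac hρ hθ) hv
      rw [← hann _ tv]
      refine integral_congr_ae (.of_forall fun ξ => ?_)
      simp only
      rw [Qexpr_sub_eq hρ hn hθ ε (l ^ 2) tv]
      have e : (fun η => (sqrtJac ρ θ η)⁻¹ * (sqrtJac ρ θ η * v η)) = v := by
        funext η
        rw [inv_mul_cancel_left₀ (hS0 η)]
      rw [e]
      ring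
    filter_upwards [h0] with ξ hξ
    simpa [hS0 ξ] using hξ

theorem isAdmissible_of_mem_closure {a' a γ' b : ℝ}
    (hsector : CompactlyIn (rect a' a γ' b) sector) (hβ : γ' < β)
    (hρβ : CompactlyIn (rect a' a γ' b) (regionAbove β ρ)) {l : ℂ}
    (hl : l ∈ closure (rect a' a γ' b)) : IsAdmissible β ρ l := by
  obtain ⟨hre, habove⟩ := hρβ.2 hl
  obtain ⟨hne, harg, -⟩ := hsector.2 hl
  refine ⟨hre, ?_, habove, Or.inl ?_⟩
  · have h1 : |l.arg| < Real.pi / 2 := Complex.abs_arg_lt_pi_div_two_iff.2 (Or.inl hre)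
    have h2 := Real.tan_lt_tan_of_lt_of_lt_pi_div_two (x := -(Real.pi / 8)) (y := l.arg)
      (by linarith [Real.pi_pos]) (abs_lt.1 h1).2 harg
    rw [Complex.tan_arg, Real.tan_neg, lt_div_iff₀ hre] at h2
    linarith
  · have hcl : IsClosed {z : ℂ | -γ' ≤ z.im} := isClosed_le continuous_const Complex.continuous_im
    have : closure (rect a' a γ' b) ⊆ {z : ℂ | -γ' ≤ z.im} :=
      closure_minimal (fun z hz => le_of_lt hz.2.2.1) hcl
    have h3 : -γ' ≤ l.im := this hl
    linarith

end Main

end CAP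

theorem proposition2 (n : ℕ) (hn : 1 ≤ n) (γ γ' a' a b : ℝ) (hγ : 0 < γ) (hγ' : γ' < γ)
    (ha' : 0 < a') (haa : a' < a) (hab : a < b)
    (hsector : CAP.CompactlyIn (CAP.rect a' a γ' b) CAP.sector)
    (ρ : ℝ → ℝ) (hρ : CAP.IsProfile γ ρ)
    (hργ : CAP.CompactlyIn (CAP.rect a' a γ' b) (CAP.regionAbove γ ρ))
    (β : ℝ) (hβ : γ' < β) (hβγ : β < γ) (hβγ' : -γ < β)
    (hρβ : CAP.CompactlyIn (CAP.rect a' a γ' b) (CAP.regionAbove β ρ)) :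
    ∃ ε₀ : ℝ, 0 < ε₀ ∧ ∀ ε : ℝ, 0 < ε → ε < ε₀ →
      CAP.opSpectrum (CAP.Qop n ρ ε (-(Complex.I * (β : ℂ)))) ∩
        ((fun l : ℂ => l ^ 2) '' CAP.rect a' a γ' b) = ∅ := by
  have key : ∃ ε₀ : ℝ, 0 < ε₀ ∧ ∀ ε : ℝ, 0 < ε → ε < ε₀ →
      ∀ l ∈ closure (CAP.rect a' a γ' b),
        l ^ 2 ∉ CAP.opSpectrum (CAP.Qop n ρ ε (-(Complex.I * (β : ℂ)))) := by
    refine hsector.1.induction_on (p := fun s => ∃ ε₀ : ℝ, 0 < ε₀ ∧ ∀ ε : ℝ, 0 < ε → ε < ε₀ →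
      ∀ l ∈ s, l ^ 2 ∉ CAP.opSpectrum (CAP.Qop n ρ ε (-(Complex.I * (β : ℂ))))) ?_ ?_ ?_ ?_
    · exact ⟨1, one_pos, fun _ _ _ l hl => absurd hl (Set.notMem_empty l)⟩
    · rintro s t hst ⟨e, he, h⟩
      exact ⟨e, he, fun ε h1 h2 l hl => h ε h1 h2 l (hst hl)⟩
    · rintro s t ⟨e, he, h⟩ ⟨e', he', h'⟩
      refine ⟨min e e', lt_min he he', fun ε h1 h2 l hl => ?_⟩
      exact hl.elim (h ε h1 (h2.trans_le (min_le_left _ _)) l)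
        (h' ε h1 (h2.trans_le (min_le_right _ _)) l)
    · intro l hl
      obtain ⟨U, hU, e, he, h⟩ := CAP.exists_eps_near hn hρ hγ (abs_lt.2 ⟨hβγ', hβγ⟩)
        (CAP.isAdmissible_of_mem_closure hsector hβ hρβ hl)
      exact ⟨U, mem_nhdsWithin_of_mem_nhds hU, e, he, h⟩
  obtain ⟨ε₀, hε₀, h⟩ := key
  refine ⟨ε₀, hε₀, fun ε h1 h2 => Set.eq_empty_iff_forall_notMem.2 ?_⟩
  rintro _ ⟨hz, l, hl, rfl⟩
  exact h ε h1 h2 l (subset_closure hl) hz
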